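/- Fix $T,K\in\mathbb N$ and $\gamma>0$. Let $(x_i,y_i)$, $i\ge 1$, be i.i.d.; $x_i\in\mathbb R^{T\times K}$ has law $H$ (for example with a density $h$), and given $x_i=x$ the vector $y_i\in\mathbb R^T$ has a density $g(\cdot|x)$. For $\theta=(\beta,\sigma_\alpha^2,\sigma_\varepsilon^2)\in\mathbb R^{K+2}$ let $\Omega=\sigma_\varepsilon^2 I_T+\sigma_\alpha^2 e_Te_T^{\top}$ ($e_T$ the vector of ones), $B_\theta(x,y)=(y-x\beta)^{\top}\Omega^{-1}(y-x\beta)$ and let $$f_\theta(y|x)=(2\pi)^{-T/2}|\Omega|^{-1/2}\exp\{-\tfrac12 B_\theta(x,y)\}$$ be the density of the linear random-effects panel model with normal effects and errors. Let $\Theta_0\subseteq\{\sigma_\alpha^2\ge0,\ \sigma_\varepsilon^2>0\}$ be the parameter space. The density $g$ need not belong to $\{f_\theta\}$. Put $u_\theta=\partial_\theta\log f_\theta$, $I_\theta=-\partial_\theta u_\theta$, and, for an individual with covariates $x_i$, $$J^{(i)}(\theta)=\int u_\theta u_\theta^{\top}f_\theta^{1+\gamma}\,dy+\int (I_\theta-\gamma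 u_\theta u_\theta^{\top})(g-f_\theta)f_\theta^{\gamma}\,dy,$$ $$\xi^{(i)}(\theta)=\int u_\theta f_\theta^\gamma g\,dy,\qquad K^{(i)}(\theta)=\int u_\theta u_\theta^{\top}f_\theta^{2\gamma}g\,dy-\xi^{(i)}(\theta)\,\xi^{(i)}(\theta)^{\top},$$ all functions being evaluated at $(y|x_i)$. The empirical density power divergence of the first $N$ individuals is, up to a term free of $\theta$, $$\widehat d_N(\theta)=\frac1N\sum_{i\le N}\int f_\theta^{1+\gamma}(y|x_i)\,dy-\frac{1+\gamma}{N\gamma}\sum_{i\le N}f_\theta^\gamma(y_i|x_i),$$ and the MDPDE estimating equations are $\partial_\theta\widehat d_N(\theta)=0$. Let $\theta_0\in\Theta_0$ be best-fitting, that is, let it minimize over $\Theta_0$ the $\theta$-dependent part of the density power divergence, $\int\!\int\{f_\theta^{1+\gamma}-(1+\frac1\gamma)f_\theta^\gamma g\}\,dy\,dH(x)$. Assume: (A1) for $H$-almost every $x$ the distribution $g(y|x)\,dy$ has full support $\mathbb R^T$; (A2) there is an open set $\omega\subseteq\Theta_0$ with $\theta_0\in\omega$ such that $J(\theta)=\lim_N\frac1N\sum_{i\le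 N}J^{(i)}(\theta)$ (an almost sure limit) is positive definite for every $\theta\in\omega$; (A3) there are functions $M_{jkl}(x,y)$, integrable with respect to $g(y|x)\,dy\,dH(x)$, such that for almost every $(x,y)$ under that distribution, all $\theta\in\omega$ and all $j,k,l$, $$\left|\frac{\partial^3}{\partial\theta_j\partial\theta_k\partial\theta_l}\exp\{-\tfrac\gamma2 B_\theta(x,y)\}\right|\le M_{jkl}(x,y).$$ Write $J=J(\theta_0)$ and $K=\lim_N\frac1N\sum_{i\le N}K^{(i)}(\theta_0)$ (an almost sure limit). Then there are estimators $\widehat\theta_N$ (measurable functions of $(x_1,y_1),\dots,(x_N,y_N)$) such that the probability that $\widehat\theta_N\in\Theta_0$ and $\widehat\theta_N$ solves the estimating equations tends to $1$, and such that (i) $\widehat\theta_N\to\theta_0$ in probability; (ii) if, almost surely, $\theta_0$ solves the expected estimating equations given the covariates, $$\sum_{i\le N}\Big[\int u_\theta(y|x_i)f_\theta^{\gamma}(y|x_i)g(y|x_i)\,dy-\int u_\theta(y|x_i)f_\theta^{1+\gamma}(y|x_i)\,dy\Big]=0,\qquad(*)$$ for every $N$, then $\sqrt N(\widehat\theta_N-\theta_0)\to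 N_{K+2}(0,J^{-1}KJ^{-1})$ in distribution. More generally, for any random vectors $\theta_N$ with $\theta_N\to\theta_0$ in probability that lie in $\Theta_0$ and solve $(*)$ with probability tending to $1$ (best-fitting parameters given the covariates), $\sqrt N(\widehat\theta_N-\theta_N)\to N_{K+2}(0,J^{-1}KJ^{-1})$ in distribution. -/

import Mathlib

open MeasureTheory ProbabilityTheory Filter Topology

namespace PanelDPD

noncomputable section

/-- Covariates of one individual: `x t` is the `K`-vector of regressors at time `t`. -/
abbrev Cov (T K : ℕ) : Type := Fin T → Fin K → ℝ

/-- Responses of one individual over the `T` time points. -/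
abbrev Resp (T : ℕ) : Type := Fin T → ℝ

/-- The parameter `(β, σ_α², σ_ε²)`, a vector of dimension `K + 2`. -/
abbrev Param (K : ℕ) : Type := EuclideanSpace ℝ (Fin K ⊕ Fin 2)

variable {T K : ℕ}

/-- The regression coefficients. -/
def beta (θ : Param K) : Fin K → ℝ := fun k => θ (Sum.inl k)

/-- The variance `σ_α²` of the individual effects. -/
def varAlpha (θ : Param K) : ℝ := θ (Sum.inr 0)

/-- The variance `σ_ε²` of the idiosyncratic errors. -/
def varEps (θ : Param K) : ℝ := θ (Sum.inr 1)

/-- The largest meaningful parameter space: `σ_α² ≥ 0` and `σ_ε² > 0`. -/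
def admissible (K : ℕ) : Set (Param K) := {θ | 0 ≤ varAlpha θ ∧ 0 < varEps θ}

/-- The covariance matrix `σ_ε² I + σ_α² e eᵀ` of the compound errors. -/
def errCov (T : ℕ) (θ : Param K) : Matrix (Fin T) (Fin T) ℝ :=
  varEps θ • (1 : Matrix (Fin T) (Fin T) ℝ) + varAlpha θ • Matrix.of (fun _ _ => (1 : ℝ))

/-- The residual vector `y - x β`. -/
def resid (θ : Param K) (x : Cov T K) (y : Resp T) : Resp T :=
  y - Matrix.mulVec (Matrix.of x) (beta θ)

/-- The quadratic form `(y - x β)ᵀ Ω⁻¹ (y - x β)`. -/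
def quadForm (θ : Param K) (x : Cov T K) (y : Resp T) : ℝ :=
  resid θ x y ⬝ᵥ Matrix.mulVec (errCov T θ)⁻¹ (resid θ x y)

/-- The model density `f_θ(y | x)`. -/
def modelDensity (θ : Param K) (x : Cov T K) (y : Resp T) : ℝ :=
  (2 * Real.pi) ^ (-(T : ℝ) / 2) * (errCov T θ).det ^ (-(1 : ℝ) / 2) *
    Real.exp (-(1 / 2) * quadForm θ x y)

/-- The partial derivative `∂F/∂θ_j`. -/
def pderiv (j : Fin K ⊕ Fin 2) (F : Param K → ℝ) (θ : Param K) : ℝ :=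
  fderiv ℝ F θ (EuclideanSpace.single j 1)

/-- The score `u_θ(y | x) = ∂ log f_θ(y | x) / ∂θ`. -/
def score (θ : Param K) (x : Cov T K) (y : Resp T) (j : Fin K ⊕ Fin 2) : ℝ :=
  pderiv j (fun η => Real.log (modelDensity η x y)) θ

/-- The matrix `I_θ(y | x) = -∂ u_θ(y | x) / ∂θ`. -/
def infoMat (θ : Param K) (x : Cov T K) (y : Resp T) (j k : Fin K ⊕ Fin 2) : ℝ :=
  -pderiv k (fun η => score η x y j) θ

/-- The individual matrix `J⁽ⁱ⁾` at the covariates `x`, for the true conditional density `g`. -/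
def Jmat (γ : ℝ) (g : Cov T K → Resp T → ℝ) (θ : Param K) (x : Cov T K) :
    Matrix (Fin K ⊕ Fin 2) (Fin K ⊕ Fin 2) ℝ :=
  Matrix.of fun j k =>
    (∫ y, score θ x y j * score θ x y k * modelDensity θ x y ^ (1 + γ)) +
      ∫ y, (infoMat θ x y j k - γ * (score θ x y j * score θ x y k)) *
        (g x y - modelDensity θ x y) * modelDensity θ x y ^ γ

/-- The individual vector `ξ⁽ⁱ⁾` at the covariates `x`. -/
def xiVec (γ : ℝ) (g : Cov T K → Resp T → ℝ) (θ : Param K) (x : Cov T K)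
    (j : Fin K ⊕ Fin 2) : ℝ :=
  ∫ y, score θ x y j * modelDensity θ x y ^ γ * g x y

/-- The individual matrix `K⁽ⁱ⁾` at the covariates `x`. -/
def Kmat (γ : ℝ) (g : Cov T K → Resp T → ℝ) (θ : Param K) (x : Cov T K) :
    Matrix (Fin K ⊕ Fin 2) (Fin K ⊕ Fin 2) ℝ :=
  Matrix.of fun j k =>
    (∫ y, score θ x y j * score θ x y k * modelDensity θ x y ^ (2 * γ) * g x y) -
      xiVec γ g θ x j * xiVec γ g θ x k

/-- The joint law of one observation `(x, y)`: the covariates have law `ν`, and the response has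
conditional density `g x` given `x`. -/
def jointLaw (ν : Measure (Cov T K)) (g : Cov T K → Resp T → ℝ) :
    Measure (Cov T K × Resp T) :=
  (ν.prod volume).withDensity fun z => ENNReal.ofReal (g z.1 z.2)

/-- The part of the density power divergence between the model and the true conditional density
that depends on `θ`. The omitted term `γ⁻¹ ∫∫ g ^ (1 + γ)` is free of `θ` (and may be infinite). -/
def dpd (γ : ℝ) (ν : Measure (Cov T K)) (g : Cov T K → Resp T → ℝ) (θ : Param K) : ℝ :=
  ∫ x, (∫ y, (modelDensity θ x y ^ (1 + γ) - (1 + 1 / γ) * (modelDensity θ x y ^ γ * g x y))) ∂ν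

/-- The empirical density power divergence of a sample, up to a term free of `θ`. -/
def empDPD (γ : ℝ) {N : ℕ} (d : Fin N → Cov T K × Resp T) (θ : Param K) : ℝ :=
  (1 / (N : ℝ)) * ∑ i, (∫ y, modelDensity θ (d i).1 y ^ (1 + γ)) -
    (1 + γ) / (N * γ) * ∑ i, modelDensity θ (d i).1 (d i).2 ^ γ

/-- `θ` solves the estimating equations `∂ d̂_γ / ∂θ = 0` of the sample. -/
def IsRootEE (γ : ℝ) {N : ℕ} (d : Fin N → Cov T K × Resp T) (θ : Param K) : Prop :=
  HasFDerivAt (empDPD γ d) (0 : Param K →L[ℝ] ℝ) θ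

/-- `θ` solves the expected estimating equations at given covariates `x₁, …, x_N`: the conditional
expectation of the sum of the estimating functions `u_θ f_θ^γ - ∫ u_θ f_θ^(1+γ)` vanishes. -/
def IsExpectedRoot (γ : ℝ) (g : Cov T K → Resp T → ℝ) {N : ℕ} (x : Fin N → Cov T K)
    (θ : Param K) : Prop :=
  ∀ j, ∑ i, ((∫ y, score θ (x i) y j * modelDensity θ (x i) y ^ γ * g (x i) y) -
    ∫ y, score θ (x i) y j * modelDensity θ (x i) y ^ (1 + γ)) = 0

end

end PanelDPD

/-!
The estimating function of an observation is
`ψ_θ(z) = (1 + γ)⁻¹ ∂ ∫ f_θ^(1+γ) - γ⁻¹ ∂ f_θ^γ` (`estFun`). The differential of the empirical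
divergence is `1 + γ` times its sample average, and at the best-fitting parameter its expectation
vanishes, because `θ₀` is an interior minimum of the divergence. Write `ψ̄_θ(x)` for the conditional
expectation of `ψ_θ` given the covariates. The expected estimating equations say that the average of
`ψ̄_θ` is zero.

Both `ψ` and `ψ̄` are differentiable at `θ₀`, with a remainder that is quadratic in `θ` and
integrable in the observation (`IsLinearizable`), and their expected derivative is the limit `J` of
the matrices `J⁽ⁱ⁾`. By the law of large numbers the average of `ψ` is, on a small ball and with
probability tending to one, nearly affine with invertible derivative. A simplified Newton iteration
started at `θ₀` is then a contraction and its limit is a consistent root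
(`exists_measurable_root`); as a limit of measurable iterates it is measurable. Any consistent root
`θ_N` of such equations satisfies `√N (θ_N - θ₀) = -J⁻¹ √N avg ψ_θ₀ + o_p(1)`
(`tendsto_sqrt_smul_root`). Subtracting the expansions of the two kinds of roots gives
`√N (θhat - θ_N) = J⁻¹ √N avg (ψ̄_θ₀ - ψ_θ₀) + o_p(1)`. The covariance of `ψ̄_θ₀ - ψ_θ₀` is the
expected conditional variance of `ψ_θ₀`, which is the limit of the matrices `K⁽ⁱ⁾`, so that the
central limit theorem gives the claim.

The analytic input comes from the third derivatives alone. The model density to the power `γ` is a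
smooth factor, free of the observation, times `exp (-γ/2 quadForm)`, which takes values in `[0, 1]`.
For functions with bounded values, a bound on the third derivative bounds the second derivative, and
nonnegativity improves this to a bound for the square of the first derivative
(`exists_bound_fderiv_mul`). An integrable majorant of the third derivatives therefore makes `∂ψ`
integrable and `ψ` square integrable. The integrals `∫ f_θ^(1+γ)` do not depend on the covariates:
after a change of variables they are an explicit smooth function of the parameter
(`exists_integral_modelDensity_rpow`), and they can be differentiated under the integral sign
because the derivatives of the log-density grow quadratically in the response.

Properties that hold with probability tending to one form a filter on pairs of a sample size and a
sample point (`probFilter`). Convergence in probability to a constant is convergence along this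
filter.
-/

namespace PanelDPD

/-! ### Convergence in probability as convergence along a filter -/

section ProbFilter

variable {S : Type*} [MeasurableSpace S] {P : Measure S}

/-- The filter on `ℕ × S` of the properties of the sample size and of the sample point that hold
with probability tending to one. Convergence in probability to a constant is convergence along
this filter. -/
def probFilter (P : Measure S) : Filter (ℕ × S) where
  sets := {A | Tendsto (fun N => P {s | (N, s) ∉ A}) atTop (𝓝 0)}
  univ_sets := by simp
  sets_of_superset := by
    intro A B hA hAB
    refine tendsto_of_tendsto_of_tendsto_of_le_of_le tendsto_const_nhds hA (fun _ => zero_le)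
      (fun N => measure_mono fun s hs h => hs (hAB h))
  inter_sets := by
    intro A B hA hB
    have h := Tendsto.add hA hB
    rw [add_zero] at h
    refine tendsto_of_tendsto_of_tendsto_of_le_of_le tendsto_const_nhds h (fun _ => zero_le)
      (fun N => le_trans (measure_mono fun s hs => ?_) (measure_union_le _ _))
    by_contra hc
    simp only [Set.mem_union, Set.mem_ofPred_eq, not_or, not_not] at hc
    exact hs hc

lemma eventually_probFilter {Q : ℕ → S → Prop} :
    (∀ᶠ p in probFilter P, Q p.1 p.2) ↔ Tendsto (fun N => P {s | ¬ Q N s}) atTop (𝓝 0) :=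
  Iff.rfl

lemma tendsto_fst_probFilter : Tendsto Prod.fst (probFilter P) atTop := by
  intro A hA
  have : ∀ᶠ N in atTop, P {s | ¬ (N, s).1 ∈ A} = 0 := by
    filter_upwards [hA] with N hN
    simp [hN]
  exact (tendsto_congr' this).2 tendsto_const_nhds

lemma eventually_probFilter_of_ae {Q : ℕ → S → Prop} (h : ∀ᵐ s ∂P, ∀ N, Q N s) :
    ∀ᶠ p in probFilter P, Q p.1 p.2 := by
  rw [eventually_probFilter]
  have : ∀ N, P {s | ¬ Q N s} = 0 := fun N => by
    have := ae_all_iff.1 h N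
    exact this
  simp [this]

lemma tendstoInMeasure_const_iff {E : Type*} [SeminormedAddCommGroup E] {f : ℕ → S → E} {c : E} :
    TendstoInMeasure P f atTop (fun _ => c) ↔
      Tendsto (fun p : ℕ × S => f p.1 p.2) (probFilter P) (𝓝 c) := by
  rw [tendstoInMeasure_iff_norm, Metric.tendsto_nhds]
  refine forall₂_congr fun ε _ => ?_
  have : ∀ N, {s | ε ≤ ‖f N s - c‖} = {s | ¬ dist (f N s) c < ε} := fun N => by
    ext s; simp [dist_eq_norm]
  simp_rw [this]
  exact Iff.rfl

/-- Boundedness in probability (`O_p(1)`) of a sequence of random elements. -/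
def BoundedInProb {F : Type*} [Norm F] (P : Measure S) (V : ℕ → S → F) : Prop :=
  ∀ ε : ENNReal, 0 < ε → ∃ R : ℝ, 0 < R ∧ ∀ N, P {s | R < ‖V N s‖} ≤ ε

/-- A sequence that is `o_p(1)` times one that is `O_p(1)` is `o_p(1)`. -/
lemma BoundedInProb.tendsto_mul {F : Type*} [Norm F] {V : ℕ → S → F} (hV : BoundedInProb P V)
    (hV0 : ∀ N s, 0 ≤ ‖V N s‖)
    {r : ℕ × S → ℝ} (hr : Tendsto r (probFilter P) (𝓝 0)) :
    Tendsto (fun p : ℕ × S => r p * ‖V p.1 p.2‖) (probFilter P) (𝓝 0) := by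
  rw [Metric.tendsto_nhds]
  intro δ hδ
  change Tendsto _ _ _
  rw [ENNReal.tendsto_nhds_zero]
  intro ε hε
  obtain ⟨R, hR, hRV⟩ := hV (ε / 2) (ENNReal.half_pos hε.ne')
  have h1 := (Metric.tendsto_nhds.1 hr) (δ / (R + 1)) (by positivity)
  have h2 : Tendsto (fun N => P {s | ¬ dist (r (N, s)) 0 < δ / (R + 1)}) atTop (𝓝 0) := h1
  rw [ENNReal.tendsto_nhds_zero] at h2
  filter_upwards [h2 (ε / 2) (ENNReal.half_pos hε.ne')] with N hN
  calc _ ≤ P ({s | ¬ dist (r (N, s)) 0 < δ / (R + 1)} ∪ {s | R < ‖V N s‖}) := by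
        refine measure_mono fun s hs => ?_
        by_contra hc
        simp only [Set.mem_union, Set.mem_ofPred_eq, not_or, not_not] at hc
        refine hs ?_
        obtain ⟨h3, h4⟩ := hc
        rw [not_lt] at h4
        simp only [dist_zero_right, Real.norm_eq_abs] at h3
        rw [dist_zero_right, norm_mul, Real.norm_eq_abs, Real.norm_eq_abs,
          abs_of_nonneg (hV0 N s)]
        calc |r (N, s)| * ‖V N s‖ ≤ |r (N, s)| * R := by gcongr
          _ ≤ |r (N, s)| * (R + 1) := by gcongr; linarith
          _ < δ / (R + 1) * (R + 1) := by gcongr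
          _ = δ := by field_simp
    _ ≤ ε / 2 + ε / 2 := (measure_union_le _ _).trans (add_le_add hN (hRV N))
    _ = ε := ENNReal.add_halves ε

end ProbFilter

/-! ### Averages over an i.i.d. sample -/

section Sample

/-- The average of `f` over a finite sample. -/
noncomputable def avg {Z V : Type*} [AddCommGroup V] [Module ℝ V] (f : Z → V) {N : ℕ}
    (d : Fin N → Z) : V :=
  (N : ℝ)⁻¹ • ∑ i, f (d i)

variable {S Z : Type*} [MeasurableSpace S] {P : Measure S} [IsProbabilityMeasure P]
  [MeasurableSpace Z] {ρ : Measure Z} {Zs : ℕ → S → Z}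

omit [MeasurableSpace S] [MeasurableSpace Z] in
lemma avg_eq_sum_range {V : Type*} [AddCommGroup V] [Module ℝ V] (f : Z → V) (N : ℕ) (s : S) :
    avg f (fun i : Fin N => Zs i s) = (N : ℝ)⁻¹ • ∑ i ∈ Finset.range N, f (Zs i s) := by
  rw [avg, Finset.sum_range]

omit [IsProbabilityMeasure P] in
lemma identDistrib_comp (h_law : ∀ i, HasLaw (Zs i) ρ P) {V : Type*} [MeasurableSpace V]
    {f : Z → V} (hf : Measurable f) (i j : ℕ) :
    IdentDistrib (fun s => f (Zs i s)) (fun s => f (Zs j s)) P P :=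
  IdentDistrib.comp ⟨(h_law i).aemeasurable, (h_law j).aemeasurable,
    (h_law i).map_eq.trans (h_law j).map_eq.symm⟩ hf

omit [IsProbabilityMeasure P] in
/-- Strong law of large numbers for functions of i.i.d. observations. -/
lemma tendsto_avg_ae (h_indep : iIndepFun Zs P) (h_law : ∀ i, HasLaw (Zs i) ρ P)
    {V : Type*} [NormedAddCommGroup V] [NormedSpace ℝ V] [CompleteSpace V] [MeasurableSpace V]
    [BorelSpace V] {f : Z → V} (hf : Measurable f) (hfi : Integrable f ρ) :
    ∀ᵐ s ∂P, Tendsto (fun N : ℕ => avg f (fun i : Fin N => Zs i s)) atTop (𝓝 (∫ z, f z ∂ρ)) := by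
  have hmap := (h_law 0).map_eq
  have h0 : AEStronglyMeasurable f (P.map (Zs 0)) := by rw [hmap]; exact hfi.1
  have hint : Integrable (fun s => f (Zs 0 s)) P := by
    have := (integrable_map_measure h0 (h_law 0).aemeasurable).1 (by rw [hmap]; exact hfi)
    exact this
  have h := strong_law_ae (fun i s => f (Zs i s)) hint
    (fun i j hij => (h_indep.indepFun hij).comp hf hf) (fun i => identDistrib_comp h_law hf i 0)
  have he : ∫ s, f (Zs 0 s) ∂P = ∫ z, f z ∂ρ := by
    rw [← hmap, integral_map (h_law 0).aemeasurable h0]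
  rw [he] at h
  simpa only [avg_eq_sum_range] using h

/-- Weak law of large numbers, along the filter of properties that hold with probability tending
to one. -/
lemma tendsto_avg_probFilter (h_indep : iIndepFun Zs P) (h_law : ∀ i, HasLaw (Zs i) ρ P)
    {V : Type*} [NormedAddCommGroup V] [NormedSpace ℝ V] [CompleteSpace V] [MeasurableSpace V]
    [BorelSpace V] [SecondCountableTopology V] {f : Z → V} (hf : Measurable f)
    (hfi : Integrable f ρ) :
    Tendsto (fun p : ℕ × S => avg f (fun i : Fin p.1 => Zs i p.2)) (probFilter P)
      (𝓝 (∫ z, f z ∂ρ)) := by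
  refine (tendstoInMeasure_const_iff (f := fun (N : ℕ) s => avg f (fun i : Fin N => Zs i s))).1 ?_
  refine tendstoInMeasure_of_tendsto_ae (fun N => ?_) (tendsto_avg_ae h_indep h_law hf hfi)
  simp only [avg]
  refine AEMeasurable.aestronglyMeasurable ?_
  refine AEMeasurable.const_smul ?_ _
  exact Finset.aemeasurable_fun_sum _ fun i _ => hf.comp_aemeasurable (h_law i).aemeasurable

omit [IsProbabilityMeasure P] in
lemma memLp_comp (h_law : ∀ i, HasLaw (Zs i) ρ P) {f : Z → ℝ} (hf2 : MemLp f 2 ρ) (i : ℕ) :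
    MemLp (fun s => f (Zs i s)) 2 P := by
  have hmap := (h_law i).map_eq
  rw [← hmap] at hf2
  exact hf2.comp_of_map (h_law i).aemeasurable

omit [MeasurableSpace Z] in
lemma sqrt_smul_avg {V : Type*} [AddCommGroup V] [Module ℝ V] (f : Z → V) {N : ℕ}
    (d : Fin N → Z) : √(N : ℝ) • avg f d = (√(N : ℝ))⁻¹ • ∑ i, f (d i) := by
  rw [avg, smul_smul]
  congr 1
  rcases Nat.eq_zero_or_pos N with h | h
  · simp [h]
  · have : (0 : ℝ) < N := by exact_mod_cast h
    nth_rewrite 2 [← Real.mul_self_sqrt this.le]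
    have := (Real.sqrt_pos.2 this).ne'
    field_simp

/-- Normalized sums of centered square integrable variables are bounded in probability. -/
lemma boundedInProb_sqrt_avg_real (h_indep : iIndepFun Zs P) (h_law : ∀ i, HasLaw (Zs i) ρ P)
    {f : Z → ℝ} (hf : Measurable f) (hf2 : MemLp f 2 ρ) (hf0 : ∫ z, f z ∂ρ = 0) :
    BoundedInProb P (fun (N : ℕ) s => √(N : ℝ) • avg f (fun i : Fin N => Zs i s)) := by
  have hm := fun i => memLp_comp h_law hf2 i
  have he : ∀ i, ∫ s, f (Zs i s) ∂P = 0 := fun i => by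
    rw [← hf0, ← (h_law i).map_eq, integral_map (h_law i).aemeasurable]
    exact hf.aestronglyMeasurable
  set v := Var[fun s => f (Zs 0 s); P] with hv
  have hvar : ∀ i, Var[fun s => f (Zs i s); P] = v := fun i =>
    (identDistrib_comp h_law hf i 0).variance_eq
  have key : ∀ (N : ℕ) (R : ℝ), 0 < R →
      P {s | R ≤ ‖√(N : ℝ) • avg f (fun i : Fin N => Zs i s)‖} ≤ ENNReal.ofReal (v / R ^ 2) := by
    intro N R hR
    have hW : MemLp (fun s => √(N : ℝ) • avg f (fun i : Fin N => Zs i s)) 2 P := by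
      simp only [sqrt_smul_avg]
      exact (memLp_finsetSum (f := fun (i : Fin N) s => f (Zs i s)) Finset.univ
        fun i _ => hm i).const_smul (√(N : ℝ))⁻¹
    have hW0 : ∫ s, √(N : ℝ) • avg f (fun i : Fin N => Zs i s) ∂P = 0 := by
      simp only [sqrt_smul_avg]
      simp only [smul_eq_mul]
      rw [integral_const_mul, integral_finsetSum _ fun (i : Fin N) _ => (hm i).integrable
        (by norm_num)]
      simp [he]
    have hWv : Var[fun s => √(N : ℝ) • avg f (fun i : Fin N => Zs i s); P] ≤ v := by
      simp only [sqrt_smul_avg]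
      simp only [smul_eq_mul]
      rw [variance_const_mul]
      have h1 : (fun s => ∑ i : Fin N, f (Zs i s)) = ∑ i ∈ Finset.range N, fun s => f (Zs i s) := by
        ext s; rw [Finset.sum_apply, Finset.sum_range]
      rw [h1, IndepFun.variance_sum (fun i _ => hm i)
        (fun i _ j _ hij => (h_indep.indepFun hij).comp hf hf)]
      simp only [hvar, Finset.sum_const, Finset.card_range, nsmul_eq_mul]
      have hv0 : 0 ≤ v := variance_nonneg _ _
      rcases Nat.eq_zero_or_pos N with h | h
      · simp [h, hv0]
      · have : (0 : ℝ) < N := by exact_mod_cast h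
        rw [inv_pow, Real.sq_sqrt this.le]
        field_simp
        exact le_refl _
    have := meas_ge_le_variance_div_sq hW hR
    rw [hW0] at this
    simp only [sub_zero] at this
    refine this.trans (ENNReal.ofReal_le_ofReal ?_)
    gcongr
  intro ε hε
  have hlim : Tendsto (fun R : ℝ => ENNReal.ofReal (v / R ^ 2)) atTop (𝓝 0) := by
    rw [← ENNReal.ofReal_zero]
    refine ENNReal.tendsto_ofReal ?_
    exact tendsto_const_nhds.div_atTop (tendsto_pow_atTop (by norm_num))
  have := ((ENNReal.tendsto_nhds_zero.1 hlim) ε hε).and (eventually_gt_atTop 0)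
  obtain ⟨R, hR, hR0⟩ := this.exists
  refine ⟨R, hR0, fun N => le_trans (measure_mono fun s hs => ?_) ((key N R hR0).trans hR)⟩
  exact (show R < _ from hs).le

end Sample

/-! ### Coordinates and the central limit theorem -/

section Coordinates

variable {ι G : Type*} [Fintype ι] [DecidableEq ι] [NormedAddCommGroup G] [NormedSpace ℝ G]

lemma eq_sum_smul_single (v : EuclideanSpace ℝ ι) :
    v = ∑ j, v j • EuclideanSpace.single j (1 : ℝ) := by
  ext k; simp [Pi.single_apply]

lemma clm_apply_eq_sum (A : EuclideanSpace ℝ ι →L[ℝ] G) (v : EuclideanSpace ℝ ι) :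
    A v = ∑ j, v j • A (EuclideanSpace.single j 1) := by
  conv_lhs => rw [eq_sum_smul_single v]
  rw [map_sum]
  exact Finset.sum_congr rfl fun j _ => map_smul _ _ _

lemma norm_le_sum_norm_single (A : EuclideanSpace ℝ ι →L[ℝ] G) :
    ‖A‖ ≤ ∑ j, ‖A (EuclideanSpace.single j 1)‖ := by
  refine A.opNorm_le_bound (Finset.sum_nonneg fun _ _ => norm_nonneg _) fun x => ?_
  rw [clm_apply_eq_sum, Finset.sum_mul]
  refine (norm_sum_le _ _).trans (Finset.sum_le_sum fun j _ => ?_)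
  rw [norm_smul, mul_comm]
  gcongr
  exact PiLp.norm_apply_le x j

end Coordinates

section CLT

variable {S Z : Type*} [MeasurableSpace S] {P : Measure S} [IsProbabilityMeasure P]
  [MeasurableSpace Z] {ρ : Measure Z} {Zs : ℕ → S → Z}

/-- Normalized sums of centered random functionals with square integrable values are bounded in
probability. -/
lemma boundedInProb_sqrt_avg_dual (h_indep : iIndepFun Zs P) (h_law : ∀ i, HasLaw (Zs i) ρ P)
    {ι : Type*} [Fintype ι] [DecidableEq ι] {ξ : Z → EuclideanSpace ℝ ι →L[ℝ] ℝ}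
    (hm : ∀ v, Measurable fun z => ξ z v)
    (h2 : ∀ v, MemLp (fun z => ξ z v) 2 ρ) (h0 : ∀ v, ∫ z, ξ z v ∂ρ = 0) :
    BoundedInProb P (fun (N : ℕ) s => √(N : ℝ) • avg ξ (fun i : Fin N => Zs i s)) := by
  have hb := fun j : ι => boundedInProb_sqrt_avg_real h_indep h_law
    (hm (EuclideanSpace.single j 1)) (h2 _) (h0 _)
  intro ε hε
  have hε' : 0 < ε / (Fintype.card ι + 1 : ENNReal) :=
    ENNReal.div_pos hε.ne' (by finiteness)
  choose R hR0 hR using fun j => hb j _ hε'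
  refine ⟨∑ j, R j + 1, by have := Finset.sum_nonneg fun j (_ : j ∈ Finset.univ) => (hR0 j).le
                           linarith, fun N => ?_⟩
  calc _ ≤ P (⋃ j, {s | R j < ‖√(N : ℝ) • avg (fun z => ξ z (EuclideanSpace.single j 1))
          (fun i : Fin N => Zs i s)‖}) := by
        refine measure_mono fun s hs => ?_
        by_contra hc
        simp only [Set.mem_iUnion, Set.mem_ofPred_eq, not_exists, not_lt] at hc hs
        have h1 := norm_le_sum_norm_single (√(N : ℝ) • avg ξ (fun i : Fin N => Zs i s))
        have h3 : ∀ j, (√(N : ℝ) • avg ξ (fun i : Fin N => Zs i s)) (EuclideanSpace.single j 1)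
            = √(N : ℝ) • avg (fun z => ξ z (EuclideanSpace.single j 1))
          (fun i : Fin N => Zs i s) := fun j => by simp [avg]
        simp only [h3] at h1
        have := Finset.sum_le_sum fun j (_ : j ∈ Finset.univ) => hc j
        linarith
    _ ≤ ∑ j, P {s | R j < ‖√(N : ℝ) • avg (fun z => ξ z (EuclideanSpace.single j 1))
          (fun i : Fin N => Zs i s)‖} := measure_iUnion_fintype_le _ _
    _ ≤ ∑ _j : ι, ε / (Fintype.card ι + 1 : ENNReal) := Finset.sum_le_sum fun j _ => hR j N
    _ = Fintype.card ι * (ε / (Fintype.card ι + 1 : ENNReal)) := by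
        rw [Finset.sum_const, Finset.card_univ, nsmul_eq_mul]
    _ ≤ (Fintype.card ι + 1) * (ε / (Fintype.card ι + 1 : ENNReal)) := by gcongr; simp
    _ ≤ ε := ENNReal.mul_div_le

/-- Multivariate central limit theorem for functions of i.i.d. observations. By Lévy's continuity
theorem it reduces to the one-dimensional theorem for each linear functional. -/
theorem tendstoInDistribution_sqrt_avg (h_indep : iIndepFun Zs P)
    (h_law : ∀ i, HasLaw (Zs i) ρ P)
    {ι : Type*} [Fintype ι] [DecidableEq ι] {V : Z → EuclideanSpace ℝ ι} (hm : Measurable V)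
    (h2 : ∀ t, MemLp (fun z => inner ℝ (V z) t) 2 ρ) (h0 : ∀ t, ∫ z, inner ℝ (V z) t ∂ρ = 0)
    {C : Matrix ι ι ℝ} (hC : C.PosSemidef)
    (hcov : ∀ t : EuclideanSpace ℝ ι, ∫ z, inner ℝ (V z) t ^ 2 ∂ρ = t.ofLp ⬝ᵥ C.mulVec t.ofLp) :
    TendstoInDistribution (fun (N : ℕ) s => √(N : ℝ) • avg V (fun i : Fin N => Zs i s)) atTop id
      (fun _ => P) (multivariateGaussian 0 C) := by
  have hae : ∀ N : ℕ, AEMeasurable (fun s => √(N : ℝ) • avg V (fun i : Fin N => Zs i s)) P := by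
    intro N
    simp only [sqrt_smul_avg]
    have h : AEMeasurable (fun s => ∑ i : Fin N, V (Zs i s)) P :=
      Finset.aemeasurable_fun_sum _ fun i _ => hm.comp_aemeasurable (h_law i).aemeasurable
    exact h.const_smul (√(N : ℝ))⁻¹
  refine ⟨hae, by fun_prop, ?_⟩
  refine ProbabilityMeasure.tendsto_iff_tendsto_charFun.2 fun t => ?_
  have hft : Measurable fun z => inner ℝ (V z) t := by fun_prop
  set X : ℕ → S → ℝ := fun i s => inner ℝ (V (Zs i s)) t with hX
  have hmap := (h_law 0).map_eq
  have hX0 : ∫ s, X 0 s ∂P = 0 := by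
    rw [← h0 t, ← hmap, integral_map (h_law 0).aemeasurable hft.aestronglyMeasurable]
  have hXm := memLp_comp h_law (h2 t) 0
  have hXv : Var[X 0; P] = t.ofLp ⬝ᵥ C.mulVec t.ofLp := by
    rw [variance_of_integral_eq_zero hXm.1.aemeasurable hX0, ← hcov t, ← hmap,
      integral_map (h_law 0).aemeasurable (hft.pow_const 2).aestronglyMeasurable]
  have hclt := tendstoInDistribution_inv_sqrt_mul_sum_sub (X := X) (P := P)
    (P' := gaussianReal 0 Var[X 0; P].toNNReal) (Y := id) ⟨aemeasurable_id, by simp⟩ hXm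
    (h_indep.comp (fun _ z => inner ℝ (V z) t) fun _ => hft)
    (fun i => identDistrib_comp h_law hft i 0)
  have hchar := ProbabilityMeasure.tendsto_iff_tendsto_charFun.1 hclt.tendsto 1
  have hlhs : ∀ N : ℕ, charFun (P.map fun s => √(N : ℝ) • avg V (fun i : Fin N => Zs i s)) t =
      charFun (P.map fun s => (√(N : ℝ))⁻¹ * (∑ k ∈ Finset.range N, X k s - N * P[X 0])) 1 := by
    intro N
    have hae1 := hclt.forall_aemeasurable N
    rw [charFun_apply, charFun_apply, integral_map (hae N) (by fun_prop),
      integral_map hae1 (by fun_prop)]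
    refine integral_congr_ae (ae_of_all _ fun s => ?_)
    simp only [hX0, mul_zero, sub_zero, sqrt_smul_avg, real_inner_smul_left, sum_inner]
    simp [hX, Finset.sum_range]
  simp only [ProbabilityMeasure.coe_mk] at hchar ⊢
  simp only [hlhs]
  convert hchar using 2
  rw [Measure.map_id, Measure.map_id, charFun_multivariateGaussian hC, charFun_gaussianReal, hXv]
  have hnn : 0 ≤ t.ofLp ⬝ᵥ C.mulVec t.ofLp := hXv ▸ variance_nonneg _ _
  simp [Real.coe_toNNReal _ hnn]

end CLT

/-! ### Roots of random estimating equations -/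

section Deterministic

variable {E F : Type*} [NormedAddCommGroup E] [NormedSpace ℝ E] [NormedAddCommGroup F]
  [NormedSpace ℝ F]

/-- The radial retraction of a normed space onto the closed ball of radius `δ` around `c`. -/
noncomputable def radialRetract (c : E) (δ : ℝ) (θ : E) : E :=
  c + (δ / max δ ‖θ - c‖) • (θ - c)

lemma continuous_radialRetract (c : E) {δ : ℝ} (hδ : 0 < δ) : Continuous (radialRetract c δ) := by
  unfold radialRetract
  have : ∀ θ, max δ ‖θ - c‖ ≠ 0 := fun θ => (lt_max_of_lt_left hδ).ne'
  fun_prop (disch := assumption)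

lemma radialRetract_mem (c : E) {δ : ℝ} (hδ : 0 < δ) (θ : E) :
    radialRetract c δ θ ∈ Metric.closedBall c δ := by
  have h : 0 < max δ ‖θ - c‖ := lt_max_of_lt_left hδ
  rw [mem_closedBall_iff_norm, radialRetract, add_sub_cancel_left, norm_smul, Real.norm_eq_abs,
    abs_of_nonneg (by positivity), div_mul_eq_mul_div, div_le_iff₀ h]
  gcongr
  exact le_max_right _ _

lemma radialRetract_of_mem {c : E} {δ : ℝ} (hδ : 0 < δ) {θ : E}
    (h : θ ∈ Metric.closedBall c δ) : radialRetract c δ θ = θ := by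
  rw [mem_closedBall_iff_norm] at h
  rw [radialRetract, max_eq_left h, div_self hδ.ne', one_smul, add_sub_cancel]

/-- One step of the simplified Newton iteration for the equation `G θ = 0`, with the fixed
derivative `J`. The retraction keeps the argument of `G` in a ball. -/
noncomputable def newtonStep (J : E ≃L[ℝ] F) (c : E) (δ : ℝ) (G : E → F) (θ : E) : E :=
  θ - J.symm (G (radialRetract c δ θ))

/-- If `G` is on a ball close to being affine with derivative `J`, and small at the centre, then
the simplified Newton iteration is a contraction of the ball and converges to a root. -/
lemma exists_root_of_approx_affine [CompleteSpace E] (J : E ≃L[ℝ] F) {G : E → F} {H : E →L[ℝ] F}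
    {c : E} {δ b : ℝ} (hδ : 0 < δ)
    (hG : ∀ θ ∈ Metric.closedBall c δ, ∀ θ' ∈ Metric.closedBall c δ,
      ‖G θ - G θ' - H (θ - θ')‖ ≤ b * ‖θ - θ'‖)
    (hb : ‖(J.symm : F →L[ℝ] E)‖ * (‖H - J‖ + b) ≤ 1 / 2)
    (h0 : ‖J.symm (G c)‖ ≤ δ / 2) :
    ∃ θ ∈ Metric.closedBall c δ, Tendsto (fun n => (newtonStep J c δ G)^[n] c) atTop (𝓝 θ) ∧
      G θ = 0 ∧ ‖θ - c‖ ≤ 2 * ‖J.symm (G c)‖ := by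
  set s := Metric.closedBall c δ
  set T := newtonStep J c δ G with hT
  have hTs : ∀ θ ∈ s, T θ = θ - J.symm (G θ) := fun θ hθ => by
    rw [hT, newtonStep, radialRetract_of_mem hδ hθ]
  have hlip : ∀ θ ∈ s, ∀ θ' ∈ s, ‖T θ - T θ'‖ ≤ 1 / 2 * ‖θ - θ'‖ := by
    intro θ hθ θ' hθ'
    have h1 : T θ - T θ' = -J.symm ((G θ - G θ' - H (θ - θ')) + (H - J) (θ - θ')) := by
      rw [hTs θ hθ, hTs θ' hθ']
      have : (G θ - G θ' - H (θ - θ')) + (H - (J : E →L[ℝ] F)) (θ - θ')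
          = G θ - G θ' - J (θ - θ') := by
        simp only [sub_apply, ContinuousLinearEquiv.coe_coe]; abel
      rw [this, map_sub, map_sub, J.symm_apply_apply]
      abel
    rw [h1, norm_neg]
    calc _ ≤ ‖(J.symm : F →L[ℝ] E)‖ *
          ‖(G θ - G θ' - H (θ - θ')) + (H - (J : E →L[ℝ] F)) (θ - θ')‖ :=
          (J.symm : F →L[ℝ] E).le_opNorm _
      _ ≤ ‖(J.symm : F →L[ℝ] E)‖ * (b * ‖θ - θ'‖ + ‖H - (J : E →L[ℝ] F)‖ * ‖θ - θ'‖) := by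
          gcongr
          exact (norm_add_le _ _).trans
            (add_le_add (hG θ hθ θ' hθ') (ContinuousLinearMap.le_opNorm _ _))
      _ = ‖(J.symm : F →L[ℝ] E)‖ * (‖H - (J : E →L[ℝ] F)‖ + b) * ‖θ - θ'‖ := by ring
      _ ≤ 1 / 2 * ‖θ - θ'‖ := by gcongr
  have hc : c ∈ s := Metric.mem_closedBall_self hδ.le
  have hTc : T c - c = -J.symm (G c) := by rw [hTs c hc]; abel
  have hmaps : Set.MapsTo T s s := by
    intro θ hθ
    have h1 := hlip θ hθ c hc
    have h2 : T θ - c = (T θ - T c) + (T c - c) := by abel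
    have h3 := mem_closedBall_iff_norm.1 hθ
    rw [mem_closedBall_iff_norm, h2]
    have h4 := norm_add_le (T θ - T c) (T c - c)
    rw [hTc, norm_neg] at h4
    rw [hTc]
    linarith
  have hcontr : ContractingWith (1 / 2 : NNReal) (hmaps.restrict T s s) := by
    refine ⟨by norm_num, LipschitzWith.of_dist_le_mul fun x y => ?_⟩
    rw [Subtype.dist_eq, Subtype.dist_eq, dist_eq_norm, dist_eq_norm]
    have := hlip x x.2 y y.2
    simpa using this
  obtain ⟨θ, hθ, hfix, hlim, -⟩ := hcontr.exists_fixedPoint'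
    (Metric.isClosed_closedBall.isComplete) hmaps hc (edist_ne_top _ _)
  have hfix' : T θ = θ := hfix
  refine ⟨θ, hθ, hlim, ?_, ?_⟩
  · have := hTs θ hθ
    rw [hfix'] at this
    have h1 : J.symm (G θ) = 0 := by
      have h2 := sub_eq_self.1 this.symm
      exact h2
    exact (map_eq_zero_iff J.symm J.symm.injective).1 h1
  · have h1 := hlip θ hθ c hc
    have h2 : θ - c = (T θ - T c) + (T c - c) := by rw [hfix']; abel
    have h3 := norm_add_le (T θ - T c) (T c - c)
    rw [← h2, hTc, norm_neg] at h3
    linarith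

end Deterministic

section Random

variable {S Z : Type*} [MeasurableSpace S] {P : Measure S} [IsProbabilityMeasure P]
  [MeasurableSpace Z] {ρ : Measure Z} {Zs : ℕ → S → Z}
  {E F : Type*} [NormedAddCommGroup E] [NormedSpace ℝ E] [NormedAddCommGroup F]
  [NormedSpace ℝ F]

/-- The estimating function `ψ` is near `θ₀` differentiable with derivative `H` at `θ₀`, uniformly
in the sense that the deviation from the affine approximation is controlled by an integrable
function `L` of the observation. -/
structure IsLinearizable [MeasurableSpace E] [MeasurableSpace F] (ρ : Measure Z) (ψ : E → Z → F)
    (H : Z → E →L[ℝ] F) (L : Z → ℝ) (θ₀ : E) (r : ℝ) : Prop where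
  pos : 0 < r
  measurable_deriv : Measurable H
  integrable_deriv : Integrable H ρ
  measurable_bound : Measurable L
  integrable_bound : Integrable L ρ
  measurable_center : Measurable (ψ θ₀)
  integrable_center : Integrable (ψ θ₀) ρ
  integral_center : ∫ z, ψ θ₀ z ∂ρ = 0
  approx : ∀ᵐ z ∂ρ, ∀ θ ∈ Metric.closedBall θ₀ r, ∀ θ' ∈ Metric.closedBall θ₀ r,
    ‖ψ θ z - ψ θ' z - H z (θ - θ')‖ ≤ L z * max ‖θ - θ₀‖ ‖θ' - θ₀‖ * ‖θ - θ'‖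

omit [MeasurableSpace Z] in
lemma norm_avg_sub_le {ψ : E → Z → F} {H : Z → E →L[ℝ] F} {L : Z → ℝ} {θ θ' : E} {t : ℝ}
    {N : ℕ} {d : Fin N → Z}
    (h : ∀ i, ‖ψ θ (d i) - ψ θ' (d i) - H (d i) (θ - θ')‖ ≤ L (d i) * t * ‖θ - θ'‖) :
    ‖avg (ψ θ) d - avg (ψ θ') d - avg H d (θ - θ')‖ ≤ avg L d * t * ‖θ - θ'‖ := by
  have : avg (ψ θ) d - avg (ψ θ') d - avg H d (θ - θ') =
      (N : ℝ)⁻¹ • ∑ i, (ψ θ (d i) - ψ θ' (d i) - H (d i) (θ - θ')) := by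
    simp only [avg, Finset.sum_sub_distrib, smul_sub, smul_apply,
      sum_apply]
  rw [this, norm_smul, Real.norm_eq_abs, abs_of_nonneg (by positivity)]
  simp only [avg, smul_eq_mul]
  rw [mul_assoc, mul_assoc]
  gcongr
  rw [Finset.sum_mul]
  refine (norm_sum_le _ _).trans (Finset.sum_le_sum fun i _ => ?_)
  rw [← mul_assoc]
  exact h i

variable [MeasurableSpace E] [BorelSpace E] [FiniteDimensional ℝ E]
  [MeasurableSpace F] [BorelSpace F] [FiniteDimensional ℝ F]

omit [IsProbabilityMeasure P] [BorelSpace E] [FiniteDimensional ℝ E] [BorelSpace F]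
  [FiniteDimensional ℝ F] in
lemma IsLinearizable.eventually_approx {ψ : E → Z → F} {H : Z → E →L[ℝ] F} {L : Z → ℝ} {θ₀ : E}
    {r : ℝ} (h : IsLinearizable ρ ψ H L θ₀ r) (h_law : ∀ i, HasLaw (Zs i) ρ P) :
    ∀ᶠ p in probFilter P, ∀ θ ∈ Metric.closedBall θ₀ r, ∀ θ' ∈ Metric.closedBall θ₀ r,
      ‖avg (ψ θ) (fun i : Fin p.1 => Zs i p.2) - avg (ψ θ') (fun i : Fin p.1 => Zs i p.2) -
        avg H (fun i : Fin p.1 => Zs i p.2) (θ - θ')‖ ≤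
        avg L (fun i : Fin p.1 => Zs i p.2) * max ‖θ - θ₀‖ ‖θ' - θ₀‖ * ‖θ - θ'‖ := by
  refine eventually_probFilter_of_ae (Q := fun N s => ∀ θ ∈ Metric.closedBall θ₀ r,
    ∀ θ' ∈ Metric.closedBall θ₀ r,
      ‖avg (ψ θ) (fun i : Fin N => Zs i s) - avg (ψ θ') (fun i : Fin N => Zs i s) -
        avg H (fun i : Fin N => Zs i s) (θ - θ')‖ ≤
        avg L (fun i : Fin N => Zs i s) * max ‖θ - θ₀‖ ‖θ' - θ₀‖ * ‖θ - θ'‖) ?_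
  have : ∀ᵐ s ∂P, ∀ i, ∀ θ ∈ Metric.closedBall θ₀ r, ∀ θ' ∈ Metric.closedBall θ₀ r,
      ‖ψ θ (Zs i s) - ψ θ' (Zs i s) - H (Zs i s) (θ - θ')‖ ≤
        L (Zs i s) * max ‖θ - θ₀‖ ‖θ' - θ₀‖ * ‖θ - θ'‖ := by
    rw [ae_all_iff]
    intro i
    refine ae_of_ae_map (h_law i).aemeasurable (p := fun z => ∀ θ ∈ Metric.closedBall θ₀ r,
      ∀ θ' ∈ Metric.closedBall θ₀ r,
      ‖ψ θ z - ψ θ' z - H z (θ - θ')‖ ≤ L z * max ‖θ - θ₀‖ ‖θ' - θ₀‖ * ‖θ - θ'‖) ?_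
    rw [(h_law i).map_eq]
    exact h.approx
  filter_upwards [this] with s hs N θ hθ θ' hθ'
  exact norm_avg_sub_le fun i => hs i θ hθ θ' hθ'

lemma measurable_newtonStep_iterate {ψ : E → Z → F} {c : E} {δ : ℝ} (J : E ≃L[ℝ] F) (hδ : 0 < δ)
    (hmeas : ∀ θ ∈ Metric.closedBall c δ, Measurable (ψ θ))
    (hcont : ∀ z, ContinuousOn (fun θ => ψ θ z) (Metric.closedBall c δ)) {N : ℕ} (n : ℕ) :
    Measurable fun d : Fin N → Z => (newtonStep J c δ (fun θ => avg (ψ θ) d))^[n] c := by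
  have : ProperSpace E := FiniteDimensional.proper ℝ E
  have : ProperSpace F := FiniteDimensional.proper ℝ F
  have hG : Measurable (Function.uncurry fun (θ : E) (d : Fin N → Z) =>
      avg (ψ (radialRetract c δ θ)) d) := by
    refine measurable_uncurry_of_continuous_of_measurable (fun d => ?_) (fun θ => ?_)
    · have h : ∀ i, Continuous fun θ => ψ (radialRetract c δ θ) (d i) := fun i =>
        (hcont (d i)).comp_continuous (continuous_radialRetract c hδ)
          (fun θ => radialRetract_mem c hδ θ)
      have h' : Continuous fun θ => ∑ i, ψ (radialRetract c δ θ) (d i) :=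
        continuous_finsetSum _ fun i _ => h i
      exact h'.const_smul (N : ℝ)⁻¹
    · have hm := hmeas _ (radialRetract_mem c hδ θ)
      have h' : Measurable fun d : Fin N → Z => ∑ i, ψ (radialRetract c δ θ) (d i) :=
        Finset.measurable_fun_sum _ fun i _ => hm.comp (measurable_pi_apply i)
      exact h'.const_smul (N : ℝ)⁻¹
  have hstep : ∀ u : (Fin N → Z) → E, Measurable u →
      Measurable fun d => newtonStep J c δ (fun θ => avg (ψ θ) d) (u d) := by
    intro u hu
    have h0 : Measurable fun d : Fin N → Z => (u d, d) := hu.prodMk measurable_id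
    have h1 := hG.comp h0
    have h2 : Measurable (J.symm : F → E) := J.symm.continuous.measurable
    have h3 := h2.comp h1
    exact hu.sub h3
  induction n with
  | zero => exact measurable_const
  | succ n ih =>
    simp only [Function.iterate_succ_apply']
    exact hstep _ ih

/-- Existence of a measurable consistent root of the estimating equations. The root is the limit of
the simplified Newton iteration started at `θ₀`, hence measurable, wherever the iteration
converges. -/
theorem exists_measurable_root (h_indep : iIndepFun Zs P) (h_law : ∀ i, HasLaw (Zs i) ρ P)
    {ψ : E → Z → F} {H : Z → E →L[ℝ] F} {L : Z → ℝ} {θ₀ : E} {r : ℝ}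
    (h : IsLinearizable ρ ψ H L θ₀ r)
    (hmeas : ∀ θ ∈ Metric.closedBall θ₀ r, Measurable (ψ θ))
    (hcont : ∀ z, ContinuousOn (fun θ => ψ θ z) (Metric.closedBall θ₀ r))
    (J : E ≃L[ℝ] F) (hJ : ∫ z, H z ∂ρ = J) :
    ∃ θhat : (N : ℕ) → (Fin N → Z) → E, (∀ N, Measurable (θhat N)) ∧
      (∀ᶠ p in probFilter P, θhat p.1 (fun i : Fin p.1 => Zs i p.2) ∈ Metric.closedBall θ₀ r ∧
        avg (ψ (θhat p.1 (fun i : Fin p.1 => Zs i p.2))) (fun i : Fin p.1 => Zs i p.2) = 0) ∧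
      Tendsto (fun p : ℕ × S => θhat p.1 (fun i : Fin p.1 => Zs i p.2)) (probFilter P)
        (𝓝 θ₀) := by
  have : CompleteSpace E := FiniteDimensional.complete ℝ E
  have : CompleteSpace F := FiniteDimensional.complete ℝ F
  have : ProperSpace E := FiniteDimensional.proper ℝ E
  have : ProperSpace F := FiniteDimensional.proper ℝ F
  set B := ‖(J.symm : F →L[ℝ] E)‖ + 1 with hB
  have hBpos : 0 < B := by positivity
  set C := |∫ z, L z ∂ρ| + 1 with hC
  have hCpos : 0 < C := by positivity
  -- With this radius the deviation of the averaged derivative from `J` and the quadratic remainder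
  -- each contribute at most `1/4` to the contraction constant.
  set δ := min r (1 / (4 * B * C)) with hδ
  have hδ0 : 0 < δ := lt_min h.pos (by positivity)
  have hδr : δ ≤ r := min_le_left _ _
  have hsub : Metric.closedBall θ₀ δ ⊆ Metric.closedBall θ₀ r :=
    Metric.closedBall_subset_closedBall hδr
  let G : (N : ℕ) → (Fin N → Z) → E → F := fun N d θ => avg (ψ θ) d
  let it : (N : ℕ) → ℕ → (Fin N → Z) → E := fun N n d => (newtonStep J θ₀ δ (G N d))^[n] θ₀
  have hitm : ∀ N n, Measurable (it N n) := fun N n =>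
    measurable_newtonStep_iterate J hδ0 (fun θ hθ => hmeas θ (hsub hθ))
      (fun z => (hcont z).mono hsub) n
  classical
  -- The estimator is the limit of the iterates where it exists, and `θ₀` elsewhere, so that it is
  -- measurable on the whole sample space.
  let θhat : (N : ℕ) → (Fin N → Z) → E := fun N d =>
    if hd : ∃ l, Tendsto (fun n => it N n d) atTop (𝓝 l) then hd.choose else θ₀
  have hθhat : ∀ N d l, Tendsto (fun n => it N n d) atTop (𝓝 l) → θhat N d = l := by
    intro N d l hl
    have hd : ∃ l, Tendsto (fun n => it N n d) atTop (𝓝 l) := ⟨l, hl⟩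
    simp only [θhat, dif_pos hd]
    exact tendsto_nhds_unique hd.choose_spec hl
  have hroot : ∀ᶠ p in probFilter P,
      θhat p.1 (fun i : Fin p.1 => Zs i p.2) ∈ Metric.closedBall θ₀ r ∧
      avg (ψ (θhat p.1 (fun i : Fin p.1 => Zs i p.2))) (fun i : Fin p.1 => Zs i p.2) = 0 ∧
      ‖θhat p.1 (fun i : Fin p.1 => Zs i p.2) - θ₀‖ ≤
        2 * ‖J.symm (avg (ψ θ₀) (fun i : Fin p.1 => Zs i p.2))‖ := by
    have hH := tendsto_avg_probFilter h_indep h_law h.measurable_deriv h.integrable_deriv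
    have hL := tendsto_avg_probFilter h_indep h_law h.measurable_bound h.integrable_bound
    have hψ := tendsto_avg_probFilter h_indep h_law h.measurable_center h.integrable_center
    rw [h.integral_center] at hψ
    rw [hJ] at hH
    have hψ' := (J.symm.continuous.tendsto 0).comp hψ
    rw [map_zero] at hψ'
    have e1 := (Metric.tendsto_nhds.1 hH) (1 / (4 * B)) (by positivity)
    have e2 := hL.eventually_lt_const (show ∫ z, L z ∂ρ < C by
      have := le_abs_self (∫ z, L z ∂ρ); linarith)
    have e3 := (Metric.tendsto_nhds.1 hψ') (δ / 2) (by positivity)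
    filter_upwards [e1, e2, e3, h.eventually_approx h_law] with p h1 h2 h3 h4
    obtain ⟨N, s⟩ := p
    simp only at h1 h2 h4 ⊢
    rw [dist_eq_norm] at h1
    simp only [Function.comp_apply, dist_zero_right] at h3
    obtain ⟨θ, hθ, hlim, hr0, hr1⟩ := exists_root_of_approx_affine J
      (G := fun θ => avg (ψ θ) (fun i : Fin N => Zs i s))
      (H := avg H (fun i : Fin N => Zs i s)) (c := θ₀) (b := C * δ) hδ0
      (fun θ hθ θ' hθ' => by
        refine (h4 θ (hsub hθ) θ' (hsub hθ')).trans ?_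
        have h5 : max ‖θ - θ₀‖ ‖θ' - θ₀‖ ≤ δ :=
          max_le (mem_closedBall_iff_norm.1 hθ) (mem_closedBall_iff_norm.1 hθ')
        have h6 : 0 ≤ max ‖θ - θ₀‖ ‖θ' - θ₀‖ := le_max_of_le_left (norm_nonneg _)
        gcongr ?_ * _
        calc _ ≤ C * max ‖θ - θ₀‖ ‖θ' - θ₀‖ := by gcongr
          _ ≤ C * δ := by gcongr)
      (by
        have h5 : C * δ ≤ 1 / (4 * B) := by
          calc C * δ ≤ C * (1 / (4 * B * C)) := by gcongr; exact min_le_right _ _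
            _ = 1 / (4 * B) := by field_simp
        calc _ ≤ B * (1 / (4 * B) + 1 / (4 * B)) := by
              gcongr
              linarith
          _ = 1 / 2 := by field_simp; norm_num)
      h3.le
    rw [hθhat N _ θ hlim]
    exact ⟨hsub hθ, hr0, hr1⟩
  refine ⟨θhat, fun N => ?_, hroot.mono fun p hp => ⟨hp.1, hp.2.1⟩, ?_⟩
  · set A : Set (Fin N → Z) := {d | ∃ l, Tendsto (fun n => it N n d) atTop (𝓝 l)} with hA
    have hAm : MeasurableSet A := measurableSet_exists_tendsto (hitm N)
    refine measurable_of_tendsto_metrizable (f := fun n d => if d ∈ A then it N n d else θ₀)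
      (fun n => Measurable.ite hAm (hitm N n) measurable_const) ?_
    rw [tendsto_pi_nhds]
    intro d
    by_cases hd : d ∈ A
    · obtain ⟨l, hl⟩ := id hd
      simp only [hd, if_true]
      rw [hθhat N d l hl]
      exact hl
    · simp only [hd, if_false]
      have : θhat N d = θ₀ := dif_neg hd
      rw [this]
      exact tendsto_const_nhds
  · have hψ := tendsto_avg_probFilter h_indep h_law h.measurable_center h.integrable_center
    rw [h.integral_center] at hψ
    have hψ' := ((J.symm.continuous.tendsto 0).comp hψ).norm.const_mul 2
    rw [map_zero, norm_zero, mul_zero] at hψ'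
    rw [tendsto_iff_norm_sub_tendsto_zero]
    exact squeeze_zero' (Eventually.of_forall fun _ => norm_nonneg _)
      (hroot.mono fun p hp => hp.2.2) hψ'

omit [BorelSpace E] [BorelSpace F] in
/-- Asymptotic linearity of consistent roots: a consistent root differs from `θ₀` by
`-J⁻¹` times the average of the estimating functions at `θ₀`, up to `o_p(N^{-1/2})`. -/
theorem tendsto_sqrt_smul_root (h_indep : iIndepFun Zs P) (h_law : ∀ i, HasLaw (Zs i) ρ P)
    {ψ : E → Z → F} {H : Z → E →L[ℝ] F} {L : Z → ℝ} {θ₀ : E} {r : ℝ}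
    (h : IsLinearizable ρ ψ H L θ₀ r) (J : E ≃L[ℝ] F) (hJ : ∫ z, H z ∂ρ = J)
    (hbdd : BoundedInProb P
      (fun (N : ℕ) s => √(N : ℝ) • avg (ψ θ₀) (fun i : Fin N => Zs i s)))
    {θg : ℕ → S → E} (hθg : Tendsto (fun p : ℕ × S => θg p.1 p.2) (probFilter P) (𝓝 θ₀))
    (hroot : ∀ᶠ p in probFilter P, avg (ψ (θg p.1 p.2)) (fun i : Fin p.1 => Zs i p.2) = 0) :
    Tendsto (fun p : ℕ × S => √(p.1 : ℝ) • (θg p.1 p.2 - θ₀) +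
      J.symm (√(p.1 : ℝ) • avg (ψ θ₀) (fun i : Fin p.1 => Zs i p.2))) (probFilter P) (𝓝 0) := by
  have : CompleteSpace E := FiniteDimensional.complete ℝ E
  have : CompleteSpace F := FiniteDimensional.complete ℝ F
  have : ProperSpace E := FiniteDimensional.proper ℝ E
  have : ProperSpace F := FiniteDimensional.proper ℝ F
  set B := ‖(J.symm : F →L[ℝ] E)‖ + 1 with hB
  have hBpos : 0 < B := by positivity
  have hH := tendsto_avg_probFilter h_indep h_law h.measurable_deriv h.integrable_deriv
  have hL := tendsto_avg_probFilter h_indep h_law h.measurable_bound h.integrable_bound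
  rw [hJ] at hH
  set R : ℕ × S → ℝ := fun p => ‖avg H (fun i : Fin p.1 => Zs i p.2) - J‖ +
    |avg L (fun i : Fin p.1 => Zs i p.2)| * ‖θg p.1 p.2 - θ₀‖ with hR
  have hR0 : Tendsto R (probFilter P) (𝓝 0) := by
    have h1 := tendsto_iff_norm_sub_tendsto_zero.1 hH
    have h2 := tendsto_iff_norm_sub_tendsto_zero.1 hθg
    have := h1.add (hL.abs.mul h2)
    simpa using this
  have hBR : Tendsto (fun p => B * R p) (probFilter P) (𝓝 0) := by simpa using hR0.const_mul B
  have hfin : Tendsto (fun p : ℕ × S => 2 * B ^ 2 * R p *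
      ‖√(p.1 : ℝ) • avg (ψ θ₀) (fun i : Fin p.1 => Zs i p.2)‖) (probFilter P) (𝓝 0) :=
    hbdd.tendsto_mul (fun _ _ => norm_nonneg _) (by simpa using hR0.const_mul (2 * B ^ 2))
  refine squeeze_zero_norm' ?_ hfin
  filter_upwards [hroot, h.eventually_approx h_law, hBR.eventually_le_const
    (show (0 : ℝ) < 1 / 2 by norm_num),
    hθg (Metric.closedBall_mem_nhds θ₀ h.pos)] with p h1 h2 h3 h4
  obtain ⟨N, s⟩ := p
  simp only at h1 h2 h3 h4 ⊢
  have hRdef : R (N, s) = ‖avg H (fun i : Fin N => Zs i s) - J‖ +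
    |avg L (fun i : Fin N => Zs i s)| * ‖θg N s - θ₀‖ := rfl
  have hRnn : 0 ≤ R (N, s) := by rw [hRdef]; positivity
  generalize R (N, s) = ρ' at *
  have h5 := h2 _ h4 θ₀ (Metric.mem_closedBall_self h.pos.le)
  rw [h1, sub_self, norm_zero, max_eq_left (norm_nonneg _), zero_sub] at h5
  generalize avg (ψ θ₀) (fun i : Fin N => Zs i s) = g at *
  generalize avg H (fun i : Fin N => Zs i s) = Hb at *
  generalize avg L (fun i : Fin N => Zs i s) = Lb at *
  generalize θg N s - θ₀ = Δ at *
  have h6 : Δ + J.symm g = -J.symm ((-g - Hb Δ) + (Hb - J) Δ) := by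
    have : (-g - Hb Δ) + (Hb - (J : E →L[ℝ] F)) Δ = -(J Δ + g) := by
      simp only [sub_apply, ContinuousLinearEquiv.coe_coe]; abel
    rw [this, map_neg, neg_neg, map_add, J.symm_apply_apply]
  have h7 : ‖Δ + J.symm g‖ ≤ B * ρ' * ‖Δ‖ := by
    rw [h6, norm_neg]
    calc _ ≤ ‖(J.symm : F →L[ℝ] E)‖ * ‖(-g - Hb Δ) + (Hb - (J : E →L[ℝ] F)) Δ‖ :=
          (J.symm : F →L[ℝ] E).le_opNorm _
      _ ≤ B * (|Lb| * ‖Δ‖ * ‖Δ‖ + ‖Hb - (J : E →L[ℝ] F)‖ * ‖Δ‖) := by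
          gcongr
          · linarith
          · refine (norm_add_le _ _).trans
              (add_le_add (h5.trans ?_) (ContinuousLinearMap.le_opNorm _ _))
            gcongr
            exact le_abs_self _
      _ = B * ρ' * ‖Δ‖ := by rw [hRdef]; ring
  have h8 : ‖J.symm g‖ ≤ B * ‖g‖ := by
    refine ((J.symm : F →L[ℝ] E).le_opNorm g).trans ?_
    gcongr
    linarith
  have h9 : ‖Δ‖ ≤ 2 * (B * ‖g‖) := by
    have h10 : ‖Δ‖ ≤ ‖Δ + J.symm g‖ + ‖J.symm g‖ := by
      have := norm_sub_le (Δ + J.symm g) (J.symm g)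
      rwa [add_sub_cancel_right] at this
    have h11 : B * ρ' * ‖Δ‖ ≤ 1 / 2 * ‖Δ‖ := by gcongr
    linarith
  rw [map_smul, ← smul_add, norm_smul, norm_smul]
  calc ‖√(N : ℝ)‖ * ‖Δ + J.symm g‖ ≤ ‖√(N : ℝ)‖ * (B * ρ' * (2 * (B * ‖g‖))) := by
        gcongr
        exact h7.trans (by gcongr)
    _ = 2 * B ^ 2 * ρ' * (‖√(N : ℝ)‖ * ‖g‖) := by ring

end Random

/-! ### Interpolation between a bounded function and its third derivative -/

section Calculus

set_option maxSynthPendingDepth 3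

variable {E F : Type*} [NormedAddCommGroup E] [NormedSpace ℝ E] [NormedAddCommGroup F]
  [NormedSpace ℝ F]

/-- First-order Taylor estimate from a Lipschitz bound on the derivative. -/
lemma norm_sub_sub_fderiv_le {f : E → F} {s : Set E} (hs : Convex ℝ s) {C : ℝ} (hC : 0 ≤ C)
    (hf : ∀ x ∈ s, DifferentiableAt ℝ f x)
    (hlip : ∀ x ∈ s, ∀ y ∈ s, ‖fderiv ℝ f x - fderiv ℝ f y‖ ≤ C * ‖x - y‖)
    {x y : E} (hx : x ∈ s) (hy : y ∈ s) :
    ‖f y - f x - fderiv ℝ f x (y - x)‖ ≤ C * ‖y - x‖ ^ 2 := by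
  have hseg : segment ℝ x y ⊆ s := hs.segment_subset hx hy
  have := (convex_segment x y).norm_image_sub_le_of_norm_hasFDerivWithin_le'
    (f := f) (f' := fderiv ℝ f) (φ := fderiv ℝ f x) (C := C * ‖y - x‖)
    (fun z hz => (hf z (hseg hz)).hasFDerivAt.hasFDerivWithinAt)
    (fun z hz => (hlip z (hseg hz) x hx).trans (by
      gcongr
      exact norm_sub_le_of_mem_segment hz))
    (left_mem_segment ℝ x y) (right_mem_segment ℝ x y)
  calc _ ≤ C * ‖y - x‖ * ‖y - x‖ := this
    _ = _ := by ring

lemma norm_fderiv_sub_le {f : E → F} {s : Set E} (hs : Convex ℝ s) {C : ℝ}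
    (hf : ∀ x ∈ s, DifferentiableAt ℝ f x) (hb : ∀ x ∈ s, ‖fderiv ℝ f x‖ ≤ C)
    {x y : E} (hx : x ∈ s) (hy : y ∈ s) : ‖f x - f y‖ ≤ C * ‖x - y‖ :=
  hs.norm_image_sub_le_of_norm_fderiv_le hf hb hy hx

lemma norm_le_of_bilin_le {A : E →L[ℝ] E →L[ℝ] ℝ} {t b : ℝ} (ht : 0 < t) (hb : 0 ≤ b)
    (h : ∀ p q, ‖p‖ ≤ t → ‖q‖ ≤ t → |A p q| ≤ b) : ‖A‖ ≤ b / t ^ 2 := by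
  refine A.opNorm_le_of_unit_norm (by positivity) fun v hv => ?_
  refine (A v).opNorm_le_of_unit_norm (by positivity) fun w hw => ?_
  have := h (t • v) (t • w) (by rw [norm_smul, hv, Real.norm_of_nonneg ht.le, mul_one])
    (by rw [norm_smul, hw, Real.norm_of_nonneg ht.le, mul_one])
  rw [map_smul, map_smul, smul_apply, smul_eq_mul, smul_eq_mul, abs_mul, abs_mul,
    abs_of_pos ht] at this
  rw [le_div_iff₀ (by positivity), Real.norm_eq_abs]
  nlinarith

/-- Second derivatives of a function with values in `[0, 1]` are controlled by a bound for the
third derivative, by comparison with second-order differences. -/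
lemma norm_snd_fderiv_le {f : E → ℝ} {c : E} {t M : ℝ} (ht : 0 < t) (hM : 0 ≤ M)
    (hf : ContDiffOn ℝ 3 f (Metric.ball c (4 * t)))
    (hf0 : ∀ x ∈ Metric.ball c (4 * t), 0 ≤ f x ∧ f x ≤ 1)
    (h3 : ∀ x ∈ Metric.ball c (4 * t), ‖fderiv ℝ (fderiv ℝ (fderiv ℝ f)) x‖ ≤ M)
    {x : E} (hx : x ∈ Metric.ball c (2 * t)) :
    ‖fderiv ℝ (fderiv ℝ f) x‖ ≤ (2 + 2 * M * t ^ 3) / t ^ 2 := by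
  set s := Metric.ball c (4 * t) with hs
  have hso : IsOpen s := Metric.isOpen_ball
  have hsc : Convex ℝ s := convex_ball _ _
  have hf1 : ContDiffOn ℝ 2 (fderiv ℝ f) s := hf.fderiv_of_isOpen hso (by norm_num)
  have hf2 : ContDiffOn ℝ 1 (fderiv ℝ (fderiv ℝ f)) s := hf1.fderiv_of_isOpen hso (by norm_num)
  have hd0 : ∀ y ∈ s, DifferentiableAt ℝ f y := fun y hy =>
    (hf.contDiffAt (hso.mem_nhds hy)).differentiableAt (by norm_num)
  have hd1 : ∀ y ∈ s, DifferentiableAt ℝ (fderiv ℝ f) y := fun y hy =>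
    (hf1.contDiffAt (hso.mem_nhds hy)).differentiableAt (by norm_num)
  have hd2 : ∀ y ∈ s, DifferentiableAt ℝ (fderiv ℝ (fderiv ℝ f)) y := fun y hy =>
    (hf2.contDiffAt (hso.mem_nhds hy)).differentiableAt (by norm_num)
  have hlip2 : ∀ y ∈ s, ∀ z ∈ s,
      ‖fderiv ℝ (fderiv ℝ f) y - fderiv ℝ (fderiv ℝ f) z‖ ≤ M * ‖y - z‖ := fun y hy z hz =>
    norm_fderiv_sub_le hsc hd2 h3 hy hz
  refine norm_le_of_bilin_le ht (by positivity) fun p q hp hq => ?_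
  have hmem : ∀ u : E, ‖u‖ ≤ t → x + u ∈ s ∧ x + u + p ∈ s := by
    intro u hu
    rw [hs, mem_ball_iff_norm, mem_ball_iff_norm]
    rw [mem_ball_iff_norm] at hx
    constructor
    · have := norm_add_le (x - c) u
      rw [show x + u - c = x - c + u by abel]; linarith
    · have := norm_add₃_le (a := x - c) (b := u) (c := p)
      rw [show x + u + p - c = x - c + u + p by abel]; linarith
  have hxs : x ∈ s := by simpa using (hmem 0 (by simpa using ht.le)).1
  -- The increment of `f` in the direction `p`, as a function of the base point.
  set k : E → ℝ := fun u => f (x + u + p) - f (x + u) with hk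
  have hk' : ∀ u ∈ Metric.closedBall (0 : E) t, HasFDerivWithinAt k
      (fderiv ℝ f (x + u + p) - fderiv ℝ f (x + u)) (Metric.closedBall 0 t) u := by
    intro u hu
    obtain ⟨h1, h2⟩ := hmem u (mem_closedBall_zero_iff.1 hu)
    have e1 : HasFDerivAt (fun u => f (x + u + p)) (fderiv ℝ f (x + u + p)) u := by
      have := (hd0 _ h2).hasFDerivAt.comp u (((hasFDerivAt_id u).const_add x).add_const p)
      rw [ContinuousLinearMap.comp_id] at this
      exact this
    have e2 : HasFDerivAt (fun u => f (x + u)) (fderiv ℝ f (x + u)) u := by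
      have := (hd0 _ h1).hasFDerivAt.comp u ((hasFDerivAt_id u).const_add x)
      rw [ContinuousLinearMap.comp_id] at this
      exact this
    exact (e1.sub e2).hasFDerivWithinAt
  have hkb : ∀ u ∈ Metric.closedBall (0 : E) t,
      ‖fderiv ℝ f (x + u + p) - fderiv ℝ f (x + u) - fderiv ℝ (fderiv ℝ f) x p‖ ≤
        2 * M * t ^ 2 := by
    intro u hu
    have hu' := mem_closedBall_zero_iff.1 hu
    obtain ⟨h1, h2⟩ := hmem u hu'
    have e1 := norm_sub_sub_fderiv_le hsc hM hd1 hlip2 h1 h2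
    have e2 := hlip2 _ h1 _ hxs
    rw [add_sub_cancel_left] at e1 e2
    have e3 := (fderiv ℝ (fderiv ℝ f) (x + u) - fderiv ℝ (fderiv ℝ f) x).le_opNorm p
    rw [sub_apply] at e3
    have e4 : fderiv ℝ f (x + u + p) - fderiv ℝ f (x + u) - fderiv ℝ (fderiv ℝ f) x p =
        (fderiv ℝ f (x + u + p) - fderiv ℝ f (x + u) - fderiv ℝ (fderiv ℝ f) (x + u) p) +
        (fderiv ℝ (fderiv ℝ f) (x + u) p - fderiv ℝ (fderiv ℝ f) x p) := by abel
    rw [e4]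
    refine (norm_add_le _ _).trans ?_
    calc _ ≤ M * ‖p‖ ^ 2 + M * ‖u‖ * ‖p‖ := by
          refine add_le_add e1 (e3.trans ?_)
          gcongr
      _ ≤ M * t ^ 2 + M * t * t := by gcongr
      _ = _ := by ring
  -- `k q - k 0` is a second-order difference: it is at most `2` in absolute value, and it differs
  -- from the second derivative at `(p, q)` by the third-order error of `hkb`.
  have hfin := (convex_closedBall (0 : E) t).norm_image_sub_le_of_norm_hasFDerivWithin_le'
    hk' hkb (Metric.mem_closedBall_self ht.le) (mem_closedBall_zero_iff.2 hq)
  rw [sub_zero, Real.norm_eq_abs] at hfin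
  have h0 := mem_closedBall_zero_iff.2 hq
  have b1 := hf0 _ (hmem q hq).1
  have b2 := hf0 _ (hmem q hq).2
  have b3 := hf0 _ (hmem 0 (by simpa using ht.le)).1
  have b4 := hf0 _ (hmem 0 (by simpa using ht.le)).2
  have hfin2 : 2 * M * t ^ 2 * ‖q‖ ≤ 2 * M * t ^ 3 := by
    calc 2 * M * t ^ 2 * ‖q‖ ≤ 2 * M * t ^ 2 * t := by gcongr
      _ = _ := by ring
  have h5 := abs_le.1 (hfin.trans hfin2)
  simp only [hk] at h5
  rw [abs_le]
  constructor <;> linarith [h5.1, h5.2, b1.1, b1.2, b2.1, b2.2, b3.1, b3.2, b4.1, b4.2]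

/-- The square of the first derivative of a function with values in `[0, 1]` is controlled by a
bound for the second derivative. -/
lemma sq_norm_fderiv_le {f : E → ℝ} {c : E} {t K : ℝ} (ht : 0 < t) (hK : 1 / t ^ 2 ≤ K)
    (hf : ContDiffOn ℝ 2 f (Metric.ball c (2 * t)))
    (hf0 : ∀ x ∈ Metric.ball c (2 * t), 0 ≤ f x ∧ f x ≤ 1)
    (h2 : ∀ x ∈ Metric.ball c (2 * t), ‖fderiv ℝ (fderiv ℝ f) x‖ ≤ K)
    {x : E} (hx : x ∈ Metric.ball c t) :
    ‖fderiv ℝ f x‖ ^ 2 ≤ 4 * K := by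
  set s := Metric.ball c (2 * t) with hs
  have hso : IsOpen s := Metric.isOpen_ball
  have hsc : Convex ℝ s := convex_ball _ _
  have hK0 : 0 < K := lt_of_lt_of_le (by positivity) hK
  have hf1 : ContDiffOn ℝ 1 (fderiv ℝ f) s := hf.fderiv_of_isOpen hso (by norm_num)
  have hd0 : ∀ y ∈ s, DifferentiableAt ℝ f y := fun y hy =>
    (hf.contDiffAt (hso.mem_nhds hy)).differentiableAt (by norm_num)
  have hd1 : ∀ y ∈ s, DifferentiableAt ℝ (fderiv ℝ f) y := fun y hy =>
    (hf1.contDiffAt (hso.mem_nhds hy)).differentiableAt (by norm_num)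
  have hlip : ∀ y ∈ s, ∀ z ∈ s, ‖fderiv ℝ f y - fderiv ℝ f z‖ ≤ K * ‖y - z‖ :=
    fun y hy z hz => norm_fderiv_sub_le hsc hd1 h2 hy hz
  have hsq : 0 < √K := Real.sqrt_pos.2 hK0
  have hsq2 : √K ^ 2 = K := Real.sq_sqrt hK0.le
  -- The step `τ` balances the two terms of `|τ f' v| ≤ 1 + K τ²`; the hypothesis `hK` says that it
  -- is at most `t`.
  set τ := 1 / √K with hτ
  have hτ0 : 0 < τ := by positivity
  have hτt : τ ≤ t := by
    rw [hτ, div_le_iff₀ hsq]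
    have : 1 / t ≤ √K := Real.le_sqrt_of_sq_le (by rw [div_pow, one_pow]; exact hK)
    calc (1 : ℝ) = t * (1 / t) := by field_simp
      _ ≤ t * √K := by gcongr
  have hKτ : K * τ ^ 2 = 1 := by rw [hτ, div_pow, hsq2]; field_simp
  have key : ‖fderiv ℝ f x‖ ≤ 2 * √K := by
    refine (fderiv ℝ f x).opNorm_le_of_unit_norm (by positivity) fun v hv => ?_
    have hxs : x ∈ s := Metric.ball_subset_ball (by linarith) hx
    have hys : x + τ • v ∈ s := by
      rw [hs, mem_ball_iff_norm]
      rw [mem_ball_iff_norm] at hx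
      have := norm_add_le (x - c) (τ • v)
      rw [norm_smul, hv, Real.norm_of_nonneg hτ0.le] at this
      rw [show x + τ • v - c = x - c + τ • v by abel]; linarith
    have e1 := norm_sub_sub_fderiv_le hsc hK0.le hd0 hlip hxs hys
    rw [add_sub_cancel_left, norm_smul, hv, Real.norm_of_nonneg hτ0.le, mul_one, hKτ,
      map_smul, smul_eq_mul, Real.norm_eq_abs, abs_le] at e1
    have b1 := hf0 _ hxs
    have b2 := hf0 _ hys
    have e2 : |τ * fderiv ℝ f x v| ≤ 2 := by rw [abs_le]; constructor <;> linarith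
    rw [abs_mul, abs_of_pos hτ0, hτ, div_mul_eq_mul_div, one_mul, div_le_iff₀ hsq] at e2
    exact e2
  calc ‖fderiv ℝ f x‖ ^ 2 ≤ (2 * √K) ^ 2 := by gcongr
    _ = 4 * K := by rw [mul_pow, hsq2]; norm_num

lemma norm_iteratedFDeriv_two {f : E → F} {x : E} :
    ‖iteratedFDeriv ℝ 2 f x‖ = ‖fderiv ℝ (fderiv ℝ f) x‖ := by
  rw [← norm_iteratedFDeriv_fderiv, norm_iteratedFDeriv_one]

lemma norm_iteratedFDeriv_three {f : E → F} {x : E} :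
    ‖iteratedFDeriv ℝ 3 f x‖ = ‖fderiv ℝ (fderiv ℝ (fderiv ℝ f)) x‖ := by
  rw [← norm_iteratedFDeriv_fderiv, norm_iteratedFDeriv_two]

/-- Let `h` take values in `[0, 1]` and have third derivative bounded by `M` on a ball, and let
`A` be a fixed smooth factor. On a smaller ball the second and third derivative of `A * h`, and the
square of the first one, are bounded linearly in `M`. The bound for the square is what makes the
score square integrable when `M` is merely integrable. -/
theorem exists_bound_fderiv_mul [FiniteDimensional ℝ E] {A : E → ℝ} {c : E} {t : ℝ} (ht : 0 < t)
    (hA : ContDiffOn ℝ 3 A (Metric.ball c (4 * t))) :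
    ∃ C : ℝ, 0 ≤ C ∧ ∀ (h : E → ℝ) (M : ℝ), 0 ≤ M →
      ContDiffOn ℝ 3 h (Metric.ball c (4 * t)) →
      (∀ x ∈ Metric.ball c (4 * t), 0 ≤ h x ∧ h x ≤ 1) →
      (∀ x ∈ Metric.ball c (4 * t), ‖fderiv ℝ (fderiv ℝ (fderiv ℝ h)) x‖ ≤ M) →
      ∀ x ∈ Metric.ball c t,
        ‖fderiv ℝ (fderiv ℝ (fderiv ℝ fun y => A y * h y)) x‖ ≤ C * (1 + M) ∧
        ‖fderiv ℝ (fderiv ℝ fun y => A y * h y) x‖ ≤ C * (1 + M) ∧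
        ‖fderiv ℝ (fun y => A y * h y) x‖ ^ 2 ≤ C * (1 + M) := by
  have : ProperSpace E := FiniteDimensional.proper ℝ E
  set s := Metric.ball c (4 * t) with hs
  have hso : IsOpen s := Metric.isOpen_ball
  have hsub : Metric.closedBall c t ⊆ s := Metric.closedBall_subset_ball (by linarith)
  have hbd : ∀ i ≤ 3, ∃ a, ∀ x ∈ Metric.closedBall c t, ‖iteratedFDeriv ℝ i A x‖ ≤ a := by
    intro i hi
    have hc : ContinuousOn (fun x => iteratedFDeriv ℝ i A x) (Metric.closedBall c t) := by
      have := (hA.continuousOn_iteratedFDerivWithin (m := i) (by exact_mod_cast hi)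
        hso.uniqueDiffOn).mono hsub
      refine this.congr fun x hx => ?_
      exact (iteratedFDerivWithin_of_isOpen i hso (hsub hx)).symm
    exact (isCompact_closedBall c t).exists_bound_of_continuousOn hc
  choose! a ha using hbd
  set a' := |a 0| + |a 1| + |a 2| + |a 3| with ha'
  have ha'0 : 0 ≤ a' := by positivity
  have hale : ∀ i ≤ 3, ∀ x ∈ Metric.closedBall c t, ‖iteratedFDeriv ℝ i A x‖ ≤ a' := by
    intro i hi x hx
    refine (ha i hi x hx).trans ((le_abs_self _).trans ?_)
    have := abs_nonneg (a 0); have := abs_nonneg (a 1)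
    have := abs_nonneg (a 2); have := abs_nonneg (a 3)
    interval_cases i <;> linarith
  set B := 3 / t ^ 2 + 2 * t with hB
  have hB0 : 0 ≤ B := by positivity
  refine ⟨8 * a' * (1 + 4 * B) + 2 * a' ^ 2 * (1 + 4 * B), by positivity, ?_⟩
  intro h M hM hh hh0 hh3 x hx
  have hxs : x ∈ s := hsub (Metric.ball_subset_closedBall hx)
  have hxc := Metric.ball_subset_closedBall hx
  -- The constant `3` in place of `2` makes `K` large enough for `sq_norm_fderiv_le`.
  set K := (3 + 2 * M * t ^ 3) / t ^ 2 with hK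
  have hKB : K ≤ B * (1 + M) := by
    have : K = 3 / t ^ 2 + 2 * t * M := by rw [hK]; field_simp
    rw [this, hB]
    have : 0 ≤ 3 / t ^ 2 * M := by positivity
    nlinarith
  have hK0 : 0 ≤ K := by positivity
  have hsnd : ∀ y ∈ Metric.ball c (2 * t), ‖fderiv ℝ (fderiv ℝ h) y‖ ≤ K := fun y hy =>
    (norm_snd_fderiv_le ht hM hh hh0 hh3 hy).trans (by rw [hK]; gcongr; norm_num)
  have h24 : Metric.ball c (2 * t) ⊆ s := Metric.ball_subset_ball (by linarith)
  have hfst := sq_norm_fderiv_le ht (show 1 / t ^ 2 ≤ K by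
      rw [hK]; gcongr; have : 0 ≤ 2 * M * t ^ 3 := by positivity
      linarith) ((hh.mono h24).of_le (by norm_num)) (fun y hy => hh0 y (h24 hy)) hsnd hx
  have n0 : ‖iteratedFDeriv ℝ 0 h x‖ ≤ 1 := by
    rw [norm_iteratedFDeriv_zero, Real.norm_eq_abs, abs_of_nonneg (hh0 x hxs).1]
    exact (hh0 x hxs).2
  have n1 : ‖iteratedFDeriv ℝ 1 h x‖ ≤ 1 + 4 * K := by
    rw [norm_iteratedFDeriv_one]; nlinarith [sq_nonneg (‖fderiv ℝ h x‖ - 1)]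
  have n2 : ‖iteratedFDeriv ℝ 2 h x‖ ≤ K := by
    rw [norm_iteratedFDeriv_two]; exact hsnd x (Metric.ball_subset_ball (by linarith) hx)
  have n3 : ‖iteratedFDeriv ℝ 3 h x‖ ≤ M := by
    rw [norm_iteratedFDeriv_three]; exact hh3 x hxs
  -- Leibniz rule, with all derivatives of `h` bounded by `1 + M + 4 * K`
  have hprod : ∀ n ≤ 3, ‖iteratedFDeriv ℝ n (fun y => A y * h y) x‖ ≤
      ∑ i ∈ Finset.range (n + 1), (n.choose i : ℝ) * ‖iteratedFDeriv ℝ i A x‖ *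
        ‖iteratedFDeriv ℝ (n - i) h x‖ := by
    intro n hn
    have := norm_iteratedFDerivWithin_mul_le hA hh hso.uniqueDiffOn hxs (n := n)
      (by exact_mod_cast hn)
    simpa only [iteratedFDerivWithin_of_isOpen _ hso hxs] using this
  set T := 1 + M + 4 * K with hT
  have hT0 : 0 ≤ T := by positivity
  have hη : ∀ i ≤ 3, ‖iteratedFDeriv ℝ i h x‖ ≤ T := by
    intro i hi
    interval_cases i
    · exact n0.trans (by rw [hT]; linarith)
    · exact n1.trans (by rw [hT]; linarith)
    · exact n2.trans (by rw [hT]; linarith)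
    · exact n3.trans (by rw [hT]; linarith)
  have hprod' : ∀ n ≤ 3, ‖iteratedFDeriv ℝ n (fun y => A y * h y) x‖ ≤ 2 ^ n * (a' * T) := by
    intro n hn
    refine (hprod n hn).trans ?_
    calc _ ≤ ∑ i ∈ Finset.range (n + 1), (n.choose i : ℝ) * (a' * T) := by
          refine Finset.sum_le_sum fun i hi => ?_
          have hi' : i ≤ n := Nat.lt_succ_iff.1 (Finset.mem_range.1 hi)
          rw [mul_assoc]
          gcongr
          · exact hale i (hi'.trans hn) x hxc
          · exact hη _ ((Nat.sub_le _ _).trans hn)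
      _ = _ := by
          rw [← Finset.sum_mul]
          congr 1
          exact_mod_cast Nat.sum_range_choose n
  have hTB : T ≤ (1 + 4 * B) * (1 + M) := by rw [hT]; linarith
  have hE : 0 ≤ 2 * a' ^ 2 * (1 + 4 * B) * (1 + M) := by positivity
  have hE' : 0 ≤ a' * (1 + 4 * B) * (1 + M) := by positivity
  have haT : a' * T ≤ a' * (1 + 4 * B) * (1 + M) := by
    rw [mul_assoc]; gcongr
  have p2 := hprod' 2 (by norm_num)
  have p3 := hprod' 3 (by norm_num)
  rw [norm_iteratedFDeriv_two] at p2
  rw [norm_iteratedFDeriv_three] at p3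
  refine ⟨by linarith, by linarith, ?_⟩
  -- The crude bound for the first derivative of `h` would give a square of order `M²`, so the bound
  -- for its square is used instead.
  have p1 := hprod 1 (by norm_num)
  simp only [Finset.sum_range_succ, Finset.sum_range_zero, zero_add, Nat.choose_zero_right,
    Nat.choose_self, Nat.cast_one, one_mul, Nat.sub_zero] at p1
  rw [norm_iteratedFDeriv_one, norm_iteratedFDeriv_one (f := h)] at p1
  have p1' : ‖fderiv ℝ (fun y => A y * h y) x‖ ≤ a' * (‖fderiv ℝ h x‖ + 1) := by
    refine p1.trans ?_
    rw [mul_add]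
    gcongr
    · exact hale 0 (by norm_num) x hxc
    · exact hale 1 (by norm_num) x hxc
  calc ‖fderiv ℝ (fun y => A y * h y) x‖ ^ 2 ≤ (a' * (‖fderiv ℝ h x‖ + 1)) ^ 2 := by gcongr
    _ ≤ a' ^ 2 * (2 * (4 * K + 1)) := by
        rw [mul_pow]
        gcongr
        nlinarith [sq_nonneg (‖fderiv ℝ h x‖ - 1)]
    _ ≤ a' ^ 2 * (2 * ((1 + 4 * B) * (1 + M))) := by
        gcongr
        linarith
    _ ≤ _ := by linarith

end Calculus

/-! ### The random-effects model -/

section Model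

variable {T K : ℕ}

lemma posDef_errCov {θ : Param K} (hθ : θ ∈ admissible K) : (errCov T θ).PosDef := by
  have h1 : (Matrix.of fun _ _ => (1 : ℝ) : Matrix (Fin T) (Fin T) ℝ).PosSemidef := by
    convert Matrix.posSemidef_vecMulVec_self_star (fun _ : Fin T => (1 : ℝ)) using 1
    ext i j
    simp [Matrix.vecMulVec]
  exact (Matrix.PosDef.one.smul hθ.2).add_posSemidef (h1.smul hθ.1)

/-- The eigenvalue `σ_ε² + T σ_α²` of the error covariance matrix is positive. -/
lemma varEps_add_pos {θ : Param K} (hθ : θ ∈ admissible K) : 0 < varEps θ + T * varAlpha θ := by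
  have := hθ.1
  have := hθ.2
  positivity

lemma inv_errCov {θ : Param K} (hθ : θ ∈ admissible K) :
    (errCov T θ)⁻¹ = (1 / varEps θ) • ((1 : Matrix (Fin T) (Fin T) ℝ) -
      (varAlpha θ / (varEps θ + T * varAlpha θ)) • Matrix.of fun _ _ => (1 : ℝ)) := by
  have h1 := hθ.2.ne'
  have h2 := (varEps_add_pos (T := T) hθ).ne'
  refine Matrix.inv_eq_right_inv ?_
  have hJ : (Matrix.of fun _ _ => (1 : ℝ) : Matrix (Fin T) (Fin T) ℝ) *
      (Matrix.of fun _ _ => (1 : ℝ)) = (T : ℝ) • Matrix.of fun _ _ => (1 : ℝ) := by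
    ext i j
    simp [Matrix.mul_apply]
  rw [errCov]
  generalize (Matrix.of fun _ _ => (1 : ℝ) : Matrix (Fin T) (Fin T) ℝ) = E at *
  simp only [add_mul, mul_sub, smul_mul_assoc, mul_smul_comm, one_mul, mul_one, hJ]
  generalize hd : varEps θ + T * varAlpha θ = d at *
  match_scalars
  · field_simp
  · field_simp
    linear_combination (-varAlpha θ) * hd

lemma quadForm_eq {θ : Param K} (hθ : θ ∈ admissible K) (x : Cov T K) (y : Resp T) :
    quadForm θ x y = (1 / varEps θ) * (∑ t, resid θ x y t ^ 2 -
      varAlpha θ / (varEps θ + T * varAlpha θ) * (∑ t, resid θ x y t) ^ 2) := by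
  rw [quadForm, inv_errCov hθ]
  generalize resid θ x y = r
  have hE : r ⬝ᵥ Matrix.mulVec (Matrix.of fun _ _ => (1 : ℝ)) r = (∑ t, r t) ^ 2 := by
    simp [dotProduct, Matrix.mulVec, ← Finset.sum_mul, sq]
  rw [Matrix.smul_mulVec, Matrix.sub_mulVec, Matrix.smul_mulVec, dotProduct_smul,
    dotProduct_sub, dotProduct_smul, hE]
  simp [dotProduct, sq]

/-- The quadratic form is bounded below by the squared residuals over the largest eigenvalue of the
error covariance matrix. -/
lemma le_quadForm {θ : Param K} (hθ : θ ∈ admissible K) (x : Cov T K) (y : Resp T) :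
    (∑ t, resid θ x y t ^ 2) / (varEps θ + T * varAlpha θ) ≤ quadForm θ x y := by
  rw [quadForm_eq hθ]
  generalize resid θ x y = r
  have h1 := hθ.2
  have h0 := hθ.1
  have h2 := varEps_add_pos (T := T) hθ
  have hcs : (∑ t, r t) ^ 2 ≤ T * ∑ t, r t ^ 2 := by
    have := sq_sum_le_card_mul_sum_sq (s := Finset.univ) (f := r)
    simpa using this
  generalize varEps θ = e at *
  generalize varAlpha θ = a at *
  rw [div_le_iff₀ h2]
  have h3 : 1 / e * (∑ t, r t ^ 2 - a / (e + T * a) * (∑ t, r t) ^ 2) * (e + T * a) =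
      1 / e * ((e + T * a) * ∑ t, r t ^ 2 - a * (∑ t, r t) ^ 2) := by
    field_simp
  rw [h3, one_div, le_inv_mul_iff₀ h1]
  nlinarith [mul_le_mul_of_nonneg_left hcs h0]

lemma quadForm_nonneg {θ : Param K} (hθ : θ ∈ admissible K) (x : Cov T K) (y : Resp T) :
    0 ≤ quadForm θ x y := by
  have := varEps_add_pos (T := T) hθ
  exact le_trans (by positivity) (le_quadForm hθ x y)

lemma modelDensity_pos {θ : Param K} (hθ : θ ∈ admissible K) (x : Cov T K) (y : Resp T) :
    0 < modelDensity θ x y := by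
  have := (posDef_errCov (T := T) hθ).det_pos
  unfold modelDensity
  positivity

/-- The logarithm of the factor of the model density that does not depend on the observation. -/
noncomputable def logScale (T : ℕ) (θ : Param K) : ℝ :=
  -(T : ℝ) / 2 * Real.log (2 * Real.pi) + -(1 : ℝ) / 2 * Real.log (errCov T θ).det

lemma log_modelDensity {θ : Param K} (hθ : θ ∈ admissible K) (x : Cov T K) (y : Resp T) :
    Real.log (modelDensity θ x y) = logScale T θ - 1 / 2 * quadForm θ x y := by
  have hd := (posDef_errCov (T := T) hθ).det_pos
  have hp : 0 < 2 * Real.pi := by positivity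
  rw [modelDensity, Real.log_mul (by positivity) (by positivity),
    Real.log_mul (by positivity) (by positivity), Real.log_exp, Real.log_rpow hp,
    Real.log_rpow hd, logScale]
  ring

lemma modelDensity_rpow {θ : Param K} (hθ : θ ∈ admissible K) (x : Cov T K) (y : Resp T) (s : ℝ) :
    modelDensity θ x y ^ s =
      Real.exp (s * logScale T θ) * Real.exp (-(s / 2) * quadForm θ x y) := by
  rw [Real.rpow_def_of_pos (modelDensity_pos hθ x y), log_modelDensity hθ, ← Real.exp_add]
  ring_nf

/-- The integral of a power of the model density does not depend on the covariates, and it depends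
on the parameter only through the determinant of the error covariance matrix. -/
lemma exists_integral_modelDensity_rpow (T K : ℕ) (s : ℝ) : ∃ κ : ℝ, ∀ θ ∈ admissible K,
    ∀ x : Cov T K, ∫ y, modelDensity θ x y ^ s =
      κ * (Real.exp (s * logScale T θ) * (errCov T θ).det ^ (1 / 2 : ℝ)) := by
  refine ⟨∫ y : Resp T, Real.exp (-(s / 2) * (y ⬝ᵥ y)), fun θ hθ x => ?_⟩
  simp_rw [modelDensity_rpow hθ]
  rw [integral_const_mul]
  have hpd := posDef_errCov (T := T) hθ
  have hdet := hpd.det_pos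
  -- The substitution `y ↦ B (y - x β)`, with `Ω⁻¹ = Bᵀ B`, turns the quadratic form into `y ⬝ᵥ y`.
  obtain ⟨B, hB⟩ : ∃ B : Matrix (Fin T) (Fin T) ℝ, (errCov T θ)⁻¹ = B.conjTranspose * B := by
    open scoped MatrixOrder in
    exact CStarAlgebra.nonneg_iff_eq_star_mul_self.mp hpd.inv.posSemidef.nonneg
  have hBdet : B.det ^ 2 = (errCov T θ).det⁻¹ := by
    have := congrArg Matrix.det hB
    rw [Matrix.det_mul, Matrix.det_conjTranspose, Matrix.det_nonsing_inv,
      Ring.inverse_eq_inv'] at this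
    rw [this]
    simp [sq]
  have hB0 : B.det ≠ 0 := by
    intro h
    rw [h] at hBdet
    have := inv_pos.2 hdet
    rw [← hBdet] at this
    simp at this
  have hquad : ∀ y, quadForm θ x y = (Matrix.mulVec B (resid θ x y)) ⬝ᵥ
      (Matrix.mulVec B (resid θ x y)) := by
    intro y
    rw [quadForm, hB, ← Matrix.mulVec_mulVec, Matrix.dotProduct_mulVec,
      Matrix.conjTranspose_eq_transpose_of_trivial, Matrix.vecMul_transpose]
  have h1 : ∫ y, Real.exp (-(s / 2) * quadForm θ x y) =
      ∫ y, Real.exp (-(s / 2) * ((Matrix.mulVec B y) ⬝ᵥ (Matrix.mulVec B y))) := by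
    simp_rw [hquad, resid]
    exact integral_sub_right_eq_self
      (fun y => Real.exp (-(s / 2) * ((Matrix.mulVec B y) ⬝ᵥ (Matrix.mulVec B y)))) _
  have h2 := Real.map_matrix_volume_pi_eq_smul_volume_pi hB0
  have hcont : Continuous fun y : Resp T => Real.exp (-(s / 2) * (y ⬝ᵥ y)) := by
    unfold dotProduct; fun_prop
  have h3 : ∫ y, Real.exp (-(s / 2) * ((Matrix.mulVec B y) ⬝ᵥ (Matrix.mulVec B y))) =
      |B.det⁻¹| * ∫ y : Resp T, Real.exp (-(s / 2) * (y ⬝ᵥ y)) := by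
    have h4 : ∫ y, Real.exp (-(s / 2) * (y ⬝ᵥ y)) ∂(Measure.map (⇑(Matrix.toLin' B)) volume) =
        ∫ y, Real.exp (-(s / 2) * ((Matrix.mulVec B y) ⬝ᵥ (Matrix.mulVec B y))) := by
      rw [integral_map (LinearMap.continuous_of_finiteDimensional _).aemeasurable
        hcont.aestronglyMeasurable]
      simp [Matrix.toLin'_apply]
    rw [← h4, h2, integral_smul_measure, ENNReal.toReal_ofReal (abs_nonneg _), smul_eq_mul]
  have h5 : |B.det⁻¹| = (errCov T θ).det ^ (1 / 2 : ℝ) := by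
    rw [← Real.sqrt_eq_rpow, abs_inv]
    have : |B.det| = √((errCov T θ).det⁻¹) := by rw [← hBdet, Real.sqrt_sq_eq_abs]
    rw [this, Real.sqrt_inv, inv_inv]
  rw [h1, h3, h5]
  ring

end Model

/-! ### The log-density as a finite combination of functions of the parameter -/

section Separation

variable {T K : ℕ}

/-- The log-density at an observation, as a function of the parameter. -/
noncomputable def logDensity (θ : Param K) (z : Cov T K × Resp T) : ℝ :=
  Real.log (modelDensity θ z.1 z.2)

/-- The entries of the matrix `(y, x)`, with `none` for the column of the response. -/
def dataEntry (z : Cov T K × Resp T) (t : Fin T) : Option (Fin K) → ℝ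
  | none => z.2 t
  | some k => z.1 t k

/-- The coefficients of the columns of the matrix `(y, x)` in the residual `y - x β`. -/
def residCoeff (θ : Param K) : Option (Fin K) → ℝ
  | none => 1
  | some k => -beta θ k

lemma resid_eq_sum (θ : Param K) (z : Cov T K × Resp T) (t : Fin T) :
    resid θ z.1 z.2 t = ∑ o, dataEntry z t o * residCoeff θ o := by
  simp [resid, Fintype.sum_option, dataEntry, residCoeff, Matrix.mulVec, dotProduct, sub_eq_add_neg]

lemma continuous_dataEntry (t : Fin T) (o : Option (Fin K)) :
    Continuous fun z : Cov T K × Resp T => dataEntry z t o := by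
  cases o <;> simp only [dataEntry] <;> fun_prop

lemma exists_abs_dataEntry_le (x : Cov T K) (t : Fin T) (o : Option (Fin K)) :
    ∃ C, 0 ≤ C ∧ ∀ y : Resp T, |dataEntry (x, y) t o| ≤ C * (1 + ‖y‖) := by
  cases o with
  | none =>
    refine ⟨1, zero_le_one, fun y => ?_⟩
    have := norm_le_pi_norm y t
    rw [Real.norm_eq_abs] at this
    simp only [dataEntry]
    linarith
  | some k =>
    refine ⟨|x t k|, abs_nonneg _, fun y => ?_⟩
    simp only [dataEntry]
    nlinarith [abs_nonneg (x t k), norm_nonneg y]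

lemma contDiff_param_apply (i : Fin K ⊕ Fin 2) : ContDiff ℝ 3 fun θ : Param K => θ i :=
  (EuclideanSpace.proj (𝕜 := ℝ) i).contDiff

lemma contDiff_residCoeff (o : Option (Fin K)) :
    ContDiff ℝ 3 fun θ : Param K => residCoeff θ o := by
  cases o with
  | none => exact contDiff_const
  | some k => exact (contDiff_param_apply (Sum.inl k)).neg

lemma contDiff_det_errCov : ContDiff ℝ 3 fun θ : Param K => (errCov T θ).det := by
  simp only [Matrix.det_apply]
  refine ContDiff.sum fun σ _ => ContDiff.const_smul _ (contDiff_prod fun i _ => ?_)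
  have : (fun θ : Param K => errCov T θ (σ i) i) = fun θ : Param K =>
      θ (Sum.inr 1) * (1 : Matrix (Fin T) (Fin T) ℝ) (σ i) i + θ (Sum.inr 0) := by
    ext θ
    simp [errCov, varEps, varAlpha]
  rw [this]
  exact ((contDiff_param_apply _).mul contDiff_const).add (contDiff_param_apply _)

lemma contDiffAt_logScale {θ : Param K} (hθ : θ ∈ admissible K) :
    ContDiffAt ℝ 3 (logScale (K := K) T) θ := by
  unfold logScale
  exact contDiffAt_const.add (contDiffAt_const.mul
    (contDiff_det_errCov.contDiffAt.log (posDef_errCov hθ).det_pos.ne'))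

/-- The log-density is a finite sum of products of smooth functions of the parameter and
polynomials of degree two in the observation. -/
lemma exists_separation (T K : ℕ) : ∃ (ι : Type) (_ : Fintype ι)
    (q : ι → Cov T K × Resp T → ℝ) (F : ι → Param K → ℝ), (∀ p, Continuous (q p)) ∧
    (∀ p x, ∃ C, 0 ≤ C ∧ ∀ y, |q p (x, y)| ≤ C * (1 + ‖y‖) ^ 2) ∧
    (∀ p, ∀ θ ∈ admissible K, ContDiffAt ℝ 3 (F p) θ) ∧
    ∀ θ ∈ admissible K, ∀ z, logDensity θ z = ∑ p, q p z * F p θ := by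
  let O := Option (Fin K) × Option (Fin K)
  let q : Option (O ⊕ O) → Cov T K × Resp T → ℝ := fun p z => match p with
    | none => 1
    | some (Sum.inl o) => ∑ t, dataEntry z t o.1 * dataEntry z t o.2
    | some (Sum.inr o) => (∑ t, dataEntry z t o.1) * ∑ t, dataEntry z t o.2
  let F : Option (O ⊕ O) → Param K → ℝ := fun p θ => match p with
    | none => logScale T θ
    | some (Sum.inl o) => -(1 / 2) * (1 / varEps θ) * (residCoeff θ o.1 * residCoeff θ o.2)
    | some (Sum.inr o) => 1 / 2 * (1 / varEps θ) * (varAlpha θ / (varEps θ + T * varAlpha θ)) *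
        (residCoeff θ o.1 * residCoeff θ o.2)
  refine ⟨Option (O ⊕ O), inferInstance, q, F, ?_, ?_, ?_, ?_⟩
  · rintro (_ | o | o)
    · exact continuous_const
    · exact continuous_finsetSum _ fun t _ =>
        (continuous_dataEntry t o.1).mul (continuous_dataEntry t o.2)
    · exact (continuous_finsetSum _ fun t _ => continuous_dataEntry t o.1).mul
        (continuous_finsetSum _ fun t _ => continuous_dataEntry t o.2)
  · intro p x
    choose C hC0 hC using fun t o => exists_abs_dataEntry_le (T := T) (K := K) x t o
    rcases p with (_ | o | o)
    · refine ⟨1, zero_le_one, fun y => ?_⟩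
      have := norm_nonneg y
      simp only [q, abs_one]
      nlinarith
    · refine ⟨∑ t, C t o.1 * C t o.2, Finset.sum_nonneg fun t _ => mul_nonneg (hC0 _ _) (hC0 _ _),
        fun y => ?_⟩
      simp only [q]
      refine (Finset.abs_sum_le_sum_abs _ _).trans ?_
      rw [Finset.sum_mul]
      refine Finset.sum_le_sum fun t _ => ?_
      rw [abs_mul]
      calc _ ≤ (C t o.1 * (1 + ‖y‖)) * (C t o.2 * (1 + ‖y‖)) := by
            have := mul_nonneg (hC0 t o.1) (show (0:ℝ) ≤ 1 + ‖y‖ by positivity)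
            exact mul_le_mul (hC _ _ _) (hC _ _ _) (abs_nonneg _) this
        _ = _ := by ring
    · have hs : ∀ o' : Option (Fin K), 0 ≤ ∑ t, C t o' := fun o' =>
        Finset.sum_nonneg fun t _ => hC0 t o'
      have hb : ∀ (o' : Option (Fin K)) (y : Resp T),
          |∑ t, dataEntry (x, y) t o'| ≤ (∑ t, C t o') * (1 + ‖y‖) := fun o' y => by
        refine (Finset.abs_sum_le_sum_abs _ _).trans ?_
        rw [Finset.sum_mul]
        exact Finset.sum_le_sum fun t _ => hC _ _ _
      refine ⟨(∑ t, C t o.1) * ∑ t, C t o.2, mul_nonneg (hs _) (hs _), fun y => ?_⟩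
      simp only [q]
      rw [abs_mul]
      calc _ ≤ ((∑ t, C t o.1) * (1 + ‖y‖)) * ((∑ t, C t o.2) * (1 + ‖y‖)) := by
            have := mul_nonneg (hs o.1) (show (0:ℝ) ≤ 1 + ‖y‖ by positivity)
            exact mul_le_mul (hb _ _) (hb _ _) (abs_nonneg _) this
        _ = _ := by ring
  · intro p θ hθ
    have h1 : ContDiffAt ℝ 3 (fun θ : Param K => 1 / varEps θ) θ :=
      contDiffAt_const.div (contDiff_param_apply _).contDiffAt hθ.2.ne'
    have h2 : ContDiffAt ℝ 3 (fun θ : Param K => varAlpha θ / (varEps θ + T * varAlpha θ)) θ :=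
      (contDiff_param_apply _).contDiffAt.div ((contDiff_param_apply _).contDiffAt.add
        (contDiffAt_const.mul (contDiff_param_apply _).contDiffAt)) (varEps_add_pos hθ).ne'
    have h3 : ∀ o : O, ContDiffAt ℝ 3 (fun θ : Param K => residCoeff θ o.1 * residCoeff θ o.2) θ :=
      fun o => ((contDiff_residCoeff _).mul (contDiff_residCoeff _)).contDiffAt
    rcases p with (_ | o | o)
    · exact contDiffAt_logScale hθ
    · exact (contDiffAt_const.mul h1).mul (h3 o)
    · exact ((contDiffAt_const.mul h1).mul h2).mul (h3 o)
  · intro θ hθ z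
    rw [logDensity, log_modelDensity hθ, quadForm_eq hθ]
    have h1 : ∑ t, resid θ z.1 z.2 t ^ 2 = ∑ o : O, (∑ t, dataEntry z t o.1 * dataEntry z t o.2) *
        (residCoeff θ o.1 * residCoeff θ o.2) := by
      have h0 : ∀ t, resid θ z.1 z.2 t ^ 2 = ∑ o : O, (dataEntry z t o.1 * residCoeff θ o.1) *
          (dataEntry z t o.2 * residCoeff θ o.2) := fun t => by
        rw [resid_eq_sum, sq, Finset.sum_mul_sum, Fintype.sum_prod_type]
      simp_rw [h0]
      rw [Finset.sum_comm]
      refine Finset.sum_congr rfl fun o _ => ?_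
      rw [Finset.sum_mul]
      exact Finset.sum_congr rfl fun t _ => by ring
    have h2 : (∑ t, resid θ z.1 z.2 t) ^ 2 = ∑ o : O, ((∑ t, dataEntry z t o.1) *
        ∑ t, dataEntry z t o.2) * (residCoeff θ o.1 * residCoeff θ o.2) := by
      simp_rw [resid_eq_sum]
      rw [Finset.sum_comm, sq, Finset.sum_mul_sum, Fintype.sum_prod_type]
      refine Finset.sum_congr rfl fun o _ => Finset.sum_congr rfl fun o' _ => ?_
      rw [← Finset.sum_mul, ← Finset.sum_mul]
      ring
    rw [Fintype.sum_option, Fintype.sum_sum_type, h1, h2]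
    have e1 : ∑ o : O, q (some (Sum.inl o)) z * F (some (Sum.inl o)) θ =
        -(1 / 2) * (1 / varEps θ) * ∑ o : O, (∑ t, dataEntry z t o.1 * dataEntry z t o.2) *
          (residCoeff θ o.1 * residCoeff θ o.2) := by
      rw [Finset.mul_sum]
      exact Finset.sum_congr rfl fun o _ => by simp only [q, F]; ring
    have e2 : ∑ o : O, q (some (Sum.inr o)) z * F (some (Sum.inr o)) θ =
        1 / 2 * (1 / varEps θ) * (varAlpha θ / (varEps θ + T * varAlpha θ)) *
          ∑ o : O, ((∑ t, dataEntry z t o.1) * ∑ t, dataEntry z t o.2) *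
          (residCoeff θ o.1 * residCoeff θ o.2) := by
      rw [Finset.mul_sum]
      exact Finset.sum_congr rfl fun o _ => by simp only [q, F]; ring
    rw [e1, e2]
    simp only [q, F]
    ring

end Separation

/-! ### Derivatives of powers of the model density -/

section PowerDerivatives

set_option maxSynthPendingDepth 3

variable {T K : ℕ} {U : Set (Param K)}

lemma exists_deriv_separation (T : ℕ) (hU : IsOpen U) (hUa : U ⊆ admissible K) :
    ∃ (ι : Type) (_ : Fintype ι) (q : ι → Cov T K × Resp T → ℝ)
    (F' : ι → Param K → Param K →L[ℝ] ℝ) (F'' : ι → Param K → Param K →L[ℝ] Param K →L[ℝ] ℝ),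
    (∀ p, Continuous (q p)) ∧
    (∀ p x, ∃ C, 0 ≤ C ∧ ∀ y, |q p (x, y)| ≤ C * (1 + ‖y‖) ^ 2) ∧
    (∀ p, ContinuousOn (F' p) U) ∧ (∀ p, ContinuousOn (F'' p) U) ∧
    ∀ z, ContDiffOn ℝ 3 (fun θ => logDensity θ z) U ∧
    ∀ θ ∈ U, fderiv ℝ (fun θ => logDensity θ z) θ = ∑ p, q p z • F' p θ ∧
      fderiv ℝ (fderiv ℝ fun θ => logDensity θ z) θ = ∑ p, q p z • F'' p θ := by
  obtain ⟨ι, hι, q, F, hq, hqb, hF, hsum⟩ := exists_separation T K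
  have hFU : ∀ p, ContDiffOn ℝ 3 (F p) U := fun p θ hθ => (hF p θ (hUa hθ)).contDiffWithinAt
  have hF1 : ∀ p, ContDiffOn ℝ 2 (fderiv ℝ (F p)) U := fun p =>
    (hFU p).fderiv_of_isOpen hU (by norm_num)
  have hF2 : ∀ p, ContDiffOn ℝ 1 (fderiv ℝ (fderiv ℝ (F p))) U := fun p =>
    (hF1 p).fderiv_of_isOpen hU (by norm_num)
  refine ⟨ι, hι, q, fun p => fderiv ℝ (F p), fun p => fderiv ℝ (fderiv ℝ (F p)), hq, hqb,
    fun p => (hF1 p).continuousOn, fun p => (hF2 p).continuousOn, fun z => ⟨?_, ?_⟩⟩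
  · have : ContDiffOn ℝ 3 (fun θ => ∑ p, q p z * F p θ) U :=
      ContDiffOn.sum fun p _ => contDiffOn_const.mul (hFU p)
    exact this.congr fun θ hθ => hsum θ (hUa hθ) z
  · have h1 : ∀ θ ∈ U, fderiv ℝ (fun θ => logDensity θ z) θ = ∑ p, q p z • fderiv ℝ (F p) θ := by
      intro θ hθ
      have he : (fun θ => logDensity θ z) =ᶠ[𝓝 θ] fun θ => ∑ p, q p z * F p θ := by
        filter_upwards [hU.mem_nhds hθ] with η hη using hsum η (hUa hη) z
      rw [he.fderiv_eq]
      have hd : ∀ p, HasFDerivAt (fun θ => q p z * F p θ) (q p z • fderiv ℝ (F p) θ) θ := fun p =>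
        (((hFU p).contDiffAt (hU.mem_nhds hθ)).differentiableAt
          (by norm_num)).hasFDerivAt.const_mul _
      exact (HasFDerivAt.fun_sum fun p _ => hd p).fderiv
    intro θ hθ
    refine ⟨h1 θ hθ, ?_⟩
    have he : (fderiv ℝ fun θ => logDensity θ z) =ᶠ[𝓝 θ]
        fun θ => ∑ p, q p z • fderiv ℝ (F p) θ := by
      filter_upwards [hU.mem_nhds hθ] with η hη using h1 η hη
    rw [he.fderiv_eq]
    have hd : ∀ p, HasFDerivAt (fun θ => q p z • fderiv ℝ (F p) θ)
        (q p z • fderiv ℝ (fderiv ℝ (F p)) θ) θ := fun p =>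
      (((hF1 p).contDiffAt (hU.mem_nhds hθ)).differentiableAt
        (by norm_num)).hasFDerivAt.fun_const_smul _
    exact (HasFDerivAt.fun_sum fun p _ => hd p).fderiv

lemma contDiffOn_logDensity (hU : IsOpen U) (hUa : U ⊆ admissible K) (z : Cov T K × Resp T) :
    ContDiffOn ℝ 3 (fun θ => logDensity θ z) U := by
  obtain ⟨ι, hι, q, F', F'', -, -, -, -, h⟩ := exists_deriv_separation T hU hUa
  exact (h z).1

lemma continuous_fderiv_logDensity (hU : IsOpen U) (hUa : U ⊆ admissible K) {θ : Param K}
    (hθ : θ ∈ U) :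
    Continuous (fun z : Cov T K × Resp T => fderiv ℝ (fun θ => logDensity θ z) θ) ∧
    Continuous (fun z : Cov T K × Resp T => fderiv ℝ (fderiv ℝ fun θ => logDensity θ z) θ) := by
  obtain ⟨ι, hι, q, F', F'', hq, -, -, -, h⟩ := exists_deriv_separation T hU hUa
  constructor
  · simp_rw [fun z => ((h z).2 θ hθ).1]
    exact continuous_finsetSum _ fun p _ => (hq p).smul continuous_const
  · simp_rw [fun z => ((h z).2 θ hθ).2]
    exact continuous_finsetSum _ fun p _ => (hq p).smul continuous_const

/-- Locally uniformly in the parameter, the first two derivatives of the log-density grow at most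
quadratically in the response. -/
lemma exists_bound_fderiv_logDensity (hU : IsOpen U) (hUa : U ⊆ admissible K) (x : Cov T K)
    {s : Set (Param K)} (hs : IsCompact s) (hsU : s ⊆ U) :
    ∃ C, 0 ≤ C ∧ ∀ θ ∈ s, ∀ y : Resp T,
      ‖fderiv ℝ (fun θ => logDensity θ (x, y)) θ‖ ≤ C * (1 + ‖y‖) ^ 2 ∧
      ‖fderiv ℝ (fderiv ℝ fun θ => logDensity θ (x, y)) θ‖ ≤ C * (1 + ‖y‖) ^ 2 := by
  obtain ⟨ι, hι, q, F', F'', -, hqb, hF', hF'', h⟩ := exists_deriv_separation T hU hUa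
  choose C hC0 hC using fun p => hqb p x
  choose a ha using fun p => hs.exists_bound_of_continuousOn ((hF' p).mono hsU)
  have hbd : ∀ p, ∃ b, ∀ θ ∈ s, ‖F'' p θ‖ ≤ b := fun p =>
    hs.exists_bound_of_continuousOn (E := Param K →L[ℝ] Param K →L[ℝ] ℝ) ((hF'' p).mono hsU)
  choose b hb using hbd
  have hnn : ∀ p, 0 ≤ C p * (|a p| + |b p|) := fun p => mul_nonneg (hC0 p) (by positivity)
  refine ⟨∑ p, C p * (|a p| + |b p|), Finset.sum_nonneg fun p _ => hnn p, fun θ hθ y => ?_⟩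
  rw [((h (x, y)).2 θ (hsU hθ)).1, ((h (x, y)).2 θ (hsU hθ)).2, Finset.sum_mul]
  constructor
  · refine (norm_sum_le _ _).trans (Finset.sum_le_sum fun p _ => ?_)
    rw [norm_smul, Real.norm_eq_abs]
    calc _ ≤ C p * (1 + ‖y‖) ^ 2 * (|a p| + |b p|) := by
          have h1 := hC0 p
          gcongr
          · exact hC p y
          · exact (ha p θ hθ).trans ((le_abs_self _).trans (by linarith [abs_nonneg (b p)]))
      _ = _ := by ring
  · refine (norm_sum_le Finset.univ fun p => q p (x, y) • F'' p θ).trans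
      (Finset.sum_le_sum fun p _ => ?_)
    rw [norm_smul (q p (x, y)) (F'' p θ), Real.norm_eq_abs]
    calc _ ≤ C p * (1 + ‖y‖) ^ 2 * (|a p| + |b p|) := by
          have h1 := hC0 p
          gcongr
          · exact hC p y
          · exact (hb p θ hθ).trans ((le_abs_self _).trans (by linarith [abs_nonneg (a p)]))
      _ = _ := by ring

/-- A power of the model density at an observation, as a function of the parameter. -/
noncomputable def densPow (s : ℝ) (θ : Param K) (z : Cov T K × Resp T) : ℝ :=
  modelDensity θ z.1 z.2 ^ s

lemma densPow_eq_exp {θ : Param K} (hθ : θ ∈ admissible K) (s : ℝ) (z : Cov T K × Resp T) :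
    densPow s θ z = Real.exp (s * logDensity θ z) := by
  rw [densPow, Real.rpow_def_of_pos (modelDensity_pos hθ _ _), logDensity, mul_comm]

lemma densPow_pos {θ : Param K} (hθ : θ ∈ admissible K) (s : ℝ) (z : Cov T K × Resp T) :
    0 < densPow s θ z := Real.rpow_pos_of_pos (modelDensity_pos hθ _ _) _

lemma continuous_densPow {θ : Param K} (hθ : θ ∈ admissible K) (s : ℝ) :
    Continuous fun z : Cov T K × Resp T => densPow s θ z := by
  have h : Continuous fun z : Cov T K × Resp T => quadForm θ z.1 z.2 := by
    simp_rw [quadForm_eq hθ, resid_eq_sum]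
    have := fun (t : Fin T) (o : Option (Fin K)) => continuous_dataEntry t o
    fun_prop
  simp_rw [densPow, modelDensity_rpow hθ]
  fun_prop

variable (hU : IsOpen U) (hUa : U ⊆ admissible K)
include hU hUa

lemma contDiffOn_densPow (s : ℝ) (z : Cov T K × Resp T) :
    ContDiffOn ℝ 3 (fun θ => densPow s θ z) U := by
  have h : ContDiffOn ℝ 3 (fun θ => Real.exp (s * logDensity θ z)) U :=
    (contDiffOn_const.mul (contDiffOn_logDensity hU hUa z)).exp
  exact h.congr fun θ hθ => densPow_eq_exp (hUa hθ) s z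

lemma fderiv_densPow (s : ℝ) (z : Cov T K × Resp T) {θ : Param K} (hθ : θ ∈ U) :
    fderiv ℝ (fun θ => densPow s θ z) θ =
      (s * densPow s θ z) • fderiv ℝ (fun θ => logDensity θ z) θ := by
  have he : (fun θ => densPow s θ z) =ᶠ[𝓝 θ] fun θ => Real.exp (s * logDensity θ z) := by
    filter_upwards [hU.mem_nhds hθ] with η hη using densPow_eq_exp (hUa hη) s z
  have hd : HasFDerivAt (fun θ => logDensity θ z) (fderiv ℝ (fun θ => logDensity θ z) θ) θ :=
    (((contDiffOn_logDensity hU hUa z).contDiffAt (hU.mem_nhds hθ)).differentiableAt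
      (by norm_num)).hasFDerivAt
  rw [he.fderiv_eq, (hd.const_mul s).exp.fderiv, densPow_eq_exp (hUa hθ), smul_smul, mul_comm]

lemma fderiv_fderiv_densPow (s : ℝ) (z : Cov T K × Resp T) {θ : Param K} (hθ : θ ∈ U) :
    fderiv ℝ (fderiv ℝ fun θ => densPow s θ z) θ =
      (s * densPow s θ z) • fderiv ℝ (fderiv ℝ fun θ => logDensity θ z) θ +
      ((s ^ 2 * densPow s θ z) • fderiv ℝ (fun θ => logDensity θ z) θ).smulRight
        (fderiv ℝ (fun θ => logDensity θ z) θ) := by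
  have he : (fderiv ℝ fun θ => densPow s θ z) =ᶠ[𝓝 θ]
      fun θ => (s * densPow s θ z) • fderiv ℝ (fun θ => logDensity θ z) θ := by
    filter_upwards [hU.mem_nhds hθ] with η hη using fderiv_densPow hU hUa s z hη
  have h1 : HasFDerivAt (fderiv ℝ fun θ => logDensity θ z)
      (fderiv ℝ (fderiv ℝ fun θ => logDensity θ z) θ) θ :=
    ((((contDiffOn_logDensity hU hUa z).fderiv_of_isOpen hU (m := 2) (by norm_num)).contDiffAt
      (hU.mem_nhds hθ)).differentiableAt (by norm_num)).hasFDerivAt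
  have h2 : HasFDerivAt (fun θ => densPow s θ z) (fderiv ℝ (fun θ => densPow s θ z) θ) θ :=
    (((contDiffOn_densPow hU hUa s z).contDiffAt (hU.mem_nhds hθ)).differentiableAt
      (by norm_num)).hasFDerivAt
  rw [he.fderiv_eq, ((h2.const_mul s).fun_smul h1).fderiv, fderiv_densPow hU hUa s z hθ, smul_smul]
  ring_nf

lemma continuous_fderiv_densPow (s : ℝ) {θ : Param K} (hθ : θ ∈ U) :
    Continuous (fun z : Cov T K × Resp T => fderiv ℝ (fun θ => densPow s θ z) θ) := by
  simp_rw [fun z => fderiv_densPow (T := T) hU hUa s z hθ]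
  exact (continuous_const.mul (continuous_densPow (hUa hθ) s)).smul
    (continuous_fderiv_logDensity hU hUa hθ).1

lemma continuous_fderiv_fderiv_densPow (s : ℝ) {θ : Param K} (hθ : θ ∈ U) :
    Continuous (fun z : Cov T K × Resp T => fderiv ℝ (fderiv ℝ fun θ => densPow s θ z) θ) := by
  simp_rw [fun z => fderiv_fderiv_densPow (T := T) hU hUa s z hθ]
  have h0 := continuous_densPow (T := T) (hUa hθ) s
  have h1 := (continuous_fderiv_logDensity (T := T) hU hUa hθ).1
  have h2 := (continuous_fderiv_logDensity (T := T) hU hUa hθ).2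
  refine ((continuous_const.mul h0).smul h2).add ?_
  exact ((ContinuousLinearMap.smulRightL ℝ (Param K) (Param K →L[ℝ] ℝ)).continuous₂).comp
    (((continuous_const.mul h0).smul h1).prodMk h1)

end PowerDerivatives

/-! ### Gaussian domination and differentiation under the integral sign -/

section Domination

set_option maxSynthPendingDepth 3

variable {T K : ℕ} {U : Set (Param K)}

lemma sq_norm_le_sum_sq (y : Resp T) : ‖y‖ ^ 2 ≤ ∑ t, y t ^ 2 := by
  have h0 : 0 ≤ ∑ t, y t ^ 2 := Finset.sum_nonneg fun _ _ => sq_nonneg _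
  have h : ‖y‖ ≤ √(∑ t, y t ^ 2) := by
    refine (pi_norm_le_iff_of_nonneg (Real.sqrt_nonneg _)).2 fun t => ?_
    refine Real.le_sqrt_of_sq_le ?_
    rw [Real.norm_eq_abs, sq_abs]
    exact Finset.single_le_sum (f := fun t => y t ^ 2) (fun _ _ => sq_nonneg _) (Finset.mem_univ t)
  calc ‖y‖ ^ 2 ≤ √(∑ t, y t ^ 2) ^ 2 := by gcongr
    _ = _ := Real.sq_sqrt h0

lemma exists_pow_mul_exp_neg_sq_le (n : ℕ) {c : ℝ} (hc : 0 < c) :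
    ∃ C, 0 ≤ C ∧ ∀ t : ℝ, 0 ≤ t → (1 + t) ^ n * Real.exp (-(c * t ^ 2)) ≤ C := by
  refine ⟨n.factorial * Real.exp (1 + 1 / (4 * c)), by positivity, fun t ht => ?_⟩
  have h1 : (1 + t) ^ n ≤ n.factorial * Real.exp (1 + t) := by
    have := Real.pow_div_factorial_le_exp (1 + t) (by linarith) n
    rwa [div_le_iff₀ (by positivity), mul_comm] at this
  calc _ ≤ n.factorial * Real.exp (1 + t) * Real.exp (-(c * t ^ 2)) := by gcongr
    _ = n.factorial * Real.exp (1 + t - c * t ^ 2) := by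
        rw [mul_assoc, ← Real.exp_add]; ring_nf
    _ ≤ _ := by
        gcongr
        have h2 : c * (t - 1 / (2 * c)) ^ 2 = c * t ^ 2 - t + 1 / (4 * c) := by field_simp; ring
        have h3 : 0 ≤ c * (t - 1 / (2 * c)) ^ 2 := by positivity
        linarith

/-- Positive powers of the model density have Gaussian tails, locally uniformly in the parameter. -/
lemma exists_densPow_le {s : ℝ} (hs : 0 < s) (x : Cov T K) {A : Set (Param K)} (hA : IsCompact A)
    (hAa : A ⊆ admissible K) :
    ∃ C c : ℝ, 0 ≤ C ∧ 0 < c ∧ ∀ θ ∈ A, ∀ y : Resp T,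
      densPow s θ (x, y) ≤ C * Real.exp (-(c * ‖y‖ ^ 2)) := by
  have hcont : ∀ i, Continuous fun θ : Param K => θ i := fun i =>
    (contDiff_param_apply i).continuous
  have hc1 : ContinuousOn (fun θ : Param K => varEps θ + T * varAlpha θ) A :=
    ((hcont _).add (continuous_const.mul (hcont _))).continuousOn
  have hc2 : ContinuousOn (fun θ : Param K => logScale (K := K) T θ) A := fun θ hθ =>
    (contDiffAt_logScale (hAa hθ)).continuousAt.continuousWithinAt
  have hc3 : ContinuousOn (fun θ : Param K => Matrix.mulVec (Matrix.of x) (beta θ)) A := by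
    refine Continuous.continuousOn ?_
    unfold Matrix.mulVec dotProduct beta
    fun_prop
  obtain ⟨a, ha⟩ := hA.exists_bound_of_continuousOn hc1
  obtain ⟨b, hb⟩ := hA.exists_bound_of_continuousOn hc2
  obtain ⟨d, hd⟩ := hA.exists_bound_of_continuousOn hc3
  -- On the compact set, `L` bounds the largest eigenvalue of the error covariance matrix, `b` the
  -- scale factor and `d` the regression term.
  set L := |a| + 1 with hL
  have hL0 : 0 < L := by positivity
  refine ⟨Real.exp (s * b + s / (2 * L) * (T * d ^ 2)), s / (4 * L), by positivity, by positivity,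
    fun θ hθ y => ?_⟩
  have hpos := varEps_add_pos (T := T) (hAa hθ)
  have e1 : varEps θ + T * varAlpha θ ≤ L := by
    have := ha θ hθ
    rw [Real.norm_eq_abs] at this
    have h1 := le_abs_self (varEps θ + T * varAlpha θ)
    have h2 := le_abs_self a
    linarith
  have e2 : logScale T θ ≤ b := (le_abs_self _).trans (hb θ hθ)
  have e3 : 1 / 2 * ‖y‖ ^ 2 - T * d ^ 2 ≤ ∑ t, resid θ x y t ^ 2 := by
    have h1 : ∀ t, 1 / 2 * y t ^ 2 - d ^ 2 ≤ resid θ x y t ^ 2 := by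
      intro t
      have h2 : |Matrix.mulVec (Matrix.of x) (beta θ) t| ≤ d :=
        (norm_le_pi_norm _ t).trans (hd θ hθ)
      have h3 : Matrix.mulVec (Matrix.of x) (beta θ) t ^ 2 ≤ d ^ 2 := sq_le_sq' (abs_le.1 h2).1
        (abs_le.1 h2).2
      simp only [resid, Pi.sub_apply]
      nlinarith [sq_nonneg (y t - 2 * Matrix.mulVec (Matrix.of x) (beta θ) t)]
    have h4 := Finset.sum_le_sum fun t (_ : t ∈ Finset.univ) => h1 t
    rw [Finset.sum_sub_distrib, ← Finset.mul_sum] at h4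
    simp only [Finset.sum_const, Finset.card_univ, Fintype.card_fin, nsmul_eq_mul] at h4
    have := sq_norm_le_sum_sq y
    linarith
  have e4 : (1 / 2 * ‖y‖ ^ 2 - T * d ^ 2) / L ≤ quadForm θ x y := by
    refine le_trans ?_ (le_quadForm (hAa hθ) x y)
    have h0 : 0 ≤ ∑ t, resid θ x y t ^ 2 := Finset.sum_nonneg fun _ _ => sq_nonneg _
    calc _ ≤ (∑ t, resid θ x y t ^ 2) / L := by gcongr
      _ ≤ _ := by gcongr
  rw [densPow_eq_exp (hAa hθ), logDensity, log_modelDensity (hAa hθ), ← Real.exp_add]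
  refine Real.exp_le_exp.2 ?_
  have e5 : s * (logScale T θ - 1 / 2 * quadForm θ x y) ≤
      s * (b - 1 / 2 * ((1 / 2 * ‖y‖ ^ 2 - T * d ^ 2) / L)) := by gcongr
  refine e5.trans (le_of_eq ?_)
  field_simp
  ring

/-- Near any parameter, a positive power of the density and its first two derivatives in the
parameter are dominated by an integrable function of the response. -/
lemma exists_dominating (hU : IsOpen U) (hUa : U ⊆ admissible K) {s : ℝ} (hs : 0 < s)
    {θ₁ : Param K} (hθ₁ : θ₁ ∈ U) (x : Cov T K) :
    ∃ ε > 0, Metric.ball θ₁ ε ⊆ U ∧ ∃ b : Resp T → ℝ, Integrable b ∧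
      ∀ θ ∈ Metric.ball θ₁ ε, ∀ y, ‖densPow s θ (x, y)‖ ≤ b y ∧
        ‖fderiv ℝ (fun θ => densPow s θ (x, y)) θ‖ ≤ b y ∧
        ‖fderiv ℝ (fderiv ℝ fun θ => densPow s θ (x, y)) θ‖ ≤ b y ∧
        s ^ 2 * densPow s θ (x, y) * ‖fderiv ℝ (fun θ => logDensity θ (x, y)) θ‖ ^ 2 ≤ b y := by
  obtain ⟨ε, hε, hεU⟩ := Metric.nhds_basis_closedBall.mem_iff.1 (hU.mem_nhds hθ₁)
  have hcpt := isCompact_closedBall θ₁ ε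
  obtain ⟨C₁, c, hC₁, hc, h1⟩ := exists_densPow_le hs x hcpt (hεU.trans hUa)
  obtain ⟨C₂, hC₂, h2⟩ := exists_bound_fderiv_logDensity hU hUa x hcpt hεU
  -- Four powers of `1 + ‖y‖` absorb the squared score, the other `T + 1` make the bound integrable
  -- in dimension `T`.
  obtain ⟨C₃, hC₃, h3⟩ := exists_pow_mul_exp_neg_sq_le (T + 5) hc
  set D := 1 + s * C₂ + s ^ 2 * C₂ ^ 2 with hD
  have hD0 : 0 ≤ D := by positivity
  refine ⟨ε, hε, Metric.ball_subset_closedBall.trans hεU,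
    fun y => D * C₁ * C₃ * (1 + ‖y‖) ^ (-((T : ℝ) + 1)), ?_, ?_⟩
  · refine Integrable.const_mul (integrable_one_add_norm ?_) _
    simp
  intro θ hθ y
  have hθ' := Metric.ball_subset_closedBall hθ
  have hθU := hεU hθ'
  have hp := densPow_pos (hUa hθU) s (x, y)
  have hy : 1 ≤ 1 + ‖y‖ := by have := norm_nonneg y; linarith
  have hy0 : 0 < 1 + ‖y‖ := by linarith
  have hb : densPow s θ (x, y) * (1 + ‖y‖) ^ 4 ≤ C₁ * C₃ * (1 + ‖y‖) ^ (-((T : ℝ) + 1)) := by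
    rw [Real.rpow_neg hy0.le, ← div_eq_mul_inv, le_div_iff₀ (by positivity)]
    have e1 : (1 + ‖y‖) ^ ((T : ℝ) + 1) = (1 + ‖y‖) ^ (T + 1) := by
      rw [← Real.rpow_natCast]; push_cast; rfl
    rw [e1]
    calc _ ≤ C₁ * Real.exp (-(c * ‖y‖ ^ 2)) * (1 + ‖y‖) ^ 4 * (1 + ‖y‖) ^ (T + 1) := by
          gcongr; exact h1 θ hθ' y
      _ = C₁ * ((1 + ‖y‖) ^ (T + 5) * Real.exp (-(c * ‖y‖ ^ 2))) := by ring
      _ ≤ C₁ * C₃ := by gcongr; exact h3 _ (norm_nonneg y)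
  have key : ∀ v : ℝ, v ≤ D * (1 + ‖y‖) ^ 4 * densPow s θ (x, y) →
      v ≤ D * C₁ * C₃ * (1 + ‖y‖) ^ (-((T : ℝ) + 1)) := by
    intro v hv
    calc v ≤ D * (densPow s θ (x, y) * (1 + ‖y‖) ^ 4) := by linarith
      _ ≤ D * (C₁ * C₃ * (1 + ‖y‖) ^ (-((T : ℝ) + 1))) := by gcongr
      _ = _ := by ring
  have hy2 : (1 + ‖y‖) ^ 2 ≤ (1 + ‖y‖) ^ 4 := pow_le_pow_right₀ hy (by norm_num)
  have hy4 : 1 ≤ (1 + ‖y‖) ^ 4 := one_le_pow₀ hy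
  obtain ⟨g1, g2⟩ := h2 θ hθ' y
  have f1 : ‖(s * densPow s θ (x, y)) • fderiv ℝ (fun θ => logDensity θ (x, y)) θ‖ ≤
      s * C₂ * (1 + ‖y‖) ^ 4 * densPow s θ (x, y) := by
    rw [norm_smul, Real.norm_of_nonneg (by positivity)]
    calc _ ≤ s * densPow s θ (x, y) * (C₂ * (1 + ‖y‖) ^ 4) := by
          gcongr
          exact g1.trans (by gcongr)
      _ = _ := by ring
  have f2 : ‖(s * densPow s θ (x, y)) • fderiv ℝ (fderiv ℝ fun θ => logDensity θ (x, y)) θ‖ ≤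
      s * C₂ * (1 + ‖y‖) ^ 4 * densPow s θ (x, y) := by
    rw [norm_smul, Real.norm_of_nonneg (by positivity)]
    calc _ ≤ s * densPow s θ (x, y) * (C₂ * (1 + ‖y‖) ^ 4) := by
          gcongr
          exact g2.trans (by gcongr)
      _ = _ := by ring
  have f3 : ‖((s ^ 2 * densPow s θ (x, y)) • fderiv ℝ (fun θ => logDensity θ (x, y)) θ).smulRight
      (fderiv ℝ (fun θ => logDensity θ (x, y)) θ)‖ ≤
      s ^ 2 * C₂ ^ 2 * (1 + ‖y‖) ^ 4 * densPow s θ (x, y) := by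
    rw [ContinuousLinearMap.norm_smulRight_apply, norm_smul, Real.norm_of_nonneg (by positivity)]
    calc _ ≤ s ^ 2 * densPow s θ (x, y) * (C₂ * (1 + ‖y‖) ^ 2) * (C₂ * (1 + ‖y‖) ^ 2) := by gcongr
      _ = _ := by ring
  have hn1 : 0 ≤ s * C₂ * ((1 + ‖y‖) ^ 4 * densPow s θ (x, y)) := by positivity
  have hn2 : 0 ≤ s ^ 2 * C₂ ^ 2 * ((1 + ‖y‖) ^ 4 * densPow s θ (x, y)) := by positivity
  have hn3 : densPow s θ (x, y) ≤ (1 + ‖y‖) ^ 4 * densPow s θ (x, y) := by nlinarith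
  have hDe : D * (1 + ‖y‖) ^ 4 * densPow s θ (x, y) = (1 + ‖y‖) ^ 4 * densPow s θ (x, y) +
      s * C₂ * ((1 + ‖y‖) ^ 4 * densPow s θ (x, y)) +
      s ^ 2 * C₂ ^ 2 * ((1 + ‖y‖) ^ 4 * densPow s θ (x, y)) := by rw [hD]; ring
  refine ⟨key _ ?_, key _ ?_, key _ ?_, key _ ?_⟩
  · rw [Real.norm_of_nonneg hp.le]
    linarith
  · rw [fderiv_densPow hU hUa s _ hθU]
    linarith
  · rw [fderiv_fderiv_densPow hU hUa s _ hθU]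
    refine (norm_add_le _ _).trans ?_
    linarith
  · rw [ContinuousLinearMap.norm_smulRight_apply, norm_smul,
      Real.norm_of_nonneg (by positivity)] at f3
    rw [sq ‖_‖, ← mul_assoc]
    linarith

/-- The first two derivatives of `θ ↦ ∫ f_θ ^ s dy` may be computed under the integral sign. -/
theorem hasFDerivAt_integral_densPow (hU : IsOpen U) (hUa : U ⊆ admissible K) {s : ℝ} (hs : 0 < s)
    {θ₁ : Param K} (hθ₁ : θ₁ ∈ U) (x : Cov T K) :
    Integrable (fun y => densPow s θ₁ (x, y)) ∧
    Integrable (fun y => fderiv ℝ (fun θ => densPow s θ (x, y)) θ₁) ∧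
    Integrable (fun y => fderiv ℝ (fderiv ℝ fun θ => densPow s θ (x, y)) θ₁) ∧
    HasFDerivAt (fun θ => ∫ y, densPow s θ (x, y))
      (∫ y, fderiv ℝ (fun θ => densPow s θ (x, y)) θ₁) θ₁ ∧
    HasFDerivAt (fun θ => ∫ y, fderiv ℝ (fun θ => densPow s θ (x, y)) θ)
      (∫ y, fderiv ℝ (fderiv ℝ fun θ => densPow s θ (x, y)) θ₁) θ₁ := by
  obtain ⟨ε, hε, hεU, b, hb, hle⟩ := exists_dominating hU hUa hs hθ₁ x
  have hmk : Continuous fun y : Resp T => (x, y) := by fun_prop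
  have hself := Metric.mem_ball_self hε (x := θ₁)
  have m0 : ∀ θ ∈ U, AEStronglyMeasurable (fun y => densPow s θ (x, y)) volume := fun θ hθ =>
    ((continuous_densPow (hUa hθ) s).comp hmk).aestronglyMeasurable
  have m1 : ∀ θ ∈ U, AEStronglyMeasurable
      (fun y => fderiv ℝ (fun θ => densPow s θ (x, y)) θ) volume := fun θ hθ =>
    ((continuous_fderiv_densPow hU hUa s hθ).comp hmk).aestronglyMeasurable
  have m2 : ∀ θ ∈ U, AEStronglyMeasurable
      (fun y => fderiv ℝ (fderiv ℝ fun θ => densPow s θ (x, y)) θ) volume := fun θ hθ =>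
    ((continuous_fderiv_fderiv_densPow hU hUa s hθ).comp hmk).aestronglyMeasurable
  have i0 : Integrable (fun y => densPow s θ₁ (x, y)) :=
    hb.mono' (m0 _ hθ₁) (ae_of_all _ fun y => (hle _ hself y).1)
  have i1 : Integrable (fun y => fderiv ℝ (fun θ => densPow s θ (x, y)) θ₁) :=
    hb.mono' (m1 _ hθ₁) (ae_of_all _ fun y => (hle _ hself y).2.1)
  have i2 : Integrable (fun y => fderiv ℝ (fderiv ℝ fun θ => densPow s θ (x, y)) θ₁) :=
    hb.mono' (m2 _ hθ₁) (ae_of_all _ fun y => (hle _ hself y).2.2.1)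
  have hev : ∀ᶠ θ in 𝓝 θ₁, θ ∈ U := hU.mem_nhds hθ₁
  refine ⟨i0, i1, i2, ?_, ?_⟩
  · refine hasFDerivAt_integral_of_dominated_of_fderiv_le (Metric.ball_mem_nhds θ₁ hε)
      (hev.mono m0) i0 (m1 _ hθ₁) (ae_of_all _ fun y θ hθ => (hle θ hθ y).2.1) hb
      (ae_of_all _ fun y θ hθ => ?_)
    exact (((contDiffOn_densPow hU hUa s (x, y)).contDiffAt (hU.mem_nhds (hεU hθ))).differentiableAt
      (by norm_num)).hasFDerivAt
  · refine hasFDerivAt_integral_of_dominated_of_fderiv_le (Metric.ball_mem_nhds θ₁ hε)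
      (hev.mono m1) i1 (m2 _ hθ₁) (ae_of_all _ fun y θ hθ => (hle θ hθ y).2.2.1) hb
      (ae_of_all _ fun y θ hθ => ?_)
    exact ((((contDiffOn_densPow hU hUa s (x, y)).fderiv_of_isOpen hU (m := 2)
      (by norm_num)).contDiffAt (hU.mem_nhds (hεU hθ))).differentiableAt (by norm_num)).hasFDerivAt

lemma integrable_sq_norm_fderiv_logDensity (hU : IsOpen U) (hUa : U ⊆ admissible K) {s : ℝ}
    (hs : 0 < s) {θ : Param K} (hθ : θ ∈ U) (x : Cov T K) :
    Integrable (fun y => densPow s θ (x, y) *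
      ‖fderiv ℝ (fun θ => logDensity θ (x, y)) θ‖ ^ 2) := by
  obtain ⟨ε, hε, -, b, hb, hle⟩ := exists_dominating hU hUa hs hθ x
  have hmk : Continuous fun y : Resp T => (x, y) := by fun_prop
  refine (hb.const_mul (1 / s ^ 2)).mono' (((continuous_densPow (hUa hθ) s).comp hmk).mul
    (((continuous_fderiv_logDensity hU hUa hθ).1.comp hmk).norm.pow 2)).aestronglyMeasurable
    (ae_of_all _ fun y => ?_)
  have h := (hle θ (Metric.mem_ball_self hε) y).2.2.2
  have hp := densPow_pos (hUa hθ) s (x, y)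
  rw [Real.norm_of_nonneg (by positivity), one_div, le_inv_mul_iff₀ (by positivity), ← mul_assoc]
  exact h

end Domination

/-! ### The estimating function and the matrices `J` and `K` -/

section Identities

set_option maxSynthPendingDepth 3

variable {T K : ℕ} {U : Set (Param K)}

/-- The integral of `f_θ ^ (1 + γ)` over the response. It does not depend on the covariates, so they
are set to zero. -/
noncomputable def powInt (T : ℕ) {K : ℕ} (γ : ℝ) (θ : Param K) : ℝ :=
  ∫ y : Resp T, densPow (1 + γ) θ (0, y)

lemma integral_densPow {θ : Param K} (hθ : θ ∈ admissible K) (γ : ℝ) (x : Cov T K) :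
    ∫ y, densPow (1 + γ) θ (x, y) = powInt T γ θ := by
  obtain ⟨κ, hκ⟩ := exists_integral_modelDensity_rpow T K (1 + γ)
  have h1 := hκ θ hθ x
  have h2 := hκ θ hθ 0
  rw [powInt]
  exact h1.trans h2.symm

lemma contDiffOn_powInt (hUa : U ⊆ admissible K) (γ : ℝ) :
    ContDiffOn ℝ 3 (powInt (K := K) T γ) U := by
  obtain ⟨κ, hκ⟩ := exists_integral_modelDensity_rpow T K (1 + γ)
  have h : ContDiffOn ℝ 3 (fun θ : Param K => κ * (Real.exp ((1 + γ) * logScale T θ) *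
      (errCov T θ).det ^ (1 / 2 : ℝ))) U := by
    intro θ hθ
    refine (contDiffAt_const.mul (ContDiffAt.mul ?_ ?_)).contDiffWithinAt
    · exact (contDiffAt_const.mul (contDiffAt_logScale (hUa hθ))).exp
    · exact contDiff_det_errCov.contDiffAt.rpow_const_of_ne (posDef_errCov (hUa hθ)).det_pos.ne'
  exact h.congr fun θ hθ => hκ θ (hUa hθ) 0

variable (hU : IsOpen U) (hUa : U ⊆ admissible K) {γ : ℝ} (hγ : 0 < γ)
include hU hUa hγ

lemma integral_fderiv_densPow {θ : Param K} (hθ : θ ∈ U) (x : Cov T K) :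
    ∫ y, fderiv ℝ (fun θ => densPow (1 + γ) θ (x, y)) θ = fderiv ℝ (powInt T γ) θ := by
  have h := (hasFDerivAt_integral_densPow hU hUa (show 0 < 1 + γ by linarith) hθ x).2.2.2.1
  rw [← h.fderiv]
  refine Filter.EventuallyEq.fderiv_eq ?_
  filter_upwards [hU.mem_nhds hθ] with η hη using integral_densPow (hUa hη) γ x

lemma integral_fderiv_fderiv_densPow {θ : Param K} (hθ : θ ∈ U) (x : Cov T K) :
    ∫ y, fderiv ℝ (fderiv ℝ fun θ => densPow (1 + γ) θ (x, y)) θ =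
      fderiv ℝ (fderiv ℝ (powInt T γ)) θ := by
  have h := (hasFDerivAt_integral_densPow hU hUa (show 0 < 1 + γ by linarith) hθ x).2.2.2.2
  rw [← h.fderiv]
  refine Filter.EventuallyEq.fderiv_eq ?_
  filter_upwards [hU.mem_nhds hθ] with η hη using integral_fderiv_densPow hU hUa hγ hη x

omit hU hUa hγ in
lemma score_eq (θ : Param K) (x : Cov T K) (y : Resp T) (j : Fin K ⊕ Fin 2) :
    score θ x y j = fderiv ℝ (fun θ => logDensity θ (x, y)) θ (EuclideanSpace.single j 1) := rfl

omit hγ in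
lemma infoMat_eq {θ : Param K} (hθ : θ ∈ U) (x : Cov T K) (y : Resp T) (j k : Fin K ⊕ Fin 2) :
    infoMat θ x y j k = -fderiv ℝ (fderiv ℝ fun θ => logDensity θ (x, y)) θ
      (EuclideanSpace.single k 1) (EuclideanSpace.single j 1) := by
  have hd : DifferentiableAt ℝ (fderiv ℝ fun θ => logDensity θ (x, y)) θ :=
    ((((contDiffOn_logDensity hU hUa (x, y)).fderiv_of_isOpen hU (m := 2) (by norm_num)).contDiffAt
      (hU.mem_nhds hθ)).differentiableAt (by norm_num))
  have : HasFDerivAt (fun η => score η x y j)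
      ((fderiv ℝ (fderiv ℝ fun θ => logDensity θ (x, y)) θ).flip
        (EuclideanSpace.single j 1)) θ := by
    have h := ((ContinuousLinearMap.apply ℝ ℝ
      (EuclideanSpace.single j (1 : ℝ) : Param K)).hasFDerivAt).comp θ hd.hasFDerivAt
    exact h
  rw [infoMat, pderiv, this.fderiv]
  rfl

omit hγ in
lemma score_mul_densPow (s : ℝ) {θ : Param K} (hθ : θ ∈ U) (x : Cov T K) (y : Resp T)
    (j : Fin K ⊕ Fin 2) :
    s * (score θ x y j * modelDensity θ x y ^ s) =
      fderiv ℝ (fun θ => densPow s θ (x, y)) θ (EuclideanSpace.single j 1) := by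
  rw [fderiv_densPow hU hUa s _ hθ, smul_apply, smul_eq_mul, score_eq, densPow]
  ring

omit hγ in
lemma fderiv_fderiv_densPow_single (s : ℝ) {θ : Param K} (hθ : θ ∈ U) (x : Cov T K) (y : Resp T)
    (j k : Fin K ⊕ Fin 2) :
    fderiv ℝ (fderiv ℝ fun θ => densPow s θ (x, y)) θ (EuclideanSpace.single k 1)
      (EuclideanSpace.single j 1) = s * (s * (score θ x y j * score θ x y k) - infoMat θ x y j k) *
        modelDensity θ x y ^ s := by
  rw [fderiv_fderiv_densPow hU hUa s _ hθ, add_apply, add_apply, smul_apply, smul_apply,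
    ContinuousLinearMap.smulRight_apply, smul_apply, smul_apply, infoMat_eq hU hUa hθ, score_eq,
    score_eq, smul_eq_mul, smul_eq_mul, smul_eq_mul, densPow]
  ring

lemma integral_score_mul_densPow {θ : Param K} (hθ : θ ∈ U) (x : Cov T K) (j : Fin K ⊕ Fin 2) :
    ∫ y, score θ x y j * modelDensity θ x y ^ (1 + γ) =
      1 / (1 + γ) * fderiv ℝ (powInt T γ) θ (EuclideanSpace.single j 1) := by
  have hs : 0 < 1 + γ := by linarith
  have hint := (hasFDerivAt_integral_densPow hU hUa hs hθ x).2.1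
  rw [← integral_fderiv_densPow hU hUa hγ hθ x, ContinuousLinearMap.integral_apply hint,
    ← integral_const_mul]
  refine integral_congr_ae (ae_of_all _ fun y => ?_)
  simp only
  rw [← score_mul_densPow hU hUa _ hθ]
  field_simp

/-- The contribution of one observation to the estimating equations, as a functional on the
parameter space: the differential of the empirical density power divergence is `1 + γ` times the
average of these. -/
noncomputable def estFun (γ : ℝ) (θ : Param K) (z : Cov T K × Resp T) : Param K →L[ℝ] ℝ :=
  (1 / (1 + γ)) • fderiv ℝ (powInt T γ) θ - (1 / γ) • fderiv ℝ (fun θ => densPow γ θ z) θ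

/-- The derivative of the estimating function in the parameter. -/
noncomputable def estFunDeriv (γ : ℝ) (θ : Param K) (z : Cov T K × Resp T) :
    Param K →L[ℝ] Param K →L[ℝ] ℝ :=
  (1 / (1 + γ)) • fderiv ℝ (fderiv ℝ (powInt T γ)) θ -
    (1 / γ) • fderiv ℝ (fderiv ℝ fun θ => densPow γ θ z) θ

/-- Conditional expectation of a function of an observation given the covariates `x`, for the
conditional density `g x`. -/
noncomputable def condMean {V : Type*} [NormedAddCommGroup V] [NormedSpace ℝ V]
    (g : Cov T K → Resp T → ℝ) (W : Cov T K × Resp T → V) (x : Cov T K) : V :=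
  ∫ y, g x y • W (x, y)

omit hγ in
lemma hasFDerivAt_estFun {θ : Param K} (hθ : θ ∈ U) (z : Cov T K × Resp T) :
    HasFDerivAt (fun θ => estFun γ θ z) (estFunDeriv γ θ z) θ := by
  have h1 : DifferentiableAt ℝ (fderiv ℝ (powInt (K := K) T γ)) θ :=
    ((((contDiffOn_powInt hUa γ).fderiv_of_isOpen hU (m := 2) (by norm_num)).contDiffAt
      (hU.mem_nhds hθ)).differentiableAt (by norm_num))
  have h2 : DifferentiableAt ℝ (fderiv ℝ fun θ => densPow γ θ z) θ :=
    ((((contDiffOn_densPow hU hUa γ z).fderiv_of_isOpen hU (m := 2) (by norm_num)).contDiffAt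
      (hU.mem_nhds hθ)).differentiableAt (by norm_num))
  exact (h1.hasFDerivAt.fun_const_smul _).fun_sub (h2.hasFDerivAt.fun_const_smul _)

omit hγ in
lemma continuous_estFun {θ : Param K} (hθ : θ ∈ U) :
    Continuous fun z : Cov T K × Resp T => estFun γ θ z :=
  continuous_const.sub ((continuous_fderiv_densPow hU hUa γ hθ).const_smul (1 / γ))

omit hγ in
lemma continuous_estFunDeriv {θ : Param K} (hθ : θ ∈ U) :
    Continuous fun z : Cov T K × Resp T => estFunDeriv γ θ z :=
  continuous_const.sub ((continuous_fderiv_fderiv_densPow hU hUa γ hθ).const_smul (1 / γ))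

/-- The matrix `J⁽ⁱ⁾` is the conditional expectation of the derivative of the estimating
function. -/
lemma Jmat_eq {g : Cov T K → Resp T → ℝ} {θ : Param K} (hθ : θ ∈ U) {x : Cov T K}
    (hg1 : ∫ y, g x y = 1)
    (hint : Integrable fun y => g x y • fderiv ℝ (fderiv ℝ fun θ => densPow γ θ (x, y)) θ)
    (j k : Fin K ⊕ Fin 2) :
    Jmat γ g θ x j k = condMean g (estFunDeriv γ θ) x (EuclideanSpace.single k 1)
      (EuclideanSpace.single j 1) := by
  have hs : 0 < 1 + γ := by linarith
  have hgi : Integrable (g x) := integrable_of_integral_eq_one hg1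
  set ej : Param K := EuclideanSpace.single j 1
  set ek : Param K := EuclideanSpace.single k 1
  have hev : ∀ {W : Resp T → Param K →L[ℝ] Param K →L[ℝ] ℝ}, Integrable W →
      Integrable (fun y => W y ek ej) ∧ (∫ y, W y) ek ej = ∫ y, W y ek ej := by
    intro W hW
    have h1 : Integrable fun y => W y ek := hW.apply_continuousLinearMap ek
    exact ⟨h1.apply_continuousLinearMap ej, by
      rw [ContinuousLinearMap.integral_apply hW, ContinuousLinearMap.integral_apply h1]⟩
  have hR : condMean g (estFunDeriv γ θ) x ek ej =
      1 / (1 + γ) * fderiv ℝ (fderiv ℝ (powInt T γ)) θ ek ej -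
      1 / γ * ∫ y, g x y * fderiv ℝ (fderiv ℝ fun θ => densPow γ θ (x, y)) θ ek ej := by
    have h1 : condMean g (estFunDeriv γ θ) x =
        (1 / (1 + γ)) • fderiv ℝ (fderiv ℝ (powInt T γ)) θ -
        (1 / γ) • ∫ y, g x y • fderiv ℝ (fderiv ℝ fun θ => densPow γ θ (x, y)) θ := by
      have h2 : ∀ y, g x y • estFunDeriv γ θ (x, y) =
          g x y • ((1 / (1 + γ)) • fderiv ℝ (fderiv ℝ (powInt T γ)) θ) -
          (1 / γ) • g x y • fderiv ℝ (fderiv ℝ fun θ => densPow γ θ (x, y)) θ := fun y => by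
        rw [estFunDeriv, smul_sub, smul_comm (1 / γ)]
      rw [condMean]
      simp_rw [h2]
      have hs : Integrable fun y => (1 / γ) •
          g x y • fderiv ℝ (fderiv ℝ fun θ => densPow γ θ (x, y)) θ := hint.smul (1 / γ)
      rw [integral_sub (hgi.smul_const _) hs, integral_smul_const, hg1, one_smul, integral_smul]
    rw [h1, sub_apply, sub_apply, smul_apply, smul_apply, smul_apply, smul_apply, (hev hint).2]
    rfl
  have i1 := (hasFDerivAt_integral_densPow hU hUa hs hθ x).2.2.1
  have i2 : Integrable fun y => score θ x y j * score θ x y k * modelDensity θ x y ^ (1 + γ) := by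
    have hb := integrable_sq_norm_fderiv_logDensity hU hUa hs hθ x
    have hmk : Continuous fun y : Resp T => (x, y) := by fun_prop
    have hc := (continuous_fderiv_logDensity (T := T) hU hUa hθ).1.comp hmk
    have hc' := (continuous_densPow (T := T) (hUa hθ) (1 + γ)).comp hmk
    have hc1 : Continuous fun y => fderiv ℝ (fun θ => logDensity θ (x, y)) θ ej := hc.clm_apply
      continuous_const
    have hc2 : Continuous fun y => fderiv ℝ (fun θ => logDensity θ (x, y)) θ ek := hc.clm_apply
      continuous_const
    refine hb.mono' ((hc1.mul hc2).mul hc').aestronglyMeasurable (ae_of_all _ fun y => ?_)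
    have hp := densPow_pos (hUa hθ) (1 + γ) (x, y)
    rw [score_eq, score_eq, norm_mul, norm_mul]
    change _ * _ * ‖densPow (1 + γ) θ (x, y)‖ ≤ _
    rw [Real.norm_of_nonneg hp.le, mul_comm, sq]
    have hn : ∀ (A : Param K →L[ℝ] ℝ) (i : Fin K ⊕ Fin 2),
        ‖A (EuclideanSpace.single i 1)‖ ≤ ‖A‖ := fun A i => by
      simpa using A.le_opNorm (EuclideanSpace.single i 1)
    gcongr
    · exact hn _ _
    · exact hn _ _
  have i3 : Integrable fun y => g x y * fderiv ℝ (fderiv ℝ fun θ => densPow γ θ (x, y)) θ ek ej :=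
    (hev hint).1
  have i4 := (hev i1).1
  have hm := (hev i1).2
  rw [integral_fderiv_fderiv_densPow hU hUa hγ hθ x] at hm
  rw [hR, hm, Jmat, Matrix.of_apply]
  -- The model density times its own power `γ` is the power `1 + γ`, so the second integral in
  -- `Jmat` splits into second derivatives of the two powers and a term that cancels the first one.
  have hpt : ∀ y, (infoMat θ x y j k - γ * (score θ x y j * score θ x y k)) *
      (g x y - modelDensity θ x y) * modelDensity θ x y ^ γ =
      1 / (1 + γ) * fderiv ℝ (fderiv ℝ fun θ => densPow (1 + γ) θ (x, y)) θ ek ej -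
      1 / γ * (g x y * fderiv ℝ (fderiv ℝ fun θ => densPow γ θ (x, y)) θ ek ej) -
      score θ x y j * score θ x y k * modelDensity θ x y ^ (1 + γ) := by
    intro y
    rw [fderiv_fderiv_densPow_single hU hUa _ hθ, fderiv_fderiv_densPow_single hU hUa _ hθ,
      Real.rpow_add (modelDensity_pos (hUa hθ) x y), Real.rpow_one]
    field_simp
    ring
  simp_rw [hpt]
  have i5 : Integrable fun y =>
      1 / (1 + γ) * fderiv ℝ (fderiv ℝ fun θ => densPow (1 + γ) θ (x, y)) θ ek ej -
      1 / γ * (g x y * fderiv ℝ (fderiv ℝ fun θ => densPow γ θ (x, y)) θ ek ej) :=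
    (i4.const_mul _).sub (i3.const_mul _)
  rw [integral_sub i5 i2, integral_sub (i4.const_mul _)
    (i3.const_mul _), integral_const_mul, integral_const_mul]
  ring

lemma xiVec_eq {g : Cov T K → Resp T → ℝ} {θ : Param K} (hθ : θ ∈ U) {x : Cov T K}
    (hint : Integrable fun y => g x y • fderiv ℝ (fun θ => densPow γ θ (x, y)) θ)
    (j : Fin K ⊕ Fin 2) :
    xiVec γ g θ x j = 1 / γ * (∫ y, g x y • fderiv ℝ (fun θ => densPow γ θ (x, y)) θ)
      (EuclideanSpace.single j 1) := by
  rw [ContinuousLinearMap.integral_apply hint, ← integral_const_mul, xiVec]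
  refine integral_congr_ae (ae_of_all _ fun y => ?_)
  simp only [smul_apply, smul_eq_mul]
  rw [← score_mul_densPow hU hUa _ hθ]
  field_simp

omit hU hUa hγ in
lemma condMean_estFun {g : Cov T K → Resp T → ℝ} {θ : Param K} {x : Cov T K}
    (hg1 : ∫ y, g x y = 1)
    (hint : Integrable fun y => g x y • fderiv ℝ (fun θ => densPow γ θ (x, y)) θ) :
    condMean g (estFun γ θ) x = (1 / (1 + γ)) • fderiv ℝ (powInt T γ) θ -
      (1 / γ) • ∫ y, g x y • fderiv ℝ (fun θ => densPow γ θ (x, y)) θ := by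
  have hgi : Integrable (g x) := integrable_of_integral_eq_one hg1
  have h2 : ∀ y, g x y • estFun γ θ (x, y) =
      g x y • ((1 / (1 + γ)) • fderiv ℝ (powInt T γ) θ) -
      (1 / γ) • g x y • fderiv ℝ (fun θ => densPow γ θ (x, y)) θ := fun y => by
    rw [estFun, smul_sub, smul_comm (1 / γ)]
  rw [condMean]
  simp_rw [h2]
  have hs : Integrable fun y => (1 / γ) • g x y • fderiv ℝ (fun θ => densPow γ θ (x, y)) θ :=
    hint.smul (1 / γ)
  rw [integral_sub (hgi.smul_const _) hs, integral_smul_const, hg1, one_smul, integral_smul]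

/-- The expected estimating equations given the covariates say that the conditional expectations of
the estimating functions sum to zero. -/
lemma sum_condMean_estFun_eq_zero {g : Cov T K → Resp T → ℝ} {θ : Param K} (hθ : θ ∈ U) {N : ℕ}
    {x : Fin N → Cov T K} (hg1 : ∀ i, ∫ y, g (x i) y = 1)
    (hint : ∀ i, Integrable fun y => g (x i) y • fderiv ℝ (fun θ => densPow γ θ (x i, y)) θ)
    (h : IsExpectedRoot γ g x θ) : ∑ i, condMean g (estFun γ θ) (x i) = 0 := by
  have hj : ∀ j, (∑ i, condMean g (estFun γ θ) (x i)) (EuclideanSpace.single j 1) = 0 := by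
    intro j
    have := h j
    rw [sum_apply, ← neg_eq_zero, ← Finset.sum_neg_distrib, ← this]
    refine Finset.sum_congr rfl fun i _ => ?_
    rw [condMean_estFun (hg1 i) (hint i), sub_apply, smul_apply, smul_apply,
      integral_score_mul_densPow hU hUa hγ hθ]
    have := xiVec_eq hU hUa hγ hθ (hint i) j
    rw [xiVec] at this
    rw [this, smul_eq_mul, smul_eq_mul]
    ring
  ext v
  rw [clm_apply_eq_sum, zero_apply]
  exact Finset.sum_eq_zero fun j _ => by rw [hj, smul_zero]

/-- The quadratic form of the matrix `K⁽ⁱ⁾` is the conditional variance of the estimating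
function in the given direction. -/
lemma dotProduct_Kmat_mulVec {g : Cov T K → Resp T → ℝ} {θ : Param K} (hθ : θ ∈ U) {x : Cov T K}
    (hint : Integrable fun y => g x y • fderiv ℝ (fun θ => densPow γ θ (x, y)) θ)
    (hint2 : Integrable fun y => g x y * ‖fderiv ℝ (fun θ => densPow γ θ (x, y)) θ‖ ^ 2)
    (hgm : Measurable (g x)) (hg0 : ∀ y, 0 ≤ g x y)
    (v : Param K) :
    v.ofLp ⬝ᵥ (Kmat γ g θ x).mulVec v.ofLp = (1 / γ) ^ 2 *
      ((∫ y, g x y * fderiv ℝ (fun θ => densPow γ θ (x, y)) θ v ^ 2) -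
      (∫ y, g x y * fderiv ℝ (fun θ => densPow γ θ (x, y)) θ v) ^ 2) := by
  set e : Fin K ⊕ Fin 2 → Param K := fun j => EuclideanSpace.single j 1 with he
  set D : Resp T → Param K →L[ℝ] ℝ := fun y => fderiv ℝ (fun θ => densPow γ θ (x, y)) θ with hD
  have hmk : Continuous fun y : Resp T => (x, y) := by fun_prop
  have hDc : Continuous D := (continuous_fderiv_densPow hU hUa γ hθ).comp hmk
  have hDv : ∀ A : Param K →L[ℝ] ℝ, A v = ∑ j, v j * A (e j) := fun A => clm_apply_eq_sum A v
  have i2 : ∀ j k, Integrable fun y => g x y * (D y (e j) * D y (e k)) := fun j k => by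
    refine hint2.mono' (hgm.aestronglyMeasurable.mul
      ((hDc.clm_apply continuous_const).mul (hDc.clm_apply continuous_const)).aestronglyMeasurable)
      (ae_of_all _ fun y => ?_)
    rw [norm_mul, norm_mul, Real.norm_of_nonneg (hg0 y), sq]
    have hn : ∀ (A : Param K →L[ℝ] ℝ) (i : Fin K ⊕ Fin 2), ‖A (e i)‖ ≤ ‖A‖ := fun A i => by
      simpa [he] using A.le_opNorm (e i)
    have := hg0 y
    gcongr
    · exact hn _ _
    · exact hn _ _
  have hK : ∀ j k, Kmat γ g θ x j k = (1 / γ) ^ 2 * ((∫ y, g x y * (D y (e j) * D y (e k))) -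
      (∫ y, g x y • D y) (e j) * (∫ y, g x y • D y) (e k)) := by
    intro j k
    rw [Kmat, Matrix.of_apply, xiVec_eq hU hUa hγ hθ hint, xiVec_eq hU hUa hγ hθ hint]
    have h1 : ∫ y, score θ x y j * score θ x y k * modelDensity θ x y ^ (2 * γ) * g x y =
        (1 / γ) ^ 2 * ∫ y, g x y * (D y (e j) * D y (e k)) := by
      rw [← integral_const_mul]
      refine integral_congr_ae (ae_of_all _ fun y => ?_)
      simp only [hD, he]
      rw [← score_mul_densPow hU hUa _ hθ, ← score_mul_densPow hU hUa _ hθ, two_mul,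
        Real.rpow_add (modelDensity_pos (hUa hθ) x y)]
      field_simp
    rw [h1]
    ring
  have hA : ∫ y, g x y * D y v = (∫ y, g x y • D y) v := by
    rw [ContinuousLinearMap.integral_apply hint]
    rfl
  have hB : ∫ y, g x y * D y v ^ 2 =
      ∑ j, ∑ k, v j * v k * ∫ y, g x y * (D y (e j) * D y (e k)) := by
    have : ∀ y, g x y * D y v ^ 2 = ∑ j, ∑ k, v j * v k * (g x y * (D y (e j) * D y (e k))) := by
      intro y
      rw [hDv, sq, Finset.sum_mul_sum, Finset.mul_sum]
      refine Finset.sum_congr rfl fun j _ => ?_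
      rw [Finset.mul_sum]
      exact Finset.sum_congr rfl fun k _ => by ring
    simp_rw [this]
    rw [integral_finsetSum _ fun j _ => integrable_finsetSum _ fun k _ => (i2 j k).const_mul _]
    refine Finset.sum_congr rfl fun j _ => ?_
    rw [integral_finsetSum _ fun k _ => (i2 j k).const_mul _]
    exact Finset.sum_congr rfl fun k _ => integral_const_mul _ _
  rw [hA, hB, hDv, sq (Finset.sum _ _), Finset.sum_mul_sum, ← Finset.sum_sub_distrib,
    Finset.mul_sum]
  simp only [dotProduct, Matrix.mulVec, hK]
  refine Finset.sum_congr rfl fun j _ => ?_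
  rw [← Finset.sum_sub_distrib, Finset.mul_sum, Finset.mul_sum]
  exact Finset.sum_congr rfl fun k _ => by ring

lemma hasFDerivAt_empDPD {N : ℕ} (hN : 0 < N) (d : Fin N → Cov T K × Resp T)
    {θ : Param K} (hθ : θ ∈ U) :
    HasFDerivAt (empDPD γ d) ((1 + γ) • avg (estFun γ θ) d) θ := by
  have hN' : (0 : ℝ) < N := by exact_mod_cast hN
  have he : empDPD γ d =ᶠ[𝓝 θ] fun θ => (1 / (N : ℝ)) * ∑ _i : Fin N, powInt T γ θ -
      (1 + γ) / (N * γ) * ∑ i, densPow γ θ (d i) := by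
    filter_upwards [hU.mem_nhds hθ] with η hη
    have hi : ∀ i, ∫ y, modelDensity η (d i).1 y ^ (1 + γ) = powInt T γ η := fun i =>
      integral_densPow (hUa hη) γ (d i).1
    simp only [empDPD, hi]
    rfl
  have h1 : HasFDerivAt (powInt (K := K) T γ) (fderiv ℝ (powInt T γ) θ) θ :=
    ((contDiffOn_powInt hUa γ).contDiffAt (hU.mem_nhds hθ)).differentiableAt
      (by norm_num) |>.hasFDerivAt
  have h2 : ∀ i, HasFDerivAt (fun θ => densPow γ θ (d i))
      (fderiv ℝ (fun θ => densPow γ θ (d i)) θ) θ := fun i =>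
    ((contDiffOn_densPow hU hUa γ (d i)).contDiffAt (hU.mem_nhds hθ)).differentiableAt
      (by norm_num) |>.hasFDerivAt
  have h := ((HasFDerivAt.fun_sum fun (_ : Fin N) (_ : _ ∈ Finset.univ) => h1).const_mul
    (1 / (N : ℝ))).fun_sub ((HasFDerivAt.fun_sum fun i (_ : i ∈ Finset.univ) => h2 i).const_mul
    ((1 + γ) / (N * γ)))
  refine (h.congr_fderiv ?_).congr_of_eventuallyEq he
  simp only [avg, estFun, Finset.sum_sub_distrib, smul_sub, ← Finset.smul_sum, smul_smul]
  congr 2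
  · field_simp
  · field_simp

end Identities

/-! ### Bounds for the derivatives of the estimating function -/

section Bounds

set_option maxSynthPendingDepth 3

lemma fderiv_clm_apply_const {E F G : Type*} [NormedAddCommGroup E] [NormedSpace ℝ E]
    [NormedAddCommGroup F] [NormedSpace ℝ F] [NormedAddCommGroup G] [NormedSpace ℝ G]
    {B : E → F →L[ℝ] G} {θ : E} (hB : DifferentiableAt ℝ B θ) (v : F) (w : E) :
    fderiv ℝ (fun η => B η v) θ w = fderiv ℝ B θ w v := by
  have h := hB.hasFDerivAt.clm_apply (hasFDerivAt_const v θ)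
  rw [h.fderiv]
  simp

/-- A function with bounded second derivative is nearly affine on a ball, with the derivative at the
centre. -/
lemma norm_sub_sub_apply_le {E F : Type*} [NormedAddCommGroup E] [NormedSpace ℝ E]
    [NormedAddCommGroup F] [NormedSpace ℝ F] {f : E → F} {f' : E → E →L[ℝ] F}
    {f'' : E → E →L[ℝ] E →L[ℝ] F} {c : E} {t L : ℝ} (ht : 0 < t) (hL : 0 ≤ L)
    (hf : ∀ x ∈ Metric.ball c t, HasFDerivAt f (f' x) x)
    (hf' : ∀ x ∈ Metric.ball c t, HasFDerivAt f' (f'' x) x)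
    (hbound : ∀ x ∈ Metric.ball c t, ‖f'' x‖ ≤ L)
    {x y : E} (hx : x ∈ Metric.ball c t) (hy : y ∈ Metric.ball c t) :
    ‖f x - f y - f' c (x - y)‖ ≤ L * max ‖x - c‖ ‖y - c‖ * ‖x - y‖ := by
  have hsub : Metric.closedBall c (max ‖x - c‖ ‖y - c‖) ⊆ Metric.ball c t := by
    refine Metric.closedBall_subset_ball (max_lt ?_ ?_)
    · exact mem_ball_iff_norm.1 hx
    · exact mem_ball_iff_norm.1 hy
  have hlip : ∀ x ∈ Metric.ball c t, ‖f' x - f' c‖ ≤ L * ‖x - c‖ := fun x hx =>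
    (convex_ball c t).norm_image_sub_le_of_norm_hasFDerivWithin_le
      (fun z hz => (hf' z hz).hasFDerivWithinAt) hbound (Metric.mem_ball_self ht) hx
  refine (convex_closedBall c (max ‖x - c‖ ‖y - c‖)).norm_image_sub_le_of_norm_hasFDerivWithin_le'
    (f' := f') (fun z hz => (hf z (hsub hz)).hasFDerivWithinAt) (fun z hz => ?_)
    (mem_closedBall_iff_norm.2 (le_max_right _ _)) (mem_closedBall_iff_norm.2 (le_max_left _ _))
  refine (hlip z (hsub hz)).trans ?_
  gcongr
  exact mem_closedBall_iff_norm.1 hz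

variable {T K : ℕ} {U : Set (Param K)}

lemma pderiv_pderiv_pderiv (hU : IsOpen U) {h : Param K → ℝ} (hh : ContDiffOn ℝ 3 h U)
    {θ : Param K} (hθ : θ ∈ U) (j k l : Fin K ⊕ Fin 2) :
    pderiv j (pderiv k (pderiv l h)) θ = fderiv ℝ (fderiv ℝ (fderiv ℝ h)) θ
      (EuclideanSpace.single j 1) (EuclideanSpace.single k 1) (EuclideanSpace.single l 1) := by
  have h1 : ContDiffOn ℝ 2 (fderiv ℝ h) U := hh.fderiv_of_isOpen hU (by norm_num)
  have h2 : ContDiffOn ℝ 1 (fderiv ℝ (fderiv ℝ h)) U := h1.fderiv_of_isOpen hU (by norm_num)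
  have d1 : ∀ η ∈ U, DifferentiableAt ℝ (fderiv ℝ h) η := fun η hη =>
    (h1.contDiffAt (hU.mem_nhds hη)).differentiableAt (by norm_num)
  have d2 : DifferentiableAt ℝ (fderiv ℝ (fderiv ℝ h)) θ :=
    (h2.contDiffAt (hU.mem_nhds hθ)).differentiableAt (by norm_num)
  have he : pderiv k (pderiv l h) =ᶠ[𝓝 θ] fun η => fderiv ℝ (fderiv ℝ h) η
      (EuclideanSpace.single k 1) (EuclideanSpace.single l 1) := by
    filter_upwards [hU.mem_nhds hθ] with η hη
    exact fderiv_clm_apply_const (d1 η hη) _ _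
  have d3 : DifferentiableAt ℝ (fun η => fderiv ℝ (fderiv ℝ h) η
      (EuclideanSpace.single k (1 : ℝ) : Param K)) θ :=
    (d2.hasFDerivAt.clm_apply (hasFDerivAt_const _ θ)).differentiableAt
  rw [pderiv, he.fderiv_eq, fderiv_clm_apply_const d3, fderiv_clm_apply_const d2]

lemma norm_fderiv_fderiv_fderiv_le (hU : IsOpen U) {h : Param K → ℝ} (hh : ContDiffOn ℝ 3 h U)
    {θ : Param K} (hθ : θ ∈ U) {m : Fin K ⊕ Fin 2 → Fin K ⊕ Fin 2 → Fin K ⊕ Fin 2 → ℝ}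
    (hm : ∀ j k l, |pderiv j (pderiv k (pderiv l h)) θ| ≤ m j k l) :
    ‖fderiv ℝ (fderiv ℝ (fderiv ℝ h)) θ‖ ≤ ∑ j, ∑ k, ∑ l, m j k l := by
  refine (norm_le_sum_norm_single _).trans (Finset.sum_le_sum fun j _ => ?_)
  refine (norm_le_sum_norm_single _).trans (Finset.sum_le_sum fun k _ => ?_)
  refine (norm_le_sum_norm_single _).trans (Finset.sum_le_sum fun l _ => ?_)
  rw [← pderiv_pderiv_pderiv hU hh hθ]
  exact hm j k l

lemma contDiffOn_exp_quadForm (hU : IsOpen U) (hUa : U ⊆ admissible K) (c : ℝ)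
    (z : Cov T K × Resp T) :
    ContDiffOn ℝ 3 (fun η => Real.exp (-(c / 2) * quadForm η z.1 z.2)) U := by
  have hl : ContDiffOn ℝ 3 (logScale (K := K) T) U := fun θ hθ =>
    (contDiffAt_logScale (hUa hθ)).contDiffWithinAt
  have h := ((hl.sub (contDiffOn_logDensity hU hUa z)).const_smul (-c)).exp
  refine h.congr fun θ hθ => ?_
  have h1 := log_modelDensity (hUa hθ) z.1 z.2
  have h2 : logDensity θ z = logScale T θ - 1 / 2 * quadForm θ z.1 z.2 := h1
  simp only [smul_eq_mul, h2]
  congr 1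
  ring

/-- Bounds for the third derivatives of the exponential factor of the model density at an
observation `z` control the estimating function near `θ₀`: its first two derivatives, the square of
its size, and its deviation from an affine function. -/
theorem exists_bound_estFun (hU : IsOpen U) (hUa : U ⊆ admissible K) {γ : ℝ} (hγ : 0 < γ)
    {θ₀ : Param K} (hθ₀ : θ₀ ∈ U) :
    ∃ t > 0, Metric.ball θ₀ t ⊆ U ∧ ∃ C : ℝ, 0 ≤ C ∧
      ∀ (z : Cov T K × Resp T) (m : Fin K ⊕ Fin 2 → Fin K ⊕ Fin 2 → Fin K ⊕ Fin 2 → ℝ),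
      (∀ θ ∈ U, ∀ j k l,
        |pderiv j (pderiv k (pderiv l fun η => Real.exp (-(γ / 2) * quadForm η z.1 z.2))) θ|
          ≤ m j k l) →
      (∀ θ ∈ Metric.ball θ₀ t,
        ‖fderiv ℝ (fderiv ℝ fun θ => densPow γ θ z) θ‖ ≤ C * (1 + ∑ j, ∑ k, ∑ l, m j k l) ∧
        ‖fderiv ℝ (fun θ => densPow γ θ z) θ‖ ^ 2 ≤ C * (1 + ∑ j, ∑ k, ∑ l, m j k l)) ∧
      ∀ θ ∈ Metric.ball θ₀ t, ∀ θ' ∈ Metric.ball θ₀ t,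
        ‖estFun γ θ z - estFun γ θ' z - estFunDeriv γ θ₀ z (θ - θ')‖ ≤
          C * (1 + ∑ j, ∑ k, ∑ l, m j k l) * max ‖θ - θ₀‖ ‖θ' - θ₀‖ * ‖θ - θ'‖ := by
  obtain ⟨ε, hε, hεU⟩ := Metric.isOpen_iff.1 hU θ₀ hθ₀
  obtain ⟨t, ht, hte⟩ : ∃ t > 0, 4 * t = ε := ⟨ε / 4, by positivity, by ring⟩
  rw [← hte] at hεU
  have hsub : Metric.ball θ₀ t ⊆ Metric.ball θ₀ (4 * t) := Metric.ball_subset_ball (by linarith)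
  have hcsub : Metric.closedBall θ₀ t ⊆ U :=
    (Metric.closedBall_subset_ball (by linarith)).trans hεU
  have hA : ContDiffOn ℝ 3 (fun θ : Param K => Real.exp (γ * logScale T θ))
      (Metric.ball θ₀ (4 * t)) := fun θ hθ =>
    ((contDiffAt_const.mul (contDiffAt_logScale (hUa (hεU hθ)))).exp).contDiffWithinAt
  obtain ⟨C, hC, hCb⟩ := exists_bound_fderiv_mul ht hA
  -- the third derivative of the integral of the power of the density is bounded
  have hp1 : ContDiffOn ℝ 2 (fderiv ℝ (powInt (K := K) T γ)) U :=
    (contDiffOn_powInt hUa γ).fderiv_of_isOpen hU (by norm_num)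
  have hp2 : ContDiffOn ℝ 1 (fderiv ℝ (fderiv ℝ (powInt (K := K) T γ))) U :=
    hp1.fderiv_of_isOpen hU (by norm_num)
  have hp3 : ContDiffOn ℝ 0 (fderiv ℝ (fderiv ℝ (fderiv ℝ (powInt (K := K) T γ)))) U :=
    hp2.fderiv_of_isOpen hU (by norm_num)
  obtain ⟨B, hB⟩ := (isCompact_closedBall θ₀ t).exists_bound_of_continuousOn
    (E := Param K →L[ℝ] Param K →L[ℝ] Param K →L[ℝ] ℝ) (hp3.continuousOn.mono hcsub)
  have hB0 : 0 ≤ B := (norm_nonneg _).trans (hB θ₀ (Metric.mem_closedBall_self ht.le))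
  obtain ⟨D, hD⟩ : ∃ D, D = C + (1 / (1 + γ) * B + 1 / γ * C) := ⟨_, rfl⟩
  have hD1 : C ≤ D := by
    have : 0 ≤ 1 / (1 + γ) * B + 1 / γ * C := by positivity
    rw [hD]
    linarith
  refine ⟨t, ht, hsub.trans hεU, D, hC.trans hD1, fun z m hm => ?_⟩
  have hh := contDiffOn_exp_quadForm hU hUa γ z
  generalize hm' : ∑ j, ∑ k, ∑ l, m j k l = m'
  have h3 : ∀ θ ∈ U, ‖fderiv ℝ (fderiv ℝ (fderiv ℝ
      fun η => Real.exp (-(γ / 2) * quadForm η z.1 z.2))) θ‖ ≤ m' := fun θ hθ =>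
    hm' ▸ norm_fderiv_fderiv_fderiv_le hU hh hθ (hm θ hθ)
  have hm0 : 0 ≤ m' := (norm_nonneg _).trans (h3 θ₀ hθ₀)
  have hb := hCb _ m' hm0 (hh.mono hεU) (fun θ hθ => ⟨(Real.exp_pos _).le, by
    refine Real.exp_le_one_iff.2 ?_
    have := quadForm_nonneg (hUa (hεU hθ)) z.1 z.2
    nlinarith⟩) (fun θ hθ => h3 θ (hεU hθ))
  -- on `U` the power of the density is the product of the two factors
  have hφ : ∀ θ ∈ U, (fun θ => densPow γ θ z) =ᶠ[𝓝 θ]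
      fun θ => Real.exp (γ * logScale T θ) * Real.exp (-(γ / 2) * quadForm θ z.1 z.2) := by
    intro θ hθ
    filter_upwards [hU.mem_nhds hθ] with η hη using modelDensity_rpow (hUa hη) z.1 z.2 γ
  have hb' : ∀ θ ∈ Metric.ball θ₀ t,
      ‖fderiv ℝ (fderiv ℝ (fderiv ℝ fun θ => densPow γ θ z)) θ‖ ≤ C * (1 + m') ∧
      ‖fderiv ℝ (fderiv ℝ fun θ => densPow γ θ z) θ‖ ≤ C * (1 + m') ∧
      ‖fderiv ℝ (fun θ => densPow γ θ z) θ‖ ^ 2 ≤ C * (1 + m') := by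
    intro θ hθ
    have he := hφ θ (hεU (hsub hθ))
    rw [he.fderiv.fderiv.fderiv_eq, he.fderiv.fderiv_eq, he.fderiv_eq]
    exact hb θ hθ
  have hCD : C * (1 + m') ≤ D * (1 + m') := by gcongr
  refine ⟨fun θ hθ => ⟨(hb' θ hθ).2.1.trans hCD, (hb' θ hθ).2.2.trans hCD⟩, ?_⟩
  have hd : ∀ θ ∈ Metric.ball θ₀ t, HasFDerivAt (fun θ => estFunDeriv γ θ z)
      ((1 / (1 + γ)) • fderiv ℝ (fderiv ℝ (fderiv ℝ (powInt T γ))) θ -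
        (1 / γ) • fderiv ℝ (fderiv ℝ (fderiv ℝ fun θ => densPow γ θ z)) θ) θ := by
    intro θ hθ
    have hθU := hU.mem_nhds (hεU (hsub hθ))
    have d1 : DifferentiableAt ℝ (fderiv ℝ (fderiv ℝ (powInt (K := K) T γ))) θ :=
      (hp2.contDiffAt hθU).differentiableAt (by norm_num)
    have d2 : DifferentiableAt ℝ (fderiv ℝ (fderiv ℝ fun θ => densPow γ θ z)) θ :=
      ((((contDiffOn_densPow hU hUa γ z).fderiv_of_isOpen hU (m := 2)
        (by norm_num)).fderiv_of_isOpen hU (m := 1) (by norm_num)).contDiffAt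
        hθU).differentiableAt (by norm_num)
    exact (d1.hasFDerivAt.fun_const_smul _).fun_sub (d2.hasFDerivAt.fun_const_smul _)
  have hbd : ∀ θ ∈ Metric.ball θ₀ t,
      ‖(1 / (1 + γ)) • fderiv ℝ (fderiv ℝ (fderiv ℝ (powInt T γ))) θ -
        (1 / γ) • fderiv ℝ (fderiv ℝ (fderiv ℝ fun θ => densPow γ θ z)) θ‖ ≤ D * (1 + m') := by
    intro θ hθ
    have h1 := hB θ (Metric.ball_subset_closedBall hθ)
    have h2 := (hb' θ hθ).1
    generalize fderiv ℝ (fderiv ℝ (fderiv ℝ (powInt (K := K) T γ))) θ = a₁ at h1 ⊢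
    generalize fderiv ℝ (fderiv ℝ (fderiv ℝ fun θ => densPow γ θ z)) θ = a₂ at h2 ⊢
    refine (norm_sub_le _ _).trans ?_
    rw [norm_smul, norm_smul, Real.norm_of_nonneg (by positivity),
      Real.norm_of_nonneg (by positivity)]
    calc 1 / (1 + γ) * ‖a₁‖ + 1 / γ * ‖a₂‖ ≤ 1 / (1 + γ) * B + 1 / γ * (C * (1 + m')) := by
          gcongr
      _ ≤ D * (1 + m') := by
          have h1 : 0 ≤ C * (1 + m') := mul_nonneg hC (by linarith)
          have h2 : 0 ≤ 1 / (1 + γ) * B * m' := mul_nonneg (by positivity) hm0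
          rw [hD]
          linarith [show (C + (1 / (1 + γ) * B + 1 / γ * C)) * (1 + m') = C * (1 + m') +
            1 / (1 + γ) * B + 1 / (1 + γ) * B * m' + 1 / γ * (C * (1 + m')) by ring]
  intro θ hθ θ' hθ'
  have hDm : 0 ≤ D * (1 + m') := mul_nonneg (hC.trans hD1) (by linarith)
  exact norm_sub_sub_apply_le (f := fun θ => estFun γ θ z) (f' := fun θ => estFunDeriv γ θ z) ht hDm
    (fun η hη => hasFDerivAt_estFun hU hUa (hεU (hsub hη)) z) hd hbd hθ hθ'

end Bounds

/-! ### Conditional expectations given the covariates -/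

section Conditioning

variable {T K : ℕ} {ν : Measure (Cov T K)} {g : Cov T K → Resp T → ℝ}
  {V : Type*} [NormedAddCommGroup V] [NormedSpace ℝ V]

section Measurability

variable (hgm : Measurable (Function.uncurry g)) (hg0 : ∀ x y, 0 ≤ g x y)
include hgm

lemma measurable_ofReal_uncurry :
    Measurable fun z : Cov T K × Resp T => ENNReal.ofReal (g z.1 z.2) :=
  ENNReal.measurable_ofReal.comp hgm

lemma measurable_condMean [MeasurableSpace V] [BorelSpace V] [SecondCountableTopology V]
    {W : Cov T K × Resp T → V} (hW : Measurable W) : Measurable (condMean g W) := by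
  have h : StronglyMeasurable fun z : Cov T K × Resp T => g z.1 z.2 • W z :=
    (Measurable.smul hgm hW).stronglyMeasurable
  exact h.integral_prod_right'.measurable

lemma ae_ae_of_ae_jointLaw [SFinite ν] {p : Cov T K × Resp T → Prop}
    (h : ∀ᵐ z ∂(jointLaw ν g), p z) : ∀ᵐ x ∂ν, ∀ᵐ y, 0 < g x y → p (x, y) := by
  have h1 := (ae_withDensity_iff (measurable_ofReal_uncurry hgm)).1 h
  filter_upwards [Measure.ae_ae_of_ae_prod h1] with x hx
  filter_upwards [hx] with y hy hg
  exact hy (by simpa using hg)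

include hg0

lemma integrable_jointLaw_iff {W : Cov T K × Resp T → V} :
    Integrable W (jointLaw ν g) ↔ Integrable (fun z => g z.1 z.2 • W z) (ν.prod volume) := by
  rw [jointLaw, integrable_withDensity_iff_integrable_smul' (measurable_ofReal_uncurry hgm)
    (ae_of_all _ fun _ => ENNReal.ofReal_lt_top)]
  simp_rw [ENNReal.toReal_ofReal (hg0 _ _)]

lemma integral_jointLaw (W : Cov T K × Resp T → V) :
    ∫ z, W z ∂(jointLaw ν g) = ∫ z, g z.1 z.2 • W z ∂(ν.prod volume) := by
  rw [jointLaw, integral_withDensity_eq_integral_toReal_smul (measurable_ofReal_uncurry hgm)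
    (ae_of_all _ fun _ => ENNReal.ofReal_lt_top)]
  simp_rw [ENNReal.toReal_ofReal (hg0 _ _)]

lemma ae_integrable_smul [SFinite ν] {W : Cov T K × Resp T → V} (hW : Integrable W (jointLaw ν g)) :
    ∀ᵐ x ∂ν, Integrable fun y => g x y • W (x, y) :=
  ((integrable_jointLaw_iff hgm hg0).1 hW).prod_right_ae

end Measurability

variable [IsProbabilityMeasure ν] (hgm : Measurable (Function.uncurry g))
  (hg0 : ∀ x y, 0 ≤ g x y) (hg1 : ∀ᵐ x ∂ν, ∫ y, g x y = 1)
include hgm hg0 hg1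

lemma map_fst_jointLaw : (jointLaw ν g).map Prod.fst = ν := by
  ext s hs
  rw [Measure.map_apply measurable_fst hs, jointLaw, withDensity_apply _ (measurable_fst hs),
    ← Set.prod_univ, ← Measure.prod_restrict, Measure.restrict_univ,
    lintegral_prod _ (measurable_ofReal_uncurry hgm).aemeasurable]
  have : ∀ᵐ x ∂(ν.restrict s), ∫⁻ y, ENNReal.ofReal (g x y) = 1 := by
    refine ae_restrict_of_ae ?_
    filter_upwards [hg1] with x hx
    rw [← ofReal_integral_eq_lintegral_ofReal (integrable_of_integral_eq_one hx)
      (ae_of_all _ (hg0 x)), hx, ENNReal.ofReal_one]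
  rw [lintegral_congr_ae this, lintegral_one, Measure.restrict_apply_univ]

lemma isProbabilityMeasure_jointLaw : IsProbabilityMeasure (jointLaw ν g) := by
  have h := map_fst_jointLaw hgm hg0 hg1
  refine ⟨?_⟩
  rw [← Set.preimage_univ (f := Prod.fst), ← Measure.map_apply measurable_fst MeasurableSet.univ, h,
    measure_univ]

lemma ae_jointLaw_fst {p : Cov T K → Prop} (h : ∀ᵐ x ∂ν, p x) :
    ∀ᵐ z ∂(jointLaw ν g), p z.1 := by
  rw [← map_fst_jointLaw hgm hg0 hg1] at h
  exact ae_of_ae_map measurable_fst.aemeasurable h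

omit [NormedSpace ℝ V] in
lemma integrable_comp_fst_iff {h : Cov T K → V} (hm : AEStronglyMeasurable h ν) :
    Integrable (fun z : Cov T K × Resp T => h z.1) (jointLaw ν g) ↔ Integrable h ν := by
  have hmap := map_fst_jointLaw hgm hg0 hg1
  have := integrable_map_measure (μ := jointLaw ν g) (f := Prod.fst) (g := h) (by rwa [hmap])
    measurable_fst.aemeasurable
  rw [hmap] at this
  exact this.symm

lemma integral_comp_fst {h : Cov T K → V} (hm : AEStronglyMeasurable h ν) :
    ∫ z, h z.1 ∂(jointLaw ν g) = ∫ x, h x ∂ν := by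
  have hmap := map_fst_jointLaw hgm hg0 hg1
  have := integral_map (μ := jointLaw ν g) (φ := Prod.fst) (f := h) measurable_fst.aemeasurable
    (by rwa [hmap])
  rw [hmap] at this
  exact this.symm

omit [IsProbabilityMeasure ν] hg1 in
lemma integrable_condMean' [SFinite ν] {W : Cov T K × Resp T → V}
    (hW : Integrable W (jointLaw ν g)) :
    Integrable (condMean g W) ν :=
  ((integrable_jointLaw_iff hgm hg0).1 hW).integral_prod_left

lemma integrable_condMean {W : Cov T K × Resp T → V} (hW : Integrable W (jointLaw ν g)) :
    Integrable (fun z => condMean g W z.1) (jointLaw ν g) := by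
  have h := integrable_condMean' hgm hg0 hW
  exact (integrable_comp_fst_iff hgm hg0 hg1 h.1).2 h

/-- The law of total expectation. -/
lemma integral_condMean {W : Cov T K × Resp T → V} (hW : Integrable W (jointLaw ν g)) :
    ∫ z, condMean g W z.1 ∂(jointLaw ν g) = ∫ z, W z ∂(jointLaw ν g) := by
  rw [integral_comp_fst hgm hg0 hg1 (integrable_condMean' hgm hg0 hW).1,
    integral_jointLaw hgm hg0, integral_prod _ ((integrable_jointLaw_iff hgm hg0).1 hW)]
  rfl

omit [IsProbabilityMeasure ν] hg0 hg1 in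
lemma integrable_mul_of_integrable_mul_sq {x : Cov T K} (h0 : ∀ y, 0 ≤ g x y)
    (h1 : ∫ y, g x y = 1) {f : Resp T → ℝ} (hf : Measurable f)
    (hf2 : Integrable fun y => g x y * f y ^ 2) : Integrable fun y => g x y * f y := by
  have hgx : Measurable (g x) := hgm.of_uncurry_left
  refine ((integrable_of_integral_eq_one h1).add hf2).mono'
    (hgx.mul hf).aestronglyMeasurable (ae_of_all _ fun y => ?_)
  have h2 : |f y| ≤ 1 + f y ^ 2 := by
    rw [← sq_abs]
    nlinarith [sq_nonneg (|f y| - 1), abs_nonneg (f y)]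
  rw [norm_mul, Real.norm_of_nonneg (h0 y), Real.norm_eq_abs]
  calc g x y * |f y| ≤ g x y * (1 + f y ^ 2) := by have := h0 y; gcongr
    _ = _ := by simp only [Pi.add_apply]; ring

omit [IsProbabilityMeasure ν] hg0 hg1 in
/-- The variance for the conditional density is the mean square minus the square of the mean. -/
lemma integral_mul_sub_sq {x : Cov T K} (h0 : ∀ y, 0 ≤ g x y)
    (h1 : ∫ y, g x y = 1) {f : Resp T → ℝ} (hf : Measurable f)
    (hf2 : Integrable fun y => g x y * f y ^ 2) :
    ∫ y, g x y * (f y - ∫ y, g x y * f y) ^ 2 =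
      (∫ y, g x y * f y ^ 2) - (∫ y, g x y * f y) ^ 2 := by
  have hi := integrable_mul_of_integrable_mul_sq hgm h0 h1 hf hf2
  set m := ∫ y, g x y * f y with hm
  have he : ∀ y, g x y * (f y - m) ^ 2 = g x y * f y ^ 2 - 2 * m * (g x y * f y) +
      m ^ 2 * g x y := fun y => by ring
  simp_rw [he]
  have hd : Integrable fun y => g x y * f y ^ 2 - 2 * m * (g x y * f y) := hf2.sub (hi.const_mul _)
  rw [integral_add hd ((integrable_of_integral_eq_one h1).const_mul _),
    integral_sub hf2 (hi.const_mul _), integral_const_mul, integral_const_mul, h1, ← hm]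
  ring

/-- The conditional expectation of a square integrable function is square integrable. -/
lemma memLp_condMean {f : Cov T K × Resp T → ℝ} (hf : Measurable f)
    (hf2 : MemLp f 2 (jointLaw ν g)) :
    MemLp (fun z => condMean g f z.1) 2 (jointLaw ν g) := by
  have hi2 : Integrable (fun z => f z ^ 2) (jointLaw ν g) := hf2.integrable_sq
  have hm : Measurable fun z : Cov T K × Resp T => condMean g f z.1 :=
    (measurable_condMean hgm hf).comp measurable_fst
  rw [memLp_two_iff_integrable_sq hm.aestronglyMeasurable]
  refine (integrable_condMean hgm hg0 hg1 hi2).mono' (hm.pow_const 2).aestronglyMeasurable ?_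
  refine ae_jointLaw_fst hgm hg0 hg1 (p := fun x => ‖condMean g f x ^ 2‖ ≤
    condMean g (fun z => f z ^ 2) x) ?_
  filter_upwards [hg1, ae_integrable_smul hgm hg0 hi2] with x h1 h2
  have hv := integral_mul_sub_sq hgm (hg0 x) h1 (f := fun y => f (x, y))
    (hf.comp measurable_prodMk_left) h2
  have : 0 ≤ ∫ y, g x y * (f (x, y) - ∫ y, g x y * f (x, y)) ^ 2 :=
    integral_nonneg fun y => mul_nonneg (hg0 x y) (sq_nonneg _)
  rw [Real.norm_of_nonneg (sq_nonneg _)]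
  simp only [condMean, smul_eq_mul]
  linarith

/-- The variance of the deviation from the conditional expectation is the expected conditional
variance. -/
lemma integral_sub_condMean_sq {f : Cov T K × Resp T → ℝ} (hf : Measurable f)
    (hf2 : MemLp f 2 (jointLaw ν g)) :
    ∫ z, (f z - condMean g f z.1) ^ 2 ∂(jointLaw ν g) =
      ∫ x, (condMean g (fun z => f z ^ 2) x - condMean g f x ^ 2) ∂ν := by
  have hi := (hf2.sub (memLp_condMean hgm hg0 hg1 hf hf2)).integrable_sq
  have hi2 : Integrable (fun z => f z ^ 2) (jointLaw ν g) := hf2.integrable_sq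
  rw [integral_jointLaw hgm hg0]
  have hp := integral_prod _ ((integrable_jointLaw_iff hgm hg0).1 hi)
  refine hp.trans (integral_congr_ae ?_)
  filter_upwards [hg1, ae_integrable_smul hgm hg0 hi2] with x h1 h2
  exact integral_mul_sub_sq hgm (hg0 x) h1 (f := fun y => f (x, y))
    (hf.comp measurable_prodMk_left) h2

end Conditioning

/-! ### Linearization of the estimating function -/

section Linearization

set_option maxSynthPendingDepth 3

variable {T K : ℕ} {U : Set (Param K)}

/-- Near `θ₀` the estimating function of the observation `z` has derivative and square bounded by
`b`, and it deviates from an affine function by at most `b` times a quadratic term. -/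
structure EstBound (γ : ℝ) (θ₀ : Param K) (t : ℝ) (z : Cov T K × Resp T) (b : ℝ) : Prop where
  snd_le : ∀ θ ∈ Metric.ball θ₀ t, ‖fderiv ℝ (fderiv ℝ fun θ => densPow γ θ z) θ‖ ≤ b
  sq_le : ∀ θ ∈ Metric.ball θ₀ t, ‖fderiv ℝ (fun θ => densPow γ θ z) θ‖ ^ 2 ≤ b
  approx : ∀ θ ∈ Metric.ball θ₀ t, ∀ θ' ∈ Metric.ball θ₀ t,
    ‖estFun γ θ z - estFun γ θ' z - estFunDeriv γ θ₀ z (θ - θ')‖ ≤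
      b * max ‖θ - θ₀‖ ‖θ' - θ₀‖ * ‖θ - θ'‖

lemma EstBound.norm_le {γ : ℝ} {θ₀ θ : Param K} {t b : ℝ} {z : Cov T K × Resp T}
    (h : EstBound γ θ₀ t z b) (hθ : θ ∈ Metric.ball θ₀ t) :
    ‖fderiv ℝ (fun θ => densPow γ θ z) θ‖ ≤ 1 + b := by
  nlinarith [h.sq_le θ hθ, sq_nonneg (‖fderiv ℝ (fun θ => densPow γ θ z) θ‖ - 1),
    norm_nonneg (fderiv ℝ (fun θ => densPow γ θ z) θ)]

/-- The bounds of `EstBound` hold almost surely, with an integrable function of the observation. -/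
structure IsControlled (γ : ℝ) (ρ : Measure (Cov T K × Resp T)) (U : Set (Param K)) (θ₀ : Param K)
    (t : ℝ) (L : Cov T K × Resp T → ℝ) : Prop where
  pos : 0 < t
  ball_subset : Metric.ball θ₀ t ⊆ U
  measurable : Measurable L
  integrable : Integrable L ρ
  bound : ∀ᵐ z ∂ρ, EstBound γ θ₀ t z (L z)

theorem exists_isControlled (hU : IsOpen U) (hUa : U ⊆ admissible K) {γ : ℝ} (hγ : 0 < γ)
    {θ₀ : Param K} (hθ₀ : θ₀ ∈ U) {ρ : Measure (Cov T K × Resp T)} [IsFiniteMeasure ρ]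
    {M : Fin K ⊕ Fin 2 → Fin K ⊕ Fin 2 → Fin K ⊕ Fin 2 → Cov T K × Resp T → ℝ}
    (hM : ∀ j k l, Integrable (M j k l) ρ)
    (hA3 : ∀ᵐ z ∂ρ, ∀ θ ∈ U, ∀ j k l,
      |pderiv j (pderiv k (pderiv l fun η => Real.exp (-(γ / 2) * quadForm η z.1 z.2))) θ|
        ≤ M j k l z) :
    ∃ t L, IsControlled γ ρ U θ₀ t L := by
  obtain ⟨t, ht, htU, C, hC, h⟩ := exists_bound_estFun (T := T) hU hUa hγ hθ₀
  have hi : Integrable (fun z => C * (1 + ∑ j, ∑ k, ∑ l, M j k l z)) ρ :=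
    ((integrable_const _).add (integrable_finsetSum _ fun j _ => integrable_finsetSum _ fun k _ =>
      integrable_finsetSum _ fun l _ => hM j k l)).const_mul C
  -- The majorants are only almost everywhere measurable, so a measurable version is taken.
  refine ⟨t, hi.1.mk _, ht, htU, hi.1.stronglyMeasurable_mk.measurable,
    hi.congr hi.1.ae_eq_mk, ?_⟩
  filter_upwards [hA3, hi.1.ae_eq_mk] with z hz he
  rw [← he]
  have hb := h z (fun j k l => M j k l z) hz
  exact ⟨fun θ hθ => (hb.1 θ hθ).1, fun θ hθ => (hb.1 θ hθ).2, hb.2⟩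

section Controlled

variable {γ : ℝ} {ρ : Measure (Cov T K × Resp T)} {θ₀ : Param K} {t : ℝ}
  {L : Cov T K × Resp T → ℝ} (hU : IsOpen U) (hUa : U ⊆ admissible K)
  (h : IsControlled γ ρ U θ₀ t L)

include h hU hUa

lemma IsControlled.integrable_fderiv [IsFiniteMeasure ρ] {θ : Param K}
    (hθ : θ ∈ Metric.ball θ₀ t) : Integrable (fun z => fderiv ℝ (fun θ => densPow γ θ z) θ) ρ := by
  refine ((integrable_const 1).add h.integrable).mono'
    (continuous_fderiv_densPow hU hUa γ (h.ball_subset hθ)).aestronglyMeasurable ?_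
  filter_upwards [h.bound] with z hz using hz.norm_le hθ

lemma IsControlled.integrable_fderiv_fderiv {θ : Param K} (hθ : θ ∈ Metric.ball θ₀ t) :
    Integrable (fun z => fderiv ℝ (fderiv ℝ fun θ => densPow γ θ z) θ) ρ := by
  refine h.integrable.mono'
    (continuous_fderiv_fderiv_densPow hU hUa γ (h.ball_subset hθ)).aestronglyMeasurable ?_
  filter_upwards [h.bound] with z hz using hz.snd_le θ hθ

lemma IsControlled.memLp_fderiv {θ : Param K} (hθ : θ ∈ Metric.ball θ₀ t) (v : Param K) :
    MemLp (fun z => fderiv ℝ (fun θ => densPow γ θ z) θ v) 2 ρ := by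
  have hc : Continuous fun z : Cov T K × Resp T => fderiv ℝ (fun θ => densPow γ θ z) θ v :=
    (continuous_fderiv_densPow hU hUa γ (h.ball_subset hθ)).clm_apply continuous_const
  rw [memLp_two_iff_integrable_sq hc.aestronglyMeasurable]
  refine (h.integrable.mul_const (‖v‖ ^ 2)).mono' (hc.pow 2).aestronglyMeasurable ?_
  filter_upwards [h.bound] with z hz
  rw [norm_pow]
  calc _ ≤ (‖fderiv ℝ (fun θ => densPow γ θ z) θ‖ * ‖v‖) ^ 2 := by
        gcongr; exact ContinuousLinearMap.le_opNorm _ _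
    _ ≤ _ := by rw [mul_pow]; gcongr; exact hz.sq_le θ hθ

lemma IsControlled.integrable_estFun [IsFiniteMeasure ρ] {θ : Param K}
    (hθ : θ ∈ Metric.ball θ₀ t) : Integrable (estFun γ θ) ρ :=
  (integrable_const _).sub ((h.integrable_fderiv hU hUa hθ).smul (1 / γ))

lemma IsControlled.integrable_estFunDeriv [IsFiniteMeasure ρ] {θ : Param K}
    (hθ : θ ∈ Metric.ball θ₀ t) : Integrable (estFunDeriv γ θ) ρ :=
  (integrable_const _).sub ((h.integrable_fderiv_fderiv hU hUa hθ).smul (1 / γ))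

omit h hU in
lemma integrable_densPow [IsFiniteMeasure ρ] (hγ : 0 < γ) {θ : Param K} (hθ : θ ∈ U) :
    Integrable (densPow γ θ) ρ := by
  refine (integrable_const (Real.exp (γ * logScale T θ))).mono'
    (continuous_densPow (hUa hθ) γ).aestronglyMeasurable (ae_of_all _ fun z => ?_)
  rw [Real.norm_of_nonneg (densPow_pos (hUa hθ) γ z).le, densPow, modelDensity_rpow (hUa hθ)]
  refine mul_le_of_le_one_right (Real.exp_pos _).le (Real.exp_le_one_iff.2 ?_)
  have := quadForm_nonneg (hUa hθ) z.1 z.2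
  nlinarith

lemma IsControlled.hasFDerivAt_integral [IsFiniteMeasure ρ] (hγ : 0 < γ) :
    HasFDerivAt (fun θ => ∫ z, densPow γ θ z ∂ρ)
      (∫ z, fderiv ℝ (fun θ => densPow γ θ z) θ₀ ∂ρ) θ₀ := by
  have hθ₀ := Metric.mem_ball_self h.pos (x := θ₀)
  refine hasFDerivAt_integral_of_dominated_of_fderiv_le
    (F' := fun θ z => fderiv ℝ (fun θ => densPow γ θ z) θ) (bound := fun z => 1 + L z)
    (Metric.ball_mem_nhds θ₀ h.pos) ?_ (integrable_densPow hUa hγ (h.ball_subset hθ₀))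
    (h.integrable_fderiv hU hUa hθ₀).1 ?_ ((integrable_const _).add h.integrable)
    (ae_of_all _ fun z θ hθ => ?_)
  · filter_upwards [Metric.ball_mem_nhds θ₀ h.pos] with θ hθ using
      (continuous_densPow (hUa (h.ball_subset hθ)) γ).aestronglyMeasurable
  · filter_upwards [h.bound] with z hz θ hθ using hz.norm_le hθ
  · exact (((contDiffOn_densPow hU hUa γ z).contDiffAt
      (hU.mem_nhds (h.ball_subset hθ))).differentiableAt (by norm_num)).hasFDerivAt

end Controlled

section Sample

variable {γ : ℝ} {ν : Measure (Cov T K)} [IsProbabilityMeasure ν] {g : Cov T K → Resp T → ℝ}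
  {θ₀ : Param K} {t : ℝ} {L : Cov T K × Resp T → ℝ} (hU : IsOpen U) (hUa : U ⊆ admissible K)
  (hγ : 0 < γ) (hgm : Measurable (Function.uncurry g)) (hg0 : ∀ x y, 0 ≤ g x y)
  (hg1 : ∀ᵐ x ∂ν, ∫ y, g x y = 1) (h : IsControlled γ (jointLaw ν g) U θ₀ t L)

include hU hUa hγ hgm hg0 hg1 in
/-- The density power divergence in terms of the integral of the power of the model density. -/
lemma dpd_eq {θ : Param K} (hθ : θ ∈ U) :
    dpd γ ν g θ = powInt T γ θ - (1 + 1 / γ) * ∫ z, densPow γ θ z ∂(jointLaw ν g) := by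
  have := isProbabilityMeasure_jointLaw hgm hg0 hg1
  have hi : Integrable (densPow γ θ) (jointLaw ν g) := integrable_densPow hUa hγ hθ
  have hc := integrable_condMean' hgm hg0 hi
  rw [← integral_condMean hgm hg0 hg1 hi, integral_comp_fst hgm hg0 hg1 hc.1, ← integral_const_mul]
  have hx : ∀ᵐ x ∂ν, ∫ y, (modelDensity θ x y ^ (1 + γ) -
      (1 + 1 / γ) * (modelDensity θ x y ^ γ * g x y)) =
      powInt T γ θ - (1 + 1 / γ) * condMean g (densPow γ θ) x := by
    filter_upwards [ae_integrable_smul hgm hg0 hi] with x hx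
    have h1 := (hasFDerivAt_integral_densPow hU hUa (show 0 < 1 + γ by linarith) hθ x).1
    have h2 : Integrable fun y => (1 + 1 / γ) * (modelDensity θ x y ^ γ * g x y) := by
      refine Integrable.const_mul ?_ _
      simpa [mul_comm, densPow] using hx
    rw [← integral_densPow (hUa hθ) γ x, condMean]
    refine (integral_sub h1 h2).trans ?_
    rw [integral_const_mul]
    simp only [densPow, smul_eq_mul, mul_comm]
  rw [dpd, integral_congr_ae hx, integral_sub (integrable_const _) (hc.const_mul _)]
  simp

include hU hUa hγ hgm hg0 hg1 h in
/-- At the best-fitting parameter the estimating function is centered. -/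
lemma IsControlled.integral_estFun {Θ₀ : Set (Param K)} (hUΘ : U ⊆ Θ₀)
    (hbest : IsMinOn (dpd γ ν g) Θ₀ θ₀) : ∫ z, estFun γ θ₀ z ∂(jointLaw ν g) = 0 := by
  have := isProbabilityMeasure_jointLaw hgm hg0 hg1
  have hθ₀ := Metric.mem_ball_self h.pos (x := θ₀)
  have hn := hU.mem_nhds (h.ball_subset hθ₀)
  have h1 : HasFDerivAt (powInt (K := K) T γ) (fderiv ℝ (powInt T γ) θ₀) θ₀ :=
    ((contDiffOn_powInt hUa γ).contDiffAt hn).differentiableAt (by norm_num) |>.hasFDerivAt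
  have h2 := h1.fun_sub ((h.hasFDerivAt_integral hU hUa hγ).const_mul (1 + 1 / γ))
  have h3 : IsLocalMin (fun θ => powInt T γ θ -
      (1 + 1 / γ) * ∫ z, densPow γ θ z ∂(jointLaw ν g)) θ₀ := by
    filter_upwards [hn] with θ hθ
    rw [← dpd_eq hU hUa hγ hgm hg0 hg1 hθ,
      ← dpd_eq hU hUa hγ hgm hg0 hg1 (h.ball_subset hθ₀)]
    exact hbest (hUΘ hθ)
  have h4 := h3.hasFDerivAt_eq_zero h2
  have hi := h.integrable_fderiv hU hUa hθ₀
  have h5 : ∫ z, estFun γ θ₀ z ∂(jointLaw ν g) = (1 / (1 + γ)) • fderiv ℝ (powInt T γ) θ₀ -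
      (1 / γ) • ∫ z, fderiv ℝ (fun θ => densPow γ θ z) θ₀ ∂(jointLaw ν g) := by
    have hs : Integrable (fun z => (1 / γ) • fderiv ℝ (fun θ => densPow γ θ z) θ₀)
      (jointLaw ν g) := hi.smul (1 / γ)
    have h6 := integral_sub (integrable_const ((1 / (1 + γ)) • fderiv ℝ (powInt T γ) θ₀)) hs
    rw [integral_const, integral_smul, probReal_univ, one_smul] at h6
    exact h6
  rw [h5]
  have h7 := congrArg (fun A => (1 / (1 + γ)) • A) h4
  simp only [smul_sub, smul_zero, smul_smul] at h7
  rw [← h7]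
  congr 2
  field_simp
  ring

/-- A covariate value at which the estimating function can be integrated against the conditional
density, uniformly in the parameter. -/
structure IsRegularCov (γ : ℝ) (g : Cov T K → Resp T → ℝ) (θ₀ : Param K) (t : ℝ)
    (L : Cov T K × Resp T → ℝ) (x : Cov T K) : Prop where
  integral_eq_one : ∫ y, g x y = 1
  integrable : Integrable fun y => g x y * L (x, y)
  bound : ∀ᵐ y, 0 < g x y → EstBound γ θ₀ t (x, y) (L (x, y))

include hgm hg0 hg1 h in
lemma IsControlled.ae_isRegularCov : ∀ᵐ x ∂ν, IsRegularCov γ g θ₀ t L x := by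
  filter_upwards [hg1, ae_integrable_smul hgm hg0 h.integrable, ae_ae_of_ae_jointLaw hgm h.bound]
    with x h1 h2 h3 using ⟨h1, h2, h3⟩

section Regular

variable {x : Cov T K} (hx : IsRegularCov γ g θ₀ t L x) (htU : Metric.ball θ₀ t ⊆ U)
include hU hUa hgm hg0 hx htU

lemma IsRegularCov.integrable_fderiv {θ : Param K} (hθ : θ ∈ Metric.ball θ₀ t) :
    Integrable fun y => g x y • fderiv ℝ (fun θ => densPow γ θ (x, y)) θ := by
  have hgx : Measurable (g x) := hgm.of_uncurry_left
  have hmk : Continuous fun y : Resp T => (x, y) := by fun_prop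
  have hc := (continuous_fderiv_densPow (T := T) hU hUa γ (htU hθ)).comp hmk
  refine ((integrable_of_integral_eq_one hx.integral_eq_one).add hx.integrable).mono'
    (hgx.aestronglyMeasurable.smul hc.aestronglyMeasurable) ?_
  filter_upwards [hx.bound] with y hy
  rw [norm_smul, Real.norm_of_nonneg (hg0 x y)]
  rcases (hg0 x y).eq_or_lt with h0 | h0
  · simp [← h0]
  · calc _ ≤ g x y * (1 + L (x, y)) := by gcongr; exact (hy h0).norm_le hθ
      _ = _ := by simp only [Pi.add_apply]; ring

lemma IsRegularCov.integrable_fderiv_fderiv {θ : Param K} (hθ : θ ∈ Metric.ball θ₀ t) :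
    Integrable fun y => g x y • fderiv ℝ (fderiv ℝ fun θ => densPow γ θ (x, y)) θ := by
  have hgx : Measurable (g x) := hgm.of_uncurry_left
  have hmk : Continuous fun y : Resp T => (x, y) := by fun_prop
  have hc := (continuous_fderiv_fderiv_densPow (T := T) hU hUa γ (htU hθ)).comp hmk
  refine hx.integrable.mono'
    (hgx.aestronglyMeasurable.smul hc.aestronglyMeasurable) ?_
  filter_upwards [hx.bound] with y hy
  rw [norm_smul, Real.norm_of_nonneg (hg0 x y)]
  rcases (hg0 x y).eq_or_lt with h0 | h0
  · simp [← h0]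
  · gcongr
    exact (hy h0).snd_le θ hθ

lemma IsRegularCov.integrable_sq_fderiv {θ : Param K} (hθ : θ ∈ Metric.ball θ₀ t) :
    Integrable fun y => g x y * ‖fderiv ℝ (fun θ => densPow γ θ (x, y)) θ‖ ^ 2 := by
  have hgx : Measurable (g x) := hgm.of_uncurry_left
  have hmk : Continuous fun y : Resp T => (x, y) := by fun_prop
  have hc := (continuous_fderiv_densPow (T := T) hU hUa γ (htU hθ)).comp hmk
  refine hx.integrable.mono'
    (hgx.aestronglyMeasurable.mul (hc.norm.pow 2).aestronglyMeasurable) ?_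
  filter_upwards [hx.bound] with y hy
  rw [norm_mul, Real.norm_of_nonneg (hg0 x y), norm_pow, norm_norm]
  rcases (hg0 x y).eq_or_lt with h0 | h0
  · simp [← h0]
  · gcongr
    exact (hy h0).sq_le θ hθ

lemma IsRegularCov.integrable_estFun {θ : Param K} (hθ : θ ∈ Metric.ball θ₀ t) :
    Integrable fun y => g x y • estFun γ θ (x, y) := by
  have h1 := (integrable_of_integral_eq_one hx.integral_eq_one).smul_const
    ((1 / (1 + γ)) • fderiv ℝ (powInt T γ) θ)
  refine (h1.sub ((hx.integrable_fderiv hU hUa hgm hg0 htU hθ).smul (1 / γ))).congr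
    (ae_of_all _ fun y => ?_)
  simp only [estFun, smul_sub, Pi.sub_apply, Pi.smul_apply, smul_comm (1 / γ)]

lemma IsRegularCov.integrable_estFunDeriv {θ : Param K} (hθ : θ ∈ Metric.ball θ₀ t) :
    Integrable fun y => g x y • estFunDeriv γ θ (x, y) := by
  have h1 := (integrable_of_integral_eq_one hx.integral_eq_one).smul_const
    ((1 / (1 + γ)) • fderiv ℝ (fderiv ℝ (powInt T γ)) θ)
  refine (h1.sub ((hx.integrable_fderiv_fderiv hU hUa hgm hg0 htU hθ).smul (1 / γ))).congr
    (ae_of_all _ fun y => ?_)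
  simp only [estFunDeriv, smul_sub, Pi.sub_apply, Pi.smul_apply, smul_comm (1 / γ)]

/-- The deviation from an affine function is inherited by the conditional expectation. -/
lemma IsRegularCov.norm_condMean_sub_le (ht : 0 < t) {θ θ' : Param K}
    (hθ : θ ∈ Metric.ball θ₀ t) (hθ' : θ' ∈ Metric.ball θ₀ t) :
    ‖condMean g (estFun γ θ) x - condMean g (estFun γ θ') x -
      condMean g (estFunDeriv γ θ₀) x (θ - θ')‖ ≤
      condMean g L x * max ‖θ - θ₀‖ ‖θ' - θ₀‖ * ‖θ - θ'‖ := by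
  have i1 := hx.integrable_estFun hU hUa hgm hg0 htU hθ
  have i2 := hx.integrable_estFun hU hUa hgm hg0 htU hθ'
  have i3 := hx.integrable_estFunDeriv hU hUa hgm hg0 htU (Metric.mem_ball_self ht)
  have i12 : Integrable fun y => g x y • estFun γ θ (x, y) - g x y • estFun γ θ' (x, y) :=
    i1.sub i2
  have i4 : Integrable fun y => (g x y • estFunDeriv γ θ₀ (x, y)) (θ - θ') :=
    i3.apply_continuousLinearMap (θ - θ')
  rw [condMean, condMean, condMean, ContinuousLinearMap.integral_apply i3, ← integral_sub i1 i2,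
    ← integral_sub i12 i4, condMean, mul_assoc, ← integral_mul_const]
  refine norm_integral_le_of_norm_le (hx.integrable.mul_const _) ?_
  filter_upwards [hx.bound] with y hy
  rw [smul_apply, ← smul_sub, ← smul_sub, norm_smul, Real.norm_of_nonneg (hg0 x y),
    smul_eq_mul, mul_assoc]
  rcases (hg0 x y).eq_or_lt with h0 | h0
  · simp [← h0]
  · gcongr
    rw [← mul_assoc]
    exact (hy h0).approx θ hθ θ' hθ'

end Regular

include hU hUa hγ hgm hg0 hg1 h in
theorem IsControlled.isLinearizable {Θ₀ : Set (Param K)} (hUΘ : U ⊆ Θ₀)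
    (hbest : IsMinOn (dpd γ ν g) Θ₀ θ₀) :
    IsLinearizable (jointLaw ν g) (estFun γ) (estFunDeriv γ θ₀) L θ₀ (t / 2) := by
  have := isProbabilityMeasure_jointLaw hgm hg0 hg1
  have hθ₀ := Metric.mem_ball_self h.pos (x := θ₀)
  have hsub : Metric.closedBall θ₀ (t / 2) ⊆ Metric.ball θ₀ t :=
    Metric.closedBall_subset_ball (half_lt_self h.pos)
  exact
    { pos := half_pos h.pos
      measurable_deriv := (continuous_estFunDeriv hU hUa (h.ball_subset hθ₀)).measurable
      integrable_deriv := h.integrable_estFunDeriv hU hUa hθ₀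
      measurable_bound := h.measurable
      integrable_bound := h.integrable
      measurable_center := (continuous_estFun hU hUa (h.ball_subset hθ₀)).measurable
      integrable_center := h.integrable_estFun hU hUa hθ₀
      integral_center := h.integral_estFun hU hUa hγ hgm hg0 hg1 hUΘ hbest
      approx := h.bound.mono fun z hz θ hθ θ' hθ' => hz.approx θ (hsub hθ) θ' (hsub hθ') }

include hU hUa hγ hgm hg0 hg1 h in
/-- The conditional expectation of the estimating function given the covariates can be linearized
in the same way, with the same expected derivative. -/
theorem IsControlled.isLinearizable_condMean {Θ₀ : Set (Param K)} (hUΘ : U ⊆ Θ₀)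
    (hbest : IsMinOn (dpd γ ν g) Θ₀ θ₀) :
    IsLinearizable (jointLaw ν g) (fun θ z => condMean g (estFun γ θ) z.1)
      (fun z => condMean g (estFunDeriv γ θ₀) z.1) (fun z => condMean g L z.1) θ₀ (t / 2) := by
  have := isProbabilityMeasure_jointLaw hgm hg0 hg1
  have hθ₀ := Metric.mem_ball_self h.pos (x := θ₀)
  have hsub : Metric.closedBall θ₀ (t / 2) ⊆ Metric.ball θ₀ t :=
    Metric.closedBall_subset_ball (half_lt_self h.pos)
  have hl := h.isLinearizable hU hUa hγ hgm hg0 hg1 hUΘ hbest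
  exact
    { pos := half_pos h.pos
      measurable_deriv := (measurable_condMean hgm hl.measurable_deriv).comp measurable_fst
      integrable_deriv := integrable_condMean hgm hg0 hg1 hl.integrable_deriv
      measurable_bound := (measurable_condMean hgm hl.measurable_bound).comp measurable_fst
      integrable_bound := integrable_condMean hgm hg0 hg1 hl.integrable_bound
      measurable_center := (measurable_condMean hgm hl.measurable_center).comp measurable_fst
      integrable_center := integrable_condMean hgm hg0 hg1 hl.integrable_center
      integral_center := by
        rw [integral_condMean hgm hg0 hg1 hl.integrable_center, hl.integral_center]
      approx := by
        refine ae_jointLaw_fst hgm hg0 hg1 (p := fun x => ∀ θ ∈ Metric.closedBall θ₀ (t / 2),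
          ∀ θ' ∈ Metric.closedBall θ₀ (t / 2),
          ‖condMean g (estFun γ θ) x - condMean g (estFun γ θ') x -
            condMean g (estFunDeriv γ θ₀) x (θ - θ')‖ ≤
            condMean g L x * max ‖θ - θ₀‖ ‖θ' - θ₀‖ * ‖θ - θ'‖) ?_
        filter_upwards [h.ae_isRegularCov hgm hg0 hg1] with x hx θ hθ θ' hθ'
        exact hx.norm_condMean_sub_le hU hUa hgm hg0 h.ball_subset h.pos (hsub hθ) (hsub hθ') }

end Sample

end Linearization

/-! ### The limits of the averages of the matrices `J` and `K` -/

section Limits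

set_option maxSynthPendingDepth 3

/-- A bilinear form given by a positive definite matrix is an isomorphism onto the dual space, with
inverse given by the inverse matrix. -/
lemma exists_equiv_of_posDef {ι : Type*} [Fintype ι] [DecidableEq ι]
    (A : EuclideanSpace ℝ ι →L[ℝ] EuclideanSpace ℝ ι →L[ℝ] ℝ) {M : Matrix ι ι ℝ} (hM : M.PosDef)
    (hA : ∀ j k, M j k = A (EuclideanSpace.single k 1) (EuclideanSpace.single j 1)) :
    ∃ e : EuclideanSpace ℝ ι ≃L[ℝ] (EuclideanSpace ℝ ι →L[ℝ] ℝ), A = e ∧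
      ∀ f t, inner ℝ (e.symm f) t = f (WithLp.toLp 2 (M⁻¹.mulVec t.ofLp)) := by
  have hAM : ∀ v w, A v w = w.ofLp ⬝ᵥ M.mulVec v.ofLp := fun v w => by
    rw [clm_apply_eq_sum (A v), dotProduct]
    refine Finset.sum_congr rfl fun j _ => ?_
    rw [clm_apply_eq_sum A, sum_apply, smul_eq_mul, Matrix.mulVec, dotProduct]
    congr 1
    refine Finset.sum_congr rfl fun k _ => ?_
    rw [smul_apply, ← hA, smul_eq_mul, mul_comm]
  have hinj : Function.Injective A := by
    rw [injective_iff_map_eq_zero]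
    intro v hv
    by_contra h0
    have h1 : v.ofLp ≠ 0 := fun h => h0 (by ext i; simp [h])
    have h2 := hM.dotProduct_mulVec_pos h1
    rw [star_trivial, ← hAM, hv, zero_apply] at h2
    exact lt_irrefl _ h2
  have hdim : Module.finrank ℝ (EuclideanSpace ℝ ι) =
      Module.finrank ℝ (EuclideanSpace ℝ ι →L[ℝ] ℝ) :=
    (InnerProductSpace.toDual ℝ (EuclideanSpace ℝ ι)).toLinearEquiv.finrank_eq
  let e := (LinearEquiv.ofInjectiveOfFinrankEq (A : EuclideanSpace ℝ ι →ₗ[ℝ] _) hinj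
    hdim).toContinuousLinearEquiv
  have he : ∀ v, e v = A v := fun v => rfl
  refine ⟨e, by ext v w; rfl, fun f t => ?_⟩
  obtain ⟨u, rfl⟩ := e.surjective f
  rw [e.symm_apply_apply, he, hAM]
  have hMt : M⁻¹.transpose = M⁻¹ := hM.inv.isHermitian.eq
  have hdet : IsUnit M.det := hM.det_pos.ne'.isUnit
  simp only
  rw [← Matrix.vecMul_transpose, hMt, ← Matrix.dotProduct_mulVec, Matrix.mulVec_mulVec,
    Matrix.nonsing_inv_mul _ hdet, Matrix.one_mulVec]
  simp [PiLp.inner_apply, dotProduct]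

variable {T K : ℕ} {U : Set (Param K)} {γ : ℝ} {ν : Measure (Cov T K)} [IsProbabilityMeasure ν]
  {g : Cov T K → Resp T → ℝ} {θ₀ : Param K} {t : ℝ} {L : Cov T K × Resp T → ℝ}
  (hU : IsOpen U) (hUa : U ⊆ admissible K)
  (hγ : 0 < γ) (hgm : Measurable (Function.uncurry g)) (hg0 : ∀ x y, 0 ≤ g x y)
  (hg1 : ∀ᵐ x ∂ν, ∫ y, g x y = 1) (h : IsControlled γ (jointLaw ν g) U θ₀ t L)
  {S : Type*} [MeasurableSpace S] {P : Measure S} [IsProbabilityMeasure P]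
  {X : ℕ → S → Cov T K} {Y : ℕ → S → Resp T}
  (h_indep : iIndepFun (fun i s => (X i s, Y i s)) P)
  (h_law : ∀ i, HasLaw (fun s => (X i s, Y i s)) (jointLaw ν g) P)

include hgm hg0 hg1 h_law in
omit [IsProbabilityMeasure P] in
lemma ae_forall_covariates {p : Cov T K → Prop} (hp : ∀ᵐ x ∂ν, p x) :
    ∀ᵐ s ∂P, ∀ i, p (X i s) := by
  rw [ae_all_iff]
  intro i
  have h1 := ae_jointLaw_fst hgm hg0 hg1 hp
  rw [← (h_law i).map_eq] at h1
  exact ae_of_ae_map (h_law i).aemeasurable h1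

include hgm hg0 hg1 h_indep h_law in
/-- The almost sure limit of averages over the covariates is the expectation. -/
lemma eq_integral_of_tendsto {F f : Cov T K → ℝ} (hf : Measurable f)
    (hfi : Integrable (fun z => f z.1) (jointLaw ν g)) (hF : ∀ᵐ x ∂ν, F x = f x) {c : ℝ}
    (hlim : ∀ᵐ s ∂P, Tendsto (fun N : ℕ => 1 / (N : ℝ) * ∑ i ∈ Finset.range N, F (X i s)) atTop
      (𝓝 c)) : c = ∫ z, f z.1 ∂(jointLaw ν g) := by
  have h1 := tendsto_avg_ae h_indep h_law (hf.comp measurable_fst) hfi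
  obtain ⟨s, hs, hs1, hs2⟩ := (hlim.and (h1.and
    (ae_forall_covariates hgm hg0 hg1 h_law hF))).exists
  refine tendsto_nhds_unique hs (hs1.congr fun N => ?_)
  rw [avg_eq_sum_range (Zs := fun i s => (X i s, Y i s)), smul_eq_mul, one_div]
  simp [hs2]

include hU hUa hγ hgm hg0 hg1 h h_indep h_law in
lemma IsControlled.limit_Jmat_eq {J : Matrix (Fin K ⊕ Fin 2) (Fin K ⊕ Fin 2) ℝ}
    (hJ : ∀ᵐ s ∂P, Tendsto
      (fun N : ℕ => (1 / (N : ℝ)) • ∑ i ∈ Finset.range N, Jmat γ g θ₀ (X i s)) atTop (𝓝 J))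
    (j k : Fin K ⊕ Fin 2) :
    J j k = (∫ z, estFunDeriv γ θ₀ z ∂(jointLaw ν g)) (EuclideanSpace.single k 1)
      (EuclideanSpace.single j 1) := by
  have := isProbabilityMeasure_jointLaw hgm hg0 hg1
  have hθ₀ := Metric.mem_ball_self h.pos (x := θ₀)
  have hi := h.integrable_estFunDeriv hU hUa hθ₀
  have hi' := integrable_condMean hgm hg0 hg1 hi
  have hm := measurable_condMean hgm
    (continuous_estFunDeriv (γ := γ) hU hUa (h.ball_subset hθ₀)).measurable
  set ej : Param K := EuclideanSpace.single j 1
  set ek : Param K := EuclideanSpace.single k 1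
  have hi1 : Integrable (fun z => condMean g (estFunDeriv γ θ₀) z.1 ek) (jointLaw ν g) :=
    hi'.apply_continuousLinearMap ek
  have hi2 : Integrable (fun z => condMean g (estFunDeriv γ θ₀) z.1 ek ej) (jointLaw ν g) :=
    hi1.apply_continuousLinearMap ej
  rw [← integral_condMean hgm hg0 hg1 hi, ContinuousLinearMap.integral_apply hi',
    ContinuousLinearMap.integral_apply hi1]
  refine eq_integral_of_tendsto hgm hg0 hg1 h_indep h_law (F := fun x => Jmat γ g θ₀ x j k)
    (f := fun x => condMean g (estFunDeriv γ θ₀) x ek ej)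
    ((hm.apply_continuousLinearMap ek).apply_continuousLinearMap ej) hi2 ?_ ?_
  · filter_upwards [h.ae_isRegularCov hgm hg0 hg1] with x hx
    exact Jmat_eq hU hUa hγ (h.ball_subset hθ₀) hx.integral_eq_one
      (hx.integrable_fderiv_fderiv hU hUa hgm hg0 h.ball_subset hθ₀) j k
  · filter_upwards [hJ] with s hs
    have h1 := tendsto_pi_nhds.1 (tendsto_pi_nhds.1 hs j) k
    simpa [Matrix.sum_apply] using h1

include hU hUa hgm hg0 hg1 h in
lemma IsControlled.condMean_sub_apply (v : Param K) : ∀ᵐ z ∂(jointLaw ν g),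
    (condMean g (estFun γ θ₀) z.1 - estFun γ θ₀ z) v =
      1 / γ * (fderiv ℝ (fun θ => densPow γ θ z) θ₀ v -
        condMean g (fun z => fderiv ℝ (fun θ => densPow γ θ z) θ₀ v) z.1) := by
  have hθ₀ := Metric.mem_ball_self h.pos (x := θ₀)
  filter_upwards [ae_jointLaw_fst hgm hg0 hg1 (h.ae_isRegularCov hgm hg0 hg1)] with z hz
  have hi := hz.integrable_fderiv hU hUa hgm hg0 h.ball_subset hθ₀
  rw [condMean_estFun hz.integral_eq_one hi, estFun, sub_sub_sub_cancel_left, sub_apply, smul_apply,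
    smul_apply, ContinuousLinearMap.integral_apply hi, condMean]
  simp only [smul_apply, smul_eq_mul]
  ring

include hU hUa hγ hgm hg0 hg1 h h_indep h_law in
/-- The limit of the matrices `K⁽ⁱ⁾` is the covariance matrix of the deviation of the estimating
function from its conditional expectation given the covariates. -/
lemma IsControlled.dotProduct_limit_Kmat_mulVec
    {Kc : Matrix (Fin K ⊕ Fin 2) (Fin K ⊕ Fin 2) ℝ}
    (hK : ∀ᵐ s ∂P, Tendsto
      (fun N : ℕ => (1 / (N : ℝ)) • ∑ i ∈ Finset.range N, Kmat γ g θ₀ (X i s)) atTop (𝓝 Kc))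
    (v : Param K) :
    v.ofLp ⬝ᵥ Kc.mulVec v.ofLp =
      ∫ z, ((condMean g (estFun γ θ₀) z.1 - estFun γ θ₀ z) v) ^ 2 ∂(jointLaw ν g) := by
  have := isProbabilityMeasure_jointLaw hgm hg0 hg1
  have hθ₀ := Metric.mem_ball_self h.pos (x := θ₀)
  set D : Cov T K × Resp T → ℝ := fun z => fderiv ℝ (fun θ => densPow γ θ z) θ₀ v with hD
  have hDm : Measurable D :=
    ((continuous_fderiv_densPow hU hUa γ (h.ball_subset hθ₀)).clm_apply continuous_const).measurable
  have hD2 : MemLp D 2 (jointLaw ν g) := h.memLp_fderiv hU hUa hθ₀ v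
  have hi2 : Integrable (fun z => D z ^ 2) (jointLaw ν g) := hD2.integrable_sq
  have hm1 := measurable_condMean hgm (hDm.pow_const 2)
  have hm2 := measurable_condMean hgm hDm
  set f : Cov T K → ℝ := fun x =>
    (1 / γ) ^ 2 * (condMean g (fun z => D z ^ 2) x - condMean g D x ^ 2) with hf
  have hfm : Measurable f := (hm1.sub (hm2.pow_const 2)).const_mul _
  have hfi : Integrable (fun z => f z.1) (jointLaw ν g) :=
    ((integrable_condMean hgm hg0 hg1 hi2).sub
      (memLp_condMean hgm hg0 hg1 hDm hD2).integrable_sq).const_mul _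
  have hlim : v.ofLp ⬝ᵥ Kc.mulVec v.ofLp = ∫ z, f z.1 ∂(jointLaw ν g) := by
    refine eq_integral_of_tendsto hgm hg0 hg1 h_indep h_law
      (F := fun x => v.ofLp ⬝ᵥ (Kmat γ g θ₀ x).mulVec v.ofLp) hfm hfi ?_ ?_
    · filter_upwards [h.ae_isRegularCov hgm hg0 hg1] with x hx
      exact dotProduct_Kmat_mulVec hU hUa hγ (h.ball_subset hθ₀)
        (hx.integrable_fderiv hU hUa hgm hg0 h.ball_subset hθ₀)
        (hx.integrable_sq_fderiv hU hUa hgm hg0 h.ball_subset hθ₀) hgm.of_uncurry_left (hg0 x) v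
    · filter_upwards [hK] with s hs
      have hc : Continuous fun A : Matrix (Fin K ⊕ Fin 2) (Fin K ⊕ Fin 2) ℝ =>
          v.ofLp ⬝ᵥ A.mulVec v.ofLp := by fun_prop
      refine ((hc.tendsto Kc).comp hs).congr fun N => ?_
      simp only [Function.comp, Matrix.smul_mulVec, dotProduct_smul, Matrix.sum_mulVec,
        dotProduct_sum, smul_eq_mul]
  have hconst : ∫ z, f z.1 ∂(jointLaw ν g) =
      (1 / γ) ^ 2 * ∫ z, (D z - condMean g D z.1) ^ 2 ∂(jointLaw ν g) := by
    rw [integral_sub_condMean_sq hgm hg0 hg1 hDm hD2,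
      integral_comp_fst hgm hg0 hg1 hfm.aestronglyMeasurable, hf, integral_const_mul]
  rw [hlim, hconst, ← integral_const_mul]
  refine integral_congr_ae ?_
  filter_upwards [h.condMean_sub_apply hU hUa hgm hg0 hg1 v] with z hz
  rw [hz, mul_pow]

include hU hUa hγ hgm hg0 hg1 h h_indep h_law in
lemma IsControlled.posSemidef_limit_Kmat
    {Kc : Matrix (Fin K ⊕ Fin 2) (Fin K ⊕ Fin 2) ℝ}
    (hK : ∀ᵐ s ∂P, Tendsto
      (fun N : ℕ => (1 / (N : ℝ)) • ∑ i ∈ Finset.range N, Kmat γ g θ₀ (X i s)) atTop (𝓝 Kc)) :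
    Kc.PosSemidef := by
  refine Matrix.PosSemidef.of_dotProduct_mulVec_nonneg ?_ fun v => ?_
  · obtain ⟨s, hs⟩ := hK.exists
    have hsymm : ∀ x, (Kmat γ g θ₀ x).transpose = Kmat γ g θ₀ x := fun x => by
      ext j k
      simp only [Matrix.transpose_apply, Kmat, Matrix.of_apply]
      simp only [mul_comm (score θ₀ x _ k), mul_comm (xiVec γ g θ₀ x k)]
    have hc : Continuous fun A : Matrix (Fin K ⊕ Fin 2) (Fin K ⊕ Fin 2) ℝ => A.transpose :=
      continuous_id.matrix_transpose
    -- The limit is symmetric because the individual matrices are.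
    refine tendsto_nhds_unique (((hc.tendsto Kc).comp hs).congr fun N => ?_) hs
    simp [Matrix.transpose_smul, Matrix.transpose_sum, hsymm]
  · have h1 := h.dotProduct_limit_Kmat_mulVec hU hUa hγ hgm hg0 hg1 h_indep h_law hK
      (WithLp.toLp 2 v)
    rw [star_trivial]
    refine le_of_le_of_eq ?_ h1.symm
    exact integral_nonneg fun z => sq_nonneg _

end Limits

/-! ### Asymptotic normality -/

section Normality

set_option maxSynthPendingDepth 3

variable {T K : ℕ} {U : Set (Param K)} {γ : ℝ} {ν : Measure (Cov T K)} [IsProbabilityMeasure ν]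
  {g : Cov T K → Resp T → ℝ} {θ₀ : Param K} {t : ℝ} {L : Cov T K × Resp T → ℝ}
  (hU : IsOpen U) (hUa : U ⊆ admissible K)
  (hγ : 0 < γ) (hgm : Measurable (Function.uncurry g)) (hg0 : ∀ x y, 0 ≤ g x y)
  (hg1 : ∀ᵐ x ∂ν, ∫ y, g x y = 1) (h : IsControlled γ (jointLaw ν g) U θ₀ t L)
  {Θ₀ : Set (Param K)} (hUΘ : U ⊆ Θ₀) (hbest : IsMinOn (dpd γ ν g) Θ₀ θ₀)
  {S : Type*} [MeasurableSpace S] {P : Measure S} [IsProbabilityMeasure P]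
  {X : ℕ → S → Cov T K} {Y : ℕ → S → Resp T}
  (h_indep : iIndepFun (fun i s => (X i s, Y i s)) P)
  (h_law : ∀ i, HasLaw (fun s => (X i s, Y i s)) (jointLaw ν g) P)

omit [IsProbabilityMeasure ν] in
include hU hUa h in
lemma IsControlled.memLp_estFun [IsFiniteMeasure (jointLaw ν g)] (v : Param K) :
    MemLp (fun z => estFun γ θ₀ z v) 2 (jointLaw ν g) :=
  (memLp_const (((1 / (1 + γ)) • fderiv ℝ (powInt T γ) θ₀) v)).sub
    ((h.memLp_fderiv hU hUa (Metric.mem_ball_self h.pos) v).const_mul (1 / γ))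

include hU hUa hgm hg0 hg1 h in
lemma IsControlled.memLp_condMean_estFun (v : Param K) :
    MemLp (fun z => condMean g (estFun γ θ₀) z.1 v) 2 (jointLaw ν g) := by
  have := isProbabilityMeasure_jointLaw hgm hg0 hg1
  have hθ₀ := Metric.mem_ball_self h.pos (x := θ₀)
  have hm : Measurable fun z : Cov T K × Resp T => estFun γ θ₀ z v := ((continuous_estFun hU hUa
    (h.ball_subset hθ₀)).clm_apply continuous_const).measurable
  refine (memLp_congr_ae ?_).1 (memLp_condMean hgm hg0 hg1 hm (h.memLp_estFun hU hUa v))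
  filter_upwards [ae_jointLaw_fst hgm hg0 hg1 (h.ae_isRegularCov hgm hg0 hg1)] with z hz
  exact (ContinuousLinearMap.integral_apply
    (hz.integrable_estFun hU hUa hgm hg0 h.ball_subset hθ₀) v).symm

include hU hUa hγ hgm hg0 hg1 h hUΘ hbest h_indep h_law in
/-- The difference of a consistent root of the estimating equations and of a consistent root of the
expected equations given the covariates is asymptotically normal: the conditional expectations of
the estimating functions cancel from the linearizations of the two equations. -/
theorem IsControlled.tendstoInDistribution {J Kc : Matrix (Fin K ⊕ Fin 2) (Fin K ⊕ Fin 2) ℝ}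
    (hJ : ∀ᵐ s ∂P, Tendsto
      (fun N : ℕ => (1 / (N : ℝ)) • ∑ i ∈ Finset.range N, Jmat γ g θ₀ (X i s)) atTop (𝓝 J))
    (hJpos : J.PosDef)
    (hK : ∀ᵐ s ∂P, Tendsto
      (fun N : ℕ => (1 / (N : ℝ)) • ∑ i ∈ Finset.range N, Kmat γ g θ₀ (X i s)) atTop (𝓝 Kc))
    {θh θg : ℕ → S → Param K} (hθhm : ∀ N, AEMeasurable (θh N) P)
    (hθgm : ∀ N, AEMeasurable (θg N) P)
    (hθh : Tendsto (fun p : ℕ × S => θh p.1 p.2) (probFilter P) (𝓝 θ₀))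
    (hθg : Tendsto (fun p : ℕ × S => θg p.1 p.2) (probFilter P) (𝓝 θ₀))
    (hrooth : ∀ᶠ p in probFilter P,
      avg (estFun γ (θh p.1 p.2)) (fun i : Fin p.1 => (X i p.2, Y i p.2)) = 0)
    (hrootg : ∀ᶠ p in probFilter P,
      IsExpectedRoot γ g (fun i : Fin p.1 => X i p.2) (θg p.1 p.2)) :
    TendstoInDistribution (fun (N : ℕ) s => √(N : ℝ) • (θh N s - θg N s)) atTop id (fun _ => P)
      (multivariateGaussian 0 (J⁻¹ * Kc * J⁻¹)) := by
  have := isProbabilityMeasure_jointLaw hgm hg0 hg1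
  have hθ₀ := Metric.mem_ball_self h.pos (x := θ₀)
  have hl := h.isLinearizable hU hUa hγ hgm hg0 hg1 hUΘ hbest
  have hlc := h.isLinearizable_condMean hU hUa hγ hgm hg0 hg1 hUΘ hbest
  obtain ⟨e, he, hsymm⟩ := exists_equiv_of_posDef _ hJpos
    (h.limit_Jmat_eq hU hUa hγ hgm hg0 hg1 h_indep h_law hJ)
  have hec : ∫ z, condMean g (estFunDeriv γ θ₀) z.1 ∂(jointLaw ν g) = e := by
    rw [integral_condMean hgm hg0 hg1 hl.integrable_deriv, he]
  have hcenter : ∀ {W : Cov T K × Resp T → Param K →L[ℝ] ℝ}, Integrable W (jointLaw ν g) →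
      ∫ z, W z ∂(jointLaw ν g) = 0 → ∀ v, ∫ z, W z v ∂(jointLaw ν g) = 0 := by
    intro W hW h0 v
    rw [← ContinuousLinearMap.integral_apply hW, h0, zero_apply]
  -- the conditional expectations vanish on average at the root given the covariates
  have hrootg' : ∀ᶠ p in probFilter P,
      avg (fun z : Cov T K × Resp T => condMean g (estFun γ (θg p.1 p.2)) z.1)
        (fun i : Fin p.1 => (X i p.2, Y i p.2)) = 0 := by
    have hreg := ae_forall_covariates hgm hg0 hg1 h_law (h.ae_isRegularCov hgm hg0 hg1)
    have hreg' : ∀ᶠ p in probFilter P, ∀ i, IsRegularCov γ g θ₀ t L (X i p.2) :=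
      eventually_probFilter_of_ae (Q := fun _ s => ∀ i, IsRegularCov γ g θ₀ t L (X i s))
        (hreg.mono fun s hs _ => hs)
    filter_upwards [hrootg, hreg', hθg (Metric.ball_mem_nhds θ₀ h.pos)] with p h1 h2 h3
    have h4 := sum_condMean_estFun_eq_zero hU hUa hγ (h.ball_subset h3)
      (x := fun i : Fin p.1 => X i p.2) (fun i => (h2 i).integral_eq_one)
      (fun i => (h2 i).integrable_fderiv hU hUa hgm hg0 h.ball_subset h3) h1
    rw [avg, h4, smul_zero]
  have hb1 := boundedInProb_sqrt_avg_dual h_indep h_law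
    (fun v => hl.measurable_center.apply_continuousLinearMap v) (h.memLp_estFun hU hUa)
    (hcenter hl.integrable_center hl.integral_center)
  have hb2 := boundedInProb_sqrt_avg_dual h_indep h_law
    (fun v => hlc.measurable_center.apply_continuousLinearMap v)
    (h.memLp_condMean_estFun hU hUa hgm hg0 hg1)
    (hcenter hlc.integrable_center hlc.integral_center)
  have h1 := tendsto_sqrt_smul_root h_indep h_law hl e he hb1 hθh hrooth
  have h2 := tendsto_sqrt_smul_root h_indep h_law hlc e hec hb2 hθg hrootg'
  -- the central limit theorem for the leading term
  set V : Cov T K × Resp T → Param K := fun z =>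
    e.symm (condMean g (estFun γ θ₀) z.1 - estFun γ θ₀ z) with hV
  have hVt : ∀ z t, inner ℝ (V z) t = (condMean g (estFun γ θ₀) z.1 - estFun γ θ₀ z)
      (WithLp.toLp 2 (J⁻¹.mulVec t.ofLp)) := fun z t => hsymm _ t
  have hJt : J⁻¹.transpose = J⁻¹ := hJpos.inv.isHermitian.eq
  have hKpos := h.posSemidef_limit_Kmat hU hUa hγ hgm hg0 hg1 h_indep h_law hK
  have hC : (J⁻¹ * Kc * J⁻¹).PosSemidef := by
    have := hKpos.conjTranspose_mul_mul_same J⁻¹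
    rwa [hJpos.inv.isHermitian.eq] at this
  have hclt := tendstoInDistribution_sqrt_avg h_indep h_law (V := V)
    (e.symm.continuous.measurable.comp (hlc.measurable_center.sub hl.measurable_center))
    (fun t => by
      simp only [hVt, sub_apply]
      exact (h.memLp_condMean_estFun hU hUa hgm hg0 hg1 _).sub (h.memLp_estFun hU hUa _))
    (fun t => by
      simp only [hVt]
      refine hcenter (hlc.integrable_center.sub hl.integrable_center) ?_ _
      have h3 := integral_sub hlc.integrable_center hl.integrable_center
      rw [hlc.integral_center, hl.integral_center, sub_zero] at h3
      exact h3)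
    hC (fun t => by
      simp only [hVt]
      rw [← h.dotProduct_limit_Kmat_mulVec hU hUa hγ hgm hg0 hg1 h_indep h_law hK]
      simp only
      rw [← Matrix.mulVec_mulVec, ← Matrix.mulVec_mulVec, Matrix.dotProduct_mulVec t.ofLp,
        ← Matrix.mulVec_transpose, hJt])
  refine tendstoInDistribution_of_tendstoInMeasure_sub _ _ hclt ?_
    (fun N => ((hθhm N).sub (hθgm N)).const_smul (√(N : ℝ)))
  refine tendstoInMeasure_const_iff.2 ((sub_zero (0 : Param K) ▸ h1.sub h2).congr fun p => ?_)
  have h3 : avg V (fun i : Fin p.1 => (X i p.2, Y i p.2)) =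
      e.symm (avg (fun z : Cov T K × Resp T => condMean g (estFun γ θ₀) z.1)
        (fun i : Fin p.1 => (X i p.2, Y i p.2))) -
      e.symm (avg (estFun γ θ₀) (fun i : Fin p.1 => (X i p.2, Y i p.2))) := by
    simp only [avg, hV, map_sub, map_smul, map_sum, Finset.sum_sub_distrib, smul_sub]
  simp only [Pi.sub_apply, h3, map_smul, smul_sub]
  abel

end Normality

end PanelDPD

open PanelDPD in
theorem theorem1 {T K : ℕ} (γ : ℝ) (hγ : 0 < γ)
    -- law of the covariates and true conditional density of the response
    (ν : Measure (Cov T K)) [IsProbabilityMeasure ν]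
    (g : Cov T K → Resp T → ℝ) (hg_meas : Measurable (Function.uncurry g))
    (hg_nonneg : ∀ x y, 0 ≤ g x y) (hg_int : ∀ᵐ x ∂ν, ∫ y, g x y = 1)
    -- the random sample
    {S : Type*} [MeasurableSpace S] (P : Measure S) [IsProbabilityMeasure P]
    (X : ℕ → S → Cov T K) (Y : ℕ → S → Resp T)
    (h_indep : iIndepFun (fun i s => (X i s, Y i s)) P)
    (h_law : ∀ i, HasLaw (fun s => (X i s, Y i s)) (jointLaw ν g) P)
    -- parameter space and best-fitting parameter
    (Θ₀ : Set (Param K)) (hΘ₀ : Θ₀ ⊆ admissible K)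
    (θ₀ : Param K) (h_best : IsMinOn (dpd γ ν g) Θ₀ θ₀)
    -- (A1)
    (hA1 : ∀ᵐ x ∂ν, (volume.withDensity fun y => ENNReal.ofReal (g x y)).IsOpenPosMeasure)
    -- (A2), with `J θ` and `Kc` the limits of the averages of the individual matrices
    (U : Set (Param K)) (hU_open : IsOpen U) (hU_sub : U ⊆ Θ₀) (hθ₀ : θ₀ ∈ U)
    (J : Param K → Matrix (Fin K ⊕ Fin 2) (Fin K ⊕ Fin 2) ℝ)
    (hJ : ∀ θ ∈ U, ∀ᵐ s ∂P, Tendsto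
      (fun N : ℕ => (1 / (N : ℝ)) • ∑ i ∈ Finset.range N, Jmat γ g θ (X i s)) atTop (𝓝 (J θ)))
    (Kc : Matrix (Fin K ⊕ Fin 2) (Fin K ⊕ Fin 2) ℝ)
    (hK : ∀ᵐ s ∂P, Tendsto
      (fun N : ℕ => (1 / (N : ℝ)) • ∑ i ∈ Finset.range N, Kmat γ g θ₀ (X i s)) atTop (𝓝 Kc))
    (hA2 : ∀ θ ∈ U, (J θ).PosDef)
    -- (A3)
    (M : Fin K ⊕ Fin 2 → Fin K ⊕ Fin 2 → Fin K ⊕ Fin 2 → Cov T K × Resp T → ℝ)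
    (hM : ∀ j k l, Integrable (M j k l) (jointLaw ν g))
    (hA3 : ∀ᵐ z ∂(jointLaw ν g), ∀ θ ∈ U, ∀ j k l,
      |pderiv j (pderiv k (pderiv l fun η => Real.exp (-(γ / 2) * quadForm η z.1 z.2))) θ|
        ≤ M j k l z) :
    -- an estimator, that is, a measurable function of the sample of size `N`
    ∃ θhat : (N : ℕ) → (Fin N → Cov T K × Resp T) → Param K,
      (∀ N, Measurable (θhat N)) ∧
      -- with probability tending to one it is a root of the estimating equations
      Tendsto (fun N : ℕ => P {s | ¬ (θhat N (fun i => (X i s, Y i s)) ∈ Θ₀ ∧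
          IsRootEE γ (fun i : Fin N => (X i s, Y i s)) (θhat N (fun i => (X i s, Y i s))))})
        atTop (𝓝 0) ∧
      -- (i) consistency
      TendstoInMeasure P (fun N s => θhat N (fun i => (X i s, Y i s))) atTop (fun _ => θ₀) ∧
      -- (ii) asymptotic normality, when `θ₀` solves the expected estimating equations for
      -- every sample size
      ((∀ᵐ s ∂P, ∀ N : ℕ, IsExpectedRoot γ g (fun i : Fin N => X i s) θ₀) →
        TendstoInDistribution
          (fun (N : ℕ) s => √(N : ℝ) • (θhat N (fun i => (X i s, Y i s)) - θ₀))
          atTop id (fun _ => P)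
          (multivariateGaussian 0 ((J θ₀)⁻¹ * Kc * (J θ₀)⁻¹))) ∧
      -- (ii) in general: asymptotic normality around the solutions of the expected estimating
      -- equations given the covariates
      (∀ θg : ℕ → S → Param K,
        (∀ N, AEMeasurable (θg N) P) →
        TendstoInMeasure P θg atTop (fun _ => θ₀) →
        Tendsto (fun N : ℕ => P {s | ¬ (θg N s ∈ Θ₀ ∧
            IsExpectedRoot γ g (fun i : Fin N => X i s) (θg N s))}) atTop (𝓝 0) →
        TendstoInDistribution
          (fun (N : ℕ) s => √(N : ℝ) • (θhat N (fun i => (X i s, Y i s)) - θg N s))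
          atTop id (fun _ => P)
          (multivariateGaussian 0 ((J θ₀)⁻¹ * Kc * (J θ₀)⁻¹))) := by
  have hUa := hU_sub.trans hΘ₀
  have := isProbabilityMeasure_jointLaw hg_meas hg_nonneg hg_int
  obtain ⟨t, L, h⟩ := exists_isControlled hU_open hUa hγ hθ₀ hM hA3
  have hl := h.isLinearizable hU_open hUa hγ hg_meas hg_nonneg hg_int hU_sub h_best
  obtain ⟨e, he, -⟩ := exists_equiv_of_posDef _ (hA2 θ₀ hθ₀)
    (h.limit_Jmat_eq hU_open hUa hγ hg_meas hg_nonneg hg_int h_indep h_law (hJ θ₀ hθ₀))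
  have hsub : Metric.closedBall θ₀ (t / 2) ⊆ U :=
    (Metric.closedBall_subset_ball (half_lt_self h.pos)).trans h.ball_subset
  obtain ⟨θhat, hmeas, hroot, hlim⟩ := exists_measurable_root h_indep h_law hl
    (fun θ hθ => (continuous_estFun hU_open hUa (hsub hθ)).measurable)
    (fun z θ hθ => (hasFDerivAt_estFun hU_open hUa (hsub hθ) z).continuousAt.continuousWithinAt)
    e he
  have hdata : ∀ N : ℕ, AEMeasurable (fun s (i : Fin N) => (X i s, Y i s)) P := fun N =>
    aemeasurable_pi_iff.2 fun i => (h_law i).aemeasurable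
  have hnormal : ∀ θg : ℕ → S → Param K, (∀ N, AEMeasurable (θg N) P) →
      Tendsto (fun p : ℕ × S => θg p.1 p.2) (probFilter P) (𝓝 θ₀) →
      (∀ᶠ p in probFilter P, IsExpectedRoot γ g (fun i : Fin p.1 => X i p.2) (θg p.1 p.2)) →
      TendstoInDistribution
        (fun (N : ℕ) s => √(N : ℝ) • (θhat N (fun i => (X i s, Y i s)) - θg N s)) atTop id
        (fun _ => P) (multivariateGaussian 0 ((J θ₀)⁻¹ * Kc * (J θ₀)⁻¹)) :=
    fun θg h1 h2 h3 => h.tendstoInDistribution hU_open hUa hγ hg_meas hg_nonneg hg_int hU_sub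
      h_best h_indep h_law (hJ θ₀ hθ₀) (hA2 θ₀ hθ₀) hK
      (fun N => (hmeas N).comp_aemeasurable (hdata N)) h1 hlim h2 (hroot.mono fun p hp => hp.2) h3
  refine ⟨θhat, hmeas, ?_, tendstoInMeasure_const_iff.2 hlim, fun hE => ?_, fun θg h1 h2 h3 => ?_⟩
  · refine eventually_probFilter.1 ?_
    filter_upwards [hroot, tendsto_fst_probFilter.eventually (eventually_gt_atTop 0)] with p hp hN
    refine ⟨hU_sub (hsub hp.1), ?_⟩
    have hd := hasFDerivAt_empDPD hU_open hUa hγ hN (fun i : Fin p.1 => (X i p.2, Y i p.2))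
      (hsub hp.1)
    rw [hp.2, smul_zero] at hd
    exact hd
  · exact hnormal (fun _ _ => θ₀) (fun _ => aemeasurable_const) tendsto_const_nhds
      (eventually_probFilter_of_ae
        (Q := fun N s => IsExpectedRoot γ g (fun i : Fin N => X i s) θ₀) hE)
  · exact hnormal θg h1 (tendstoInMeasure_const_iff.1 h2)
      ((eventually_probFilter.2 h3).mono fun p hp => hp.2)
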